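/- Let $d\in\mathbb N$, let $\Omega=C(\mathbb R_+;\mathbb R^d)$ carry the locally uniform topology, its Borel $\sigma$-field, the canonical process $X_t(\omega)=\omega(t)$ and the canonical filtration $\mathcal F_t=\sigma(X_s,\,s\le t)$. Let $F$ be a metrizable space, and let $b\colon F\times\mathbb R^d\to\mathbb R^d$ and $a\colon\mathbb R^d\to\mathbb S^d_+$ (the symmetric positive semidefinite real $d\times d$ matrices) be functions such that $F$ is compact, $b$ and $a$ are continuous, and there is a constant $\mathsf C>0$ with $$\|b(f,x)\|\le\mathsf C,\qquad \frac{\|\xi\|^2}{\mathsf C}\le\langle\xi,a(x)\xi\rangle\le\mathsf C\|\xi\|^2\qquad\text{for all }f\in F,\ x,\xi\in\mathbb R^d.$$ Set $\Theta(x)=\{(b(f,x),a(x))\colon f\in F\}$. For $x\in\mathbb R^d$ let $\mathcal R(x)$ be the set of all probability measures $P$ on $\Omega$ such that $P\circ X_0^{-1}=\delta_x$, the process $X$ is under $P$ a continuous semimartingale whose characteristics $(B^P,C^P)$ are $P$-a.s. absolutely continuous with respect to Lebesgue measure $\lambda$ on $\mathbb R_+$, and $(dB^P/d\lambda,dC^P/d\lambda)\in\Theta(X)$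 holds $(\lambda\otimes P)$-a.e. For a function $\psi\colon\Omega\to[-\infty,\infty]$ that is upper semianalytic (i.e. $\{\psi>c\}$ is an analytic set for every $c\in\mathbb R$) put $$\mathcal E^x(\psi)=\sup_{P\in\mathcal R(x)}E^P[\psi],\qquad E^P[\psi]=E^P[\psi^+]-E^P[\psi^-],$$ with the conventions $\infty-\infty=-\infty$ and $\sup\emptyset=-\infty$. For $t\in\mathbb R_+$ let $\theta_t\colon\Omega\to\Omega$, $\theta_t(\omega)=\omega(\,\cdot+t)$. Then, for every upper semianalytic $\psi\colon\Omega\to[-\infty,\infty]$ and every $(t,x)\in\mathbb R_+\times\mathbb R^d$, the function $\omega\mapsto\mathcal E^{X_t(\omega)}(\psi)$ is upper semianalytic on $\Omega$, and if the expectation of $\psi\circ\theta_t$ exists under every $P\in\mathcal R(x)$, that is, $E^P[(\psi\circ\theta_t)^+]$ and $E^P[(\psi\circ\theta_t)^-]$ are not both infinite, then $$\mathcal E^x(\psi\circ\theta_t)=\mathcal E^x\big(\mathcal E^{X_t}(\psi)\big).$$ -/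

import Mathlib

open MeasureTheory ProbabilityTheory Set
open scoped NNReal ENNReal

noncomputable section

namespace NonlinearDiffusion

/-- The Euclidean space `ℝ^d`. -/
abbrev E (d : ℕ) : Type := EuclideanSpace ℝ (Fin d)

/-- The path space of continuous functions `ℝ₊ → ℝ^d`, with Mathlib's compact-open topology, i.e.
the topology of locally uniform convergence. -/
abbrev PathSpace (d : ℕ) : Type := C(ℝ≥0, E d)

instance instMeasurableSpacePathSpace (d : ℕ) : MeasurableSpace (PathSpace d) :=
  borel (PathSpace d)

instance instBorelSpacePathSpace (d : ℕ) : BorelSpace (PathSpace d) := ⟨rfl⟩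

/-- The canonical process `X_t(ω) = ω(t)`. -/
def X {d : ℕ} (t : ℝ≥0) (ω : PathSpace d) : E d := ω t

theorem continuous_X {d : ℕ} (t : ℝ≥0) : Continuous (X (d := d) t) :=
  ContinuousEvalConst.continuous_eval_const t

/-- The canonical filtration `𝓕_t = σ(X_s, s ≤ t)`. -/
def canonicalFiltration (d : ℕ) :
    Filtration ℝ≥0 (inferInstance : MeasurableSpace (PathSpace d)) :=
  Filtration.natural (X (d := d)) fun t => (continuous_X t).measurable.stronglyMeasurable

/-- The shift `θ_t(ω) = ω(· + t)`. -/
def shift {d : ℕ} (t : ℝ≥0) (ω : PathSpace d) : PathSpace d :=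
  ω.comp ⟨fun s => s + t, by fun_prop⟩

/-- Lebesgue measure on `ℝ₊ = [0, ∞)`. -/
def lebesgue : Measure ℝ≥0 := (volume : Measure ℝ).comap ((↑) : ℝ≥0 → ℝ)

/-- Real-valued local martingales for the canonical filtration. -/
def IsLocalMartingale {d : ℕ} (P : Measure (PathSpace d)) (M : ℝ≥0 → PathSpace d → ℝ) : Prop :=
  Locally (fun Y => Martingale Y (canonicalFiltration d) P) (canonicalFiltration d) M P

/-- The martingale part `X - X_0 - B`. -/
def martPart {d : ℕ} (B : ℝ≥0 → PathSpace d → E d) (t : ℝ≥0) (ω : PathSpace d) : E d :=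
  X t ω - X 0 ω - B t ω

/-- The coordinate process is under `P` a continuous semimartingale with characteristics `(B, C)`:
`X = X_0 + B + M`, where `B` is an adapted continuous process of finite variation starting at `0`,
`M` is a continuous local martingale, and `C` is the quadratic covariation of `M`, i.e. the adapted
continuous process of finite variation starting at `0` such that all `M^i M^j - C^{ij}` are local
martingales. Path properties are required almost surely, so that adaptedness to the (not augmented)
canonical filtration is no restriction, and `(B, C)` is unique up to indistinguishability. -/
structure HasCharacteristics {d : ℕ} (P : Measure (PathSpace d))
    (B : ℝ≥0 → PathSpace d → E d)
    (C : ℝ≥0 → PathSpace d → Matrix (Fin d) (Fin d) ℝ) : Prop where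
  adapted_fst : StronglyAdapted (canonicalFiltration d) B
  zero_fst : ∀ᵐ ω ∂P, B 0 ω = 0
  continuous_fst : ∀ᵐ ω ∂P, Continuous fun t => B t ω
  variation_fst : ∀ᵐ ω ∂P, LocallyBoundedVariationOn (fun t => B t ω) univ
  adapted_snd : ∀ i j, StronglyAdapted (canonicalFiltration d) fun t ω => C t ω i j
  zero_snd : ∀ᵐ ω ∂P, C 0 ω = 0
  continuous_snd : ∀ᵐ ω ∂P, ∀ i j, Continuous fun t => C t ω i j
  variation_snd : ∀ᵐ ω ∂P, ∀ i j, LocallyBoundedVariationOn (fun t => C t ω i j) univ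
  localMartingale : ∀ i, IsLocalMartingale P fun t ω => martPart B t ω i
  covariation : ∀ i j, IsLocalMartingale P fun t ω =>
    martPart B t ω i * martPart B t ω j - C t ω i j

/-- `P`-a.s. `A ≪ λ` with Lebesgue density `dA/dλ = h`: almost every path of `A` is the
indefinite Lebesgue integral of the locally integrable path of `h`. -/
structure HasLebesgueDensity {d : ℕ} (P : Measure (PathSpace d))
    (A h : ℝ≥0 → PathSpace d → ℝ) : Prop where
  measurable : Measurable (Function.uncurry h)
  integrable : ∀ᵐ ω ∂P, ∀ t, IntegrableOn (fun s => h s ω) (Iic t) lebesgue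
  eq_integral : ∀ᵐ ω ∂P, ∀ t, A t ω = ∫ s in Iic t, h s ω ∂lebesgue

/-- The coordinate process is under `P` a continuous semimartingale whose characteristics `(B, C)`
are absolutely continuous with `(dB/dλ, dC/dλ) = (β, γ)`. -/
def HasDifferentialCharacteristics {d : ℕ} (P : Measure (PathSpace d))
    (β : ℝ≥0 → PathSpace d → E d)
    (γ : ℝ≥0 → PathSpace d → Matrix (Fin d) (Fin d) ℝ) : Prop :=
  ∃ B C, HasCharacteristics P B C ∧
    (∀ i, HasLebesgueDensity P (fun t ω => B t ω i) fun t ω => β t ω i) ∧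
    (∀ i j, HasLebesgueDensity P (fun t ω => C t ω i j) fun t ω => γ t ω i j)

/-- The set of laws of continuous semimartingales. -/
def semimartingaleLaws (d : ℕ) : Set (ProbabilityMeasure (PathSpace d)) :=
  {P | ∃ B C, HasCharacteristics (P : Measure (PathSpace d)) B C}

/-- The set of laws of continuous semimartingales with absolutely continuous characteristics. -/
def acSemimartingaleLaws (d : ℕ) : Set (ProbabilityMeasure (PathSpace d)) :=
  {P | P ∈ semimartingaleLaws d ∧
    ∃ β γ, HasDifferentialCharacteristics (P : Measure (PathSpace d)) β γ}

/-- The correspondence `Θ(x) = {(b(f, x), a(x)) : f ∈ F}`. -/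
def Theta {d : ℕ} {F : Type*} (b : F × E d → E d) (a : E d → Matrix (Fin d) (Fin d) ℝ)
    (x : E d) : Set (E d × Matrix (Fin d) (Fin d) ℝ) :=
  {p | ∃ f : F, p = (b (f, x), a x)}

/-- The set `𝓡(x)` of laws of continuous semimartingales with initial value `x` and absolutely
continuous characteristics whose densities take `(λ ⊗ P)`-a.e. values in `Θ(X)`. -/
def R {d : ℕ} {F : Type*} (b : F × E d → E d) (a : E d → Matrix (Fin d) (Fin d) ℝ)
    (x : E d) : Set (ProbabilityMeasure (PathSpace d)) :=
  {P | P ∈ acSemimartingaleLaws d ∧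
    (P : Measure (PathSpace d)).map (X 0) = Measure.dirac x ∧
    ∃ β γ, HasDifferentialCharacteristics (P : Measure (PathSpace d)) β γ ∧
      ∀ᵐ p ∂(lebesgue.prod (P : Measure (PathSpace d))),
        (β p.1 p.2, γ p.1 p.2) ∈ Theta b a (X p.1 p.2)}

/-- The standing condition on the coefficients: the parameter space `F` is compact, `b` and `a` are
continuous, `b` is bounded, and `a` is bounded and uniformly elliptic. -/
structure BoundedElliptic {d : ℕ} {F : Type*} [TopologicalSpace F] (b : F × E d → E d)
    (a : E d → Matrix (Fin d) (Fin d) ℝ) : Prop where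
  compact : CompactSpace F
  continuous_b : Continuous b
  continuous_a : Continuous a
  bounds : ∃ K : ℝ, 0 < K ∧ ∀ (f : F) (x ξ : E d), ‖b (f, x)‖ ≤ K ∧
    ‖ξ‖ ^ 2 / K ≤ ξ.ofLp ⬝ᵥ (a x).mulVec ξ.ofLp ∧
    ξ.ofLp ⬝ᵥ (a x).mulVec ξ.ofLp ≤ K * ‖ξ‖ ^ 2

/-- Upper semianalytic functions: all sets `{ψ > c}`, `c ∈ ℝ`, are analytic. -/
def UpperSemianalytic {S : Type*} [TopologicalSpace S] (ψ : S → EReal) : Prop :=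
  ∀ c : ℝ, AnalyticSet {s | (c : EReal) < ψ s}

/-- `E^P[ψ⁺]`. -/
def posExpectation {d : ℕ} (P : ProbabilityMeasure (PathSpace d)) (ψ : PathSpace d → EReal) :
    ℝ≥0∞ := ∫⁻ ω, (ψ ω).toENNReal ∂(P : Measure (PathSpace d))

/-- `E^P[ψ⁻]`. -/
def negExpectation {d : ℕ} (P : ProbabilityMeasure (PathSpace d)) (ψ : PathSpace d → EReal) :
    ℝ≥0∞ := ∫⁻ ω, (-ψ ω).toENNReal ∂(P : Measure (PathSpace d))

/-- The extended expectation `E^P[ψ] = E^P[ψ⁺] - E^P[ψ⁻]`, with the convention `∞ - ∞ = -∞`, which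
is the one of subtraction in `EReal`. -/
def expectation {d : ℕ} (P : ProbabilityMeasure (PathSpace d)) (ψ : PathSpace d → EReal) : EReal :=
  (posExpectation P ψ : EReal) - (negExpectation P ψ : EReal)

/-- `E^P[ψ]` exists, i.e. is not of the form `∞ - ∞`. -/
def ExpectationExists {d : ℕ} (P : ProbabilityMeasure (PathSpace d))
    (ψ : PathSpace d → EReal) : Prop :=
  posExpectation P ψ ≠ ⊤ ∨ negExpectation P ψ ≠ ⊤

/-- The sublinear expectation `𝓔^x(ψ) = sup_{P ∈ 𝓡(x)} E^P[ψ]`. -/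
def sublinearExpectation {d : ℕ} {F : Type*} (b : F × E d → E d)
    (a : E d → Matrix (Fin d) (Fin d) ℝ) (x : E d) (ψ : PathSpace d → EReal) : EReal :=
  ⨆ P ∈ R b a x, expectation P ψ

end NonlinearDiffusion

end

/-! The identity is the dynamic programming principle. It rests on two stability properties of the
family `R b a x` and on a measurable selection. Conditioning: for `P` in `R b a x`, the conditional
law of the shifted path given the path up to time `t` belongs almost surely to `R b a (X t ω)`. Its
expectation of `ψ` is therefore at most the inner sublinear expectation at `X t ω`, and integrating
over the past gives `≤`. Gluing: following `P` up to time `t` and then a law `Q y` in `R b a y`,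
chosen measurably in `y = X t`, produces a law in `R b a x` again. Taking `Q y` nearly optimal gives
`≥`; the existence of the expectation excludes `∞ - ∞` under the glued law.

Both stability properties become manageable once localization is removed. The diffusion component of
`Theta` is the single value `a x`, and all coefficients are bounded. Hence the brackets grow at most
linearly, the local martingales are square integrable martingales, and the drift density has a
version `β` that depends exactly on the past. By `mem_R_iff`, membership in `R b a x` means starting
at `x` and being a controlled law for some `β`: the increments of `X - ∫ β` are orthogonal to the
past with conditional covariance `∫ a(X)`, and `β` lies in `b(F, X)`. Such conditions disintegrate
(`IsControlledLaw.ae_tail`) and paste (`isControlledLaw_glueLaw`). They reduce to countably many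
integral identities, over a π-system of events and a dense set of times, so null sets can be
collected and the conditions are Borel in parameters.

For the selection, controls and laws are coded by points of the Polish space `ℕ → ℕ → ℕ`. The strict
subgraph of `ψ` is the continuous image of the Baire space, so `c < E^P[ψ]` holds exactly when `P`
lifts to a law on the Baire space with a real-valued integral above `c` (`lt_extIntegral_iff`).
Consequently `{(y, c) | c < 𝓔^y(ψ)}` is the projection of a Borel set of codes
(`lt_sublinearExpectation_iff`). This yields upper semianalyticity, and the Jankov–von Neumann
theorem yields a measurable family of nearly optimal laws together with their controls
(`exists_kernel_lt_extIntegral`). -/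

open MeasureTheory ProbabilityTheory Set
open scoped NNReal ENNReal

noncomputable section

namespace NonlinearDiffusion

/-! ### Analytic sets, measurable selection, and universal parametrizations. -/

section DescriptiveSetTheory

open Filter Topology

/-- An open neighbourhood of the compact box `{z | z ≤ n}` of the Baire space contains all
sequences that are bounded by `n` up to some index. -/
theorem exists_prefix_box_subset (n : ℕ → ℕ) {W : Set (ℕ → ℕ)} (hW : IsOpen W)
    (h : {z : ℕ → ℕ | ∀ i, z i ≤ n i} ⊆ W) :
    ∃ k, {z : ℕ → ℕ | ∀ i < k, z i ≤ n i} ⊆ W := by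
  by_contra! hcon
  have hcon' : ∀ k, ∃ z : ℕ → ℕ, (∀ i < k, z i ≤ n i) ∧ z ∉ W := by
    intro k
    obtain ⟨z, hz, hzW⟩ := Set.not_subset.1 (hcon k)
    exact ⟨z, hz, hzW⟩
  choose z hz hzW using hcon'
  have hK : IsCompact {z : ℕ → ℕ | ∀ i, z i ≤ n i} := by
    have : {z : ℕ → ℕ | ∀ i, z i ≤ n i} = Set.pi univ fun i => Iic (n i) := by
      ext z; simp [Pi.le_def]
    rw [this]
    exact isCompact_univ_pi fun i => (Set.finite_Iic (n i)).isCompact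
  -- Truncating `z k` at `n` puts it into the compact box. Coordinate `i` is unaffected once `k >
  -- i`, so the subsequential limit is also a limit of the untruncated sequences.
  obtain ⟨y, hy, φ, hφ, hlim⟩ := hK.tendsto_subseq
    (x := fun k i => min (z k i) (n i)) (fun k i => min_le_right _ _)
  have hlim' : Tendsto (fun j => z (φ j)) atTop (𝓝 y) := by
    rw [tendsto_pi_nhds] at hlim ⊢
    intro i
    refine (hlim i).congr' ?_
    filter_upwards [eventually_gt_atTop i] with j hj
    have : i < φ j := hj.trans_le (hφ.id_le j)
    simpa using hz (φ j) i this
  exact hW.isClosed_compl.mem_of_tendsto hlim' (Eventually.of_forall fun j => hzW _) (h hy)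

/-- Choquet's capacitability theorem for the range of a continuous map on the Baire space. -/
theorem exists_isCompact_lt_measure {Y : Type*} [TopologicalSpace Y] [T2Space Y]
    [MeasurableSpace Y] [BorelSpace Y] (μ : Measure Y) [μ.OuterRegular]
    {f : (ℕ → ℕ) → Y} (hf : Continuous f) {c : ℝ≥0∞} (hc : c < μ (range f)) :
    ∃ K ⊆ range f, IsCompact K ∧ c ≤ μ K := by
  let N : List ℕ → Set (ℕ → ℕ) := fun l => {z | ∀ i (hi : i < l.length), z i ≤ l[i]}
  -- `N l` is the increasing union of the sets that also bound the next coordinate. Continuity from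
  -- below holds for outer measure, so the images need not be measurable.
  have step : ∀ l, c < μ (f '' N l) → ∃ m, c < μ (f '' N (l ++ [m])) := by
    intro l hl
    have hU : N l = ⋃ m, N (l ++ [m]) := by
      ext z
      simp only [N, mem_ofPred_eq, mem_iUnion]
      constructor
      · intro h
        refine ⟨z l.length, fun i hi => ?_⟩
        by_cases hil : i < l.length
        · simpa [List.getElem_append_left hil] using h i hil
        · have : i = l.length := by simp at hi; omega
          subst this; simp
      · rintro ⟨m, h⟩ i hi
        have := h i (by simp; omega)
        simpa [List.getElem_append_left hi] using this
    have hmono : Monotone fun m => f '' N (l ++ [m]) := by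
      intro m m' hmm
      apply image_mono
      intro z hz i hi
      have := hz i (by simpa using hi)
      by_cases hil : i < l.length
      · simpa [List.getElem_append_left hil] using this
      · have : i = l.length := by simp at hi; omega
        subst this; simp at this ⊢; omega
    rw [hU, image_iUnion, hmono.measure_iUnion] at hl
    exact lt_iSup_iff.1 hl
  choose! m hm using step
  let L : ℕ → List ℕ := fun k => Nat.rec [] (fun _ l => l ++ [m l]) k
  have hL : ∀ k, c < μ (f '' N (L k)) := by
    intro k
    induction k with
    | zero => simpa [L, N] using hc
    | succ k ih => exact hm _ ih
  have hlen : ∀ k, (L k).length = k := by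
    intro k
    induction k with
    | zero => rfl
    | succ k ih => change (L k ++ [m (L k)]).length = k + 1; simp [ih]
  let n : ℕ → ℕ := fun i => m (L i)
  have hget : ∀ k i (hi : i < (L k).length), (L k)[i] = n i := by
    intro k
    induction k with
    | zero => intro i hi; simp [hlen] at hi
    | succ k ih =>
      intro i hi
      change (L k ++ [m (L k)])[i]'hi = n i
      by_cases hil : i < (L k).length
      · rw [List.getElem_append_left hil, ih]
      · have hik : i = (L k).length := by
          have h1 := hlen (k + 1)
          have h2 := hlen k
          omega
        subst hik
        simp [n, hlen]
  have hK : IsCompact {z : ℕ → ℕ | ∀ i, z i ≤ n i} := by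
    have : {z : ℕ → ℕ | ∀ i, z i ≤ n i} = Set.pi univ fun i => Iic (n i) := by
      ext z; simp [Pi.le_def]
    rw [this]
    exact isCompact_univ_pi fun i => (Set.finite_Iic (n i)).isCompact
  refine ⟨f '' {z : ℕ → ℕ | ∀ i, z i ≤ n i}, image_subset_range _ _, hK.image hf, ?_⟩
  -- Only prefix sets are known to have image of measure above `c`. Every open set containing the
  -- image of the compact box contains the image of such a prefix set, so outer regularity passes
  -- the bound to the box.
  rw [Set.measure_eq_iInf_isOpen]
  refine le_iInf₂ fun U hU => le_iInf fun hUo => ?_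
  obtain ⟨k, hk⟩ := exists_prefix_box_subset n (hUo.preimage hf) (image_subset_iff.1 hU)
  refine (hL k).le.trans (measure_mono (image_subset_iff.2 fun z hz => hk ?_))
  intro i hi
  have := hz i (by rw [hlen]; exact hi)
  rwa [hget] at this

/-- Analytic sets are universally measurable. -/
theorem analyticSet_nullMeasurableSet {Y : Type*} [TopologicalSpace Y] [T2Space Y]
    [MeasurableSpace Y] [BorelSpace Y] {A : Set Y} (hA : AnalyticSet A) (μ : Measure Y)
    [IsFiniteMeasure μ] [μ.OuterRegular] : NullMeasurableSet A μ := by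
  rw [AnalyticSet] at hA
  rcases hA with rfl | ⟨f, hf, rfl⟩
  · exact nullMeasurableSet_empty
  rcases eq_or_ne (μ (range f)) 0 with h0 | h0
  · exact NullMeasurableSet.of_null h0
  obtain ⟨c, -, hc, hclim⟩ := exists_seq_strictMono_tendsto' (pos_iff_ne_zero.2 h0)
  choose K hKs hKc hKμ using fun k => exists_isCompact_lt_measure μ hf (hc k).2
  have hmeas : MeasurableSet (⋃ k, K k) := MeasurableSet.iUnion fun k => (hKc k).measurableSet
  have hsub : ⋃ k, K k ⊆ range f := iUnion_subset hKs
  have hle : μ (range f) ≤ μ (⋃ k, K k) :=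
    le_of_tendsto' hclim fun k => (hKμ k).trans (measure_mono (subset_iUnion K k))
  refine hmeas.nullMeasurableSet.congr ?_
  exact ae_eq_of_subset_of_measure_ge hsub hle hmeas.nullMeasurableSet (measure_ne_top _ _)

/-- The Jankov–von Neumann selector: the lexicographically smallest element of the fibre. -/
def lexSelector {Y : Type*} (g : (ℕ → ℕ) → Y) (y : Y) : ℕ → ℕ
  | k => sInf {n : ℕ | ∃ z : ℕ → ℕ, (∀ i : Fin k, z i = lexSelector g y i) ∧ z k = n ∧ g z = y}
termination_by k => k
decreasing_by exact i.2

/-- By induction, each minimal value is attained by a point of the fibre that already agrees with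
the selector on the earlier coordinates. A lexicographic minimum of the fibre itself is not
presupposed. -/
theorem exists_agree_lexSelector {Y : Type*} (g : (ℕ → ℕ) → Y) {y : Y} (hy : y ∈ range g) (k : ℕ) :
    ∃ z : ℕ → ℕ, (∀ i < k, z i = lexSelector g y i) ∧ g z = y := by
  induction k with
  | zero => obtain ⟨z, hz⟩ := hy; exact ⟨z, by simp, hz⟩
  | succ k ih =>
    obtain ⟨z, hz, hzy⟩ := ih
    have hne : {n : ℕ | ∃ z : ℕ → ℕ,
        (∀ i : Fin k, z i = lexSelector g y i) ∧ z k = n ∧ g z = y}.Nonempty :=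
      ⟨z k, z, fun i : Fin k => hz i i.2, rfl, hzy⟩
    obtain ⟨w, hw, hwk, hwy⟩ := Nat.sInf_mem hne
    rw [← lexSelector] at hwk
    refine ⟨w, fun i hi => ?_, hwy⟩
    rcases Nat.lt_succ_iff_lt_or_eq.1 hi with h | rfl
    · exact hw ⟨i, h⟩
    · exact hwk

/-- Points of the fibre agreeing with the selector on longer and longer prefixes converge to it, and
the fibre of a continuous map is closed. -/
theorem apply_lexSelector {Y : Type*} [TopologicalSpace Y] [T2Space Y] {g : (ℕ → ℕ) → Y}
    (hg : Continuous g) {y : Y} (hy : y ∈ range g) : g (lexSelector g y) = y := by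
  choose z hz hzy using exists_agree_lexSelector g hy
  have hlim : Tendsto z atTop (𝓝 (lexSelector g y)) := by
    rw [tendsto_pi_nhds]
    intro i
    refine tendsto_const_nhds.congr' ?_
    filter_upwards [eventually_gt_atTop i] with k hk using (hz k i hk).symm
  have h1 := (hg.tendsto _).comp hlim
  refine tendsto_nhds_unique h1 ?_
  simp [Function.comp_def, hzy]

/-- There are countably many prefixes. With the prefix and the next value prescribed, the admissible
`y` form the image under `g` of an open cylinder, hence an analytic and so universally measurable
set. -/
theorem nullMeasurable_lexSelector {Y : Type*} [TopologicalSpace Y] [T2Space Y]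
    [MeasurableSpace Y] [BorelSpace Y] {g : (ℕ → ℕ) → Y} (hg : Continuous g) (μ : Measure Y)
    [IsFiniteMeasure μ] [μ.OuterRegular] (k : ℕ) :
    NullMeasurable (fun y => lexSelector g y k) μ := by
  induction k using Nat.strong_induction_on with
  | _ k ih =>
  have hpre : NullMeasurable (fun y (i : Fin k) => lexSelector g y i) μ := by
    refine (aemeasurable_pi_iff.2 fun i : Fin k => (ih i i.2).aemeasurable).nullMeasurable
  have hmem : ∀ n : ℕ, NullMeasurableSet {y | ∃ z : ℕ → ℕ,
      (∀ i : Fin k, z i = lexSelector g y i) ∧ z k = n ∧ g z = y} μ := by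
    intro n
    have : {y | ∃ z : ℕ → ℕ, (∀ i : Fin k, z i = lexSelector g y i) ∧ z k = n ∧ g z = y} =
        ⋃ u : Fin k → ℕ, ((fun y (i : Fin k) => lexSelector g y i) ⁻¹' {u}) ∩
          g '' {z | (∀ i : Fin k, z i = u i) ∧ z k = n} := by
      ext y
      simp only [mem_ofPred_eq, mem_iUnion, mem_inter_iff, mem_preimage, mem_singleton_iff,
        mem_image]
      constructor
      · rintro ⟨z, h1, h2, h3⟩
        exact ⟨fun i => lexSelector g y i, rfl, z, ⟨h1, h2⟩, h3⟩
      · rintro ⟨u, rfl, z, ⟨h1, h2⟩, h3⟩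
        exact ⟨z, h1, h2, h3⟩
    rw [this]
    refine NullMeasurableSet.iUnion fun u => (hpre (measurableSet_singleton u)).inter ?_
    refine analyticSet_nullMeasurableSet ?_ μ
    refine IsOpen.analyticSet_image ?_ hg
    have h : {z : ℕ → ℕ | (∀ i : Fin k, z i = u i) ∧ z k = n} =
        (⋂ i : Fin k, (fun z : ℕ → ℕ => z i) ⁻¹' {u i}) ∩ (fun z : ℕ → ℕ => z k) ⁻¹' {n} := by
      ext z; simp
    rw [h]
    exact (isOpen_iInter_of_finite fun i => (isOpen_discrete _).preimage (continuous_apply _)).inter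
      ((isOpen_discrete _).preimage (continuous_apply _))
  -- The second set of the union accounts for `sInf ∅ = 0`, the value of the selector outside the
  -- range of `g`.
  have heq : ∀ n : ℕ, (fun y => lexSelector g y k) ⁻¹' {n} =
      {y | (fun n' => ∃ z : ℕ → ℕ,
        (∀ i : Fin k, z i = lexSelector g y i) ∧ z k = n' ∧ g z = y) n ∧ ∀ n' < n, ¬ ∃ z : ℕ → ℕ,
        (∀ i : Fin k, z i = lexSelector g y i) ∧ z k = n' ∧ g z = y} ∪
      {y | n = 0 ∧ ∀ n', ¬ ∃ z : ℕ → ℕ,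
        (∀ i : Fin k, z i = lexSelector g y i) ∧ z k = n' ∧ g z = y} := by
    intro n
    ext y
    simp only [mem_preimage, mem_singleton_iff, mem_union, mem_ofPred_eq]
    set S := {n' : ℕ | ∃ z : ℕ → ℕ,
        (∀ i : Fin k, z i = lexSelector g y i) ∧ z k = n' ∧ g z = y} with hS
    have hval : lexSelector g y k = sInf S := by rw [lexSelector]
    rw [hval]
    change _ ↔ (n ∈ S ∧ ∀ n' < n, n' ∉ S) ∨ (n = 0 ∧ ∀ n', n' ∉ S)
    constructor
    · rintro rfl
      by_cases hne : S.Nonempty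
      · exact Or.inl ⟨Nat.sInf_mem hne, fun n' => Nat.notMem_of_lt_sInf⟩
      · rw [not_nonempty_iff_eq_empty] at hne
        right; simp [hne]
    · rintro (⟨h1, h2⟩ | ⟨rfl, h2⟩)
      · refine le_antisymm (Nat.sInf_le h1) ?_
        by_contra! hlt
        exact h2 _ hlt (Nat.sInf_mem ⟨n, h1⟩)
      · rw [eq_empty_of_forall_notMem h2]; simp
  have hsing : ∀ n : ℕ, NullMeasurableSet ((fun y => lexSelector g y k) ⁻¹' {n}) μ := by
    intro n
    rw [heq]
    refine NullMeasurableSet.union ((hmem n).inter ?_) ?_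
    · have : {y | ∀ n' < n, ¬ ∃ z : ℕ → ℕ,
        (∀ i : Fin k, z i = lexSelector g y i) ∧ z k = n' ∧ g z = y} = ⋂ n' : Fin n,
        {y | ∃ z : ℕ → ℕ, (∀ i : Fin k, z i = lexSelector g y i) ∧ z k = n' ∧ g z = y}ᶜ := by
        ext y; simp [Fin.forall_iff]
      change NullMeasurableSet {y | ∀ n' < n, ¬ ∃ z : ℕ → ℕ,
        (∀ i : Fin k, z i = lexSelector g y i) ∧ z k = n' ∧ g z = y} μ
      rw [this]
      exact NullMeasurableSet.iInter fun n' => (hmem n').compl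
    · have : {y | n = 0 ∧ ∀ n', ¬ ∃ z : ℕ → ℕ,
        (∀ i : Fin k, z i = lexSelector g y i) ∧ z k = n' ∧ g z = y} = {_y | n = 0} ∩ ⋂ n' : ℕ,
        {y | ∃ z : ℕ → ℕ, (∀ i : Fin k, z i = lexSelector g y i) ∧ z k = n' ∧ g z = y}ᶜ := by
        ext y; simp
      rw [this]
      exact (MeasurableSet.const _).nullMeasurableSet.inter
        (NullMeasurableSet.iInter fun n' => (hmem n').compl)
  intro s _
  have : (fun y => lexSelector g y k) ⁻¹' s = ⋃ n ∈ s, (fun y => lexSelector g y k) ⁻¹' {n} := by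
    ext y; simp
  rw [this]
  exact NullMeasurableSet.biUnion s.to_countable fun n _ => hsing n

/-- The Jankov–von Neumann measurable selection theorem. -/
theorem AnalyticSet.exists_measurable_selection {Y Z : Type*} [TopologicalSpace Y] [PolishSpace Y]
    [MeasurableSpace Y] [BorelSpace Y] [TopologicalSpace Z] [PolishSpace Z] [MeasurableSpace Z]
    [BorelSpace Z] [Nonempty Z] {A : Set (Y × Z)} (hA : AnalyticSet A) (μ : Measure Y)
    [IsFiniteMeasure μ] :
    ∃ s : Y → Z, Measurable s ∧ ∀ᵐ y ∂μ, y ∈ Prod.fst '' A → (y, s y) ∈ A := by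
  rw [AnalyticSet] at hA
  rcases hA with rfl | ⟨f, hf, rfl⟩
  · exact ⟨fun _ => Classical.arbitrary Z, measurable_const, by simp⟩
  let g : (ℕ → ℕ) → Y := fun z => (f z).1
  have hg : Continuous g := continuous_fst.comp hf
  have hmeas : AEMeasurable (fun y => lexSelector g y) μ :=
    aemeasurable_pi_iff.2 fun k => (nullMeasurable_lexSelector hg μ k).aemeasurable
  -- The selector is only null measurable. Passing to a Borel version is why the conclusion holds
  -- merely almost everywhere.
  refine ⟨fun y => (f (hmeas.mk _ y)).2,
    (continuous_snd.comp hf).measurable.comp hmeas.measurable_mk, ?_⟩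
  filter_upwards [hmeas.ae_eq_mk] with y hy hyA
  have hy' : y ∈ range g := by
    rw [← range_comp] at hyA
    exact hyA
  have h := apply_lexSelector hg hy'
  rw [hy] at h
  refine ⟨hmeas.mk _ y, ?_⟩
  ext1
  · exact h
  · rfl

/-- A parametrization of the measurable maps `S → Y`, up to almost everywhere equality, by the
points of a Polish space. -/
theorem exists_universal_measurable (S Y : Type*) [MeasurableSpace S]
    [MeasurableSpace.CountablyGenerated S] [MeasurableSpace Y] [StandardBorelSpace Y]
    [Nonempty Y] :
    ∃ G : (ℕ → ℕ → ℕ) → S → Y, Measurable (Function.uncurry G) ∧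
      ∀ (μ : Measure S) [IsFiniteMeasure μ] (f : S → Y), Measurable f → ∃ σ, G σ =ᵐ[μ] f := by
  classical
  let 𝒜 := generateSetAlgebra (MeasurableSpace.countableGeneratingSet S)
  have h𝒜c : 𝒜.Countable :=
    countable_generateSetAlgebra (MeasurableSpace.countable_countableGeneratingSet)
  have h𝒜 : IsSetAlgebra 𝒜 := isSetAlgebra_generateSetAlgebra
  have hgen : ‹MeasurableSpace S› = MeasurableSpace.generateFrom 𝒜 := by
    rw [generateFrom_generateSetAlgebra_eq, MeasurableSpace.generateFrom_countableGeneratingSet]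
  obtain ⟨A, hA⟩ := h𝒜c.exists_eq_range ⟨∅, h𝒜.empty_mem⟩
  have hAm : ∀ n, MeasurableSet (A n) := fun n => by
    rw [hgen]; exact MeasurableSpace.measurableSet_generateFrom (hA ▸ mem_range_self n)
  obtain ⟨e, he, hinj⟩ := MeasurableSpace.measurable_injection_nat_bool_of_countablySeparated Y
  have hemb : MeasurableEmbedding e := he.measurableEmbedding hinj
  obtain ⟨r, hr, hre⟩ := hemb.exists_measurable_extend measurable_id (fun _ => ‹Nonempty Y›)
  -- The row `σ n` lists algebra sets approximating the event that the `n`-th bit of `e (f s)` is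
  -- true, and the bit is read off as their limsup.
  let G₀ : (ℕ → ℕ → ℕ) → S → (ℕ → Bool) := fun σ s n => decide (∃ᶠ k in atTop, s ∈ A (σ n k))
  have hG₀ : Measurable (Function.uncurry G₀) := by
    refine measurable_pi_iff.2 fun n => measurable_to_bool ?_
    have : (fun p : (ℕ → ℕ → ℕ) × S => Function.uncurry G₀ p n) ⁻¹' {true} =
        ⋂ N : ℕ, ⋃ k : ℕ, ⋃ _ : N ≤ k, ⋃ m : ℕ, {p : (ℕ → ℕ → ℕ) × S | p.1 n k = m ∧ p.2 ∈ A m} := by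
      ext ⟨σ, s⟩
      simp [G₀, Function.uncurry, frequently_atTop]
    rw [this]
    refine MeasurableSet.iInter fun N => MeasurableSet.iUnion fun k => MeasurableSet.iUnion fun _ =>
      MeasurableSet.iUnion fun m => ?_
    have h1 : Measurable fun p : (ℕ → ℕ → ℕ) × S => p.1 n k :=
      (measurable_pi_apply k).comp ((measurable_pi_apply n).comp measurable_fst)
    exact (h1 (measurableSet_singleton m)).inter (measurable_snd (hAm m))
  refine ⟨fun σ s => r (G₀ σ s), hr.comp hG₀, fun μ _ f hf => ?_⟩
  have hdense := Measure.MeasureDense.of_generateFrom_isSetAlgebra_finite μ h𝒜 hgen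
  have hset : ∀ B : Set S, MeasurableSet B → ∃ τ : ℕ → ℕ,
      ∀ᵐ s ∂μ, (∃ᶠ k in atTop, s ∈ A (τ k)) ↔ s ∈ B := by
    intro B hB
    have hap : ∀ k : ℕ, ∃ m, μ (symmDiff B (A m)) < ENNReal.ofReal ((1 / 2) ^ k) := by
      intro k
      obtain ⟨t, ht, hlt⟩ := hdense.approx B hB (measure_ne_top _ _) ((1 / 2) ^ k) (by positivity)
      rw [hA] at ht
      obtain ⟨m, rfl⟩ := ht
      exact ⟨m, hlt⟩
    choose τ hτ using hap
    refine ⟨τ, ?_⟩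
    -- Borel–Cantelli: with summable errors, almost every point is eventually classified correctly,
    -- so the limsup equals `B` up to a null set.
    have hsum : ∑' k, μ (symmDiff B (A (τ k))) ≠ ∞ := by
      refine ne_top_of_le_ne_top ?_ (ENNReal.tsum_le_tsum fun k => (hτ k).le)
      rw [← ENNReal.ofReal_tsum_of_nonneg (fun k => by positivity) summable_geometric_two]
      exact ENNReal.ofReal_ne_top
    filter_upwards [ae_eventually_notMem hsum] with s hs
    have hs' : ∀ᶠ k in atTop, (s ∈ A (τ k) ↔ s ∈ B) := by
      filter_upwards [hs] with k hk
      simp only [Set.mem_symmDiff] at hk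
      tauto
    rw [frequently_congr hs']
    simp
  have hbits : ∀ n, ∃ τ : ℕ → ℕ, ∀ᵐ s ∂μ, (∃ᶠ k in atTop, s ∈ A (τ k)) ↔ e (f s) n = true := by
    intro n
    have : MeasurableSet {s | e (f s) n = true} :=
      ((measurable_pi_apply n).comp (he.comp hf)) (measurableSet_singleton true)
    exact hset _ this
  choose σ hσ using hbits
  refine ⟨σ, ?_⟩
  filter_upwards [ae_all_iff.2 hσ] with s hs
  have : G₀ σ s = e (f s) := by
    funext n
    simp only [G₀]
    rw [Bool.eq_iff_iff, decide_eq_true_iff]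
    exact hs n
  change r (G₀ σ s) = f s
  rw [this]
  exact congrFun hre (f s)

/-- A parametrization of the probability measures on `Y` by the points of a Polish space. -/
theorem exists_universal_kernel (Y : Type*) [MeasurableSpace Y] [StandardBorelSpace Y]
    [Nonempty Y] :
    ∃ K : Kernel (ℕ → ℕ → ℕ) Y, IsMarkovKernel K ∧
      ∀ (μ : Measure Y) [IsProbabilityMeasure μ], ∃ σ, K σ = μ := by
  obtain ⟨G, hG, hGu⟩ := exists_universal_measurable unitInterval Y
  let K : Kernel (ℕ → ℕ → ℕ) Y :=
    ((Kernel.deterministic id measurable_id) ×ₖ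
      (Kernel.const (ℕ → ℕ → ℕ) (volume : Measure unitInterval))).map (Function.uncurry G)
  have hK : ∀ σ, K σ = (volume : Measure unitInterval).map (G σ) := by
    intro σ
    rw [Kernel.map_apply _ hG, Kernel.prod_apply, Kernel.deterministic_apply, Kernel.const_apply,
      Measure.dirac_prod, Measure.map_map hG (by fun_prop)]
    rfl
  refine ⟨K, Kernel.IsMarkovKernel.map _ hG, fun μ _ => ?_⟩
  -- Every probability measure on `Y` is an image of Lebesgue measure on the unit interval, so
  -- coding measurable maps also codes laws.
  obtain ⟨f, hf, hfμ⟩ := Measure.exists_measurable_map_eq μ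
  obtain ⟨σ, hσ⟩ := hGu volume f hf
  exact ⟨σ, by rw [hK, Measure.map_congr hσ, hfμ]⟩

end DescriptiveSetTheory

/-! ### Stopping, shifting and concatenating paths; the canonical filtration. -/

section PathSpace

variable {d : ℕ}

/-- The path `ω` stopped at time `s`. -/
def stopAt (s : ℝ≥0) (ω : PathSpace d) : PathSpace d :=
  ω.comp ⟨fun u => min u s, by fun_prop⟩

/-- The path that follows `ω` up to time `t` and the increments of `ω'` afterwards. -/
def concat (t : ℝ≥0) (ω ω' : PathSpace d) : PathSpace d :=
  ⟨fun u => ω (min u t) + (ω' (u - t) - ω' 0), by fun_prop⟩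

@[simp] theorem stop_apply (s u : ℝ≥0) (ω : PathSpace d) : stopAt s ω u = ω (min u s) := rfl

@[simp] theorem concat_apply (t u : ℝ≥0) (ω ω' : PathSpace d) :
    concat t ω ω' u = ω (min u t) + (ω' (u - t) - ω' 0) := rfl

@[simp] theorem shift_apply (t u : ℝ≥0) (ω : PathSpace d) : shift t ω u = ω (u + t) := rfl

theorem continuous_stop :
    Continuous fun p : ℝ≥0 × PathSpace d => stopAt p.1 p.2 := by
  refine ContinuousMap.continuous_of_continuous_uncurry _ ?_
  change Continuous fun q : (ℝ≥0 × PathSpace d) × ℝ≥0 => q.1.2 (min q.2 q.1.1)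
  fun_prop

theorem continuous_stop_right (s : ℝ≥0) : Continuous (stopAt (d := d) s) :=
  continuous_stop.comp (Continuous.prodMk_right s)

theorem continuous_concat (t : ℝ≥0) :
    Continuous fun p : PathSpace d × PathSpace d => concat t p.1 p.2 := by
  refine ContinuousMap.continuous_of_continuous_uncurry _ ?_
  change Continuous fun q : (PathSpace d × PathSpace d) × ℝ≥0 =>
    q.1.1 (min q.2 t) + (q.1.2 (q.2 - t) - q.1.2 0)
  fun_prop

theorem continuous_shift (t : ℝ≥0) : Continuous (shift (d := d) t) := by
  refine ContinuousMap.continuous_of_continuous_uncurry _ ?_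
  change Continuous fun q : PathSpace d × ℝ≥0 => q.1 (q.2 + t)
  fun_prop

theorem continuous_X_uncurry :
    Continuous fun p : ℝ≥0 × PathSpace d => X p.1 p.2 := by
  change Continuous fun p : ℝ≥0 × PathSpace d => p.2 p.1
  fun_prop

theorem stop_stop (s r : ℝ≥0) (ω : PathSpace d) : stopAt s (stopAt r ω) = stopAt (min s r) ω := by
  ext1 u; simp [min_assoc]

theorem stop_concat_of_le {s t : ℝ≥0} (h : s ≤ t) (ω ω' : PathSpace d) :
    stopAt s (concat t ω ω') = stopAt s ω := by
  ext1 u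
  have h1 : min u s ≤ t := (min_le_right _ _).trans h
  simp [tsub_eq_zero_of_le h1, min_eq_left h1]

theorem concat_stop (t : ℝ≥0) (ω ω' : PathSpace d) : concat t (stopAt t ω) ω' = concat t ω ω' := by
  ext1 u; simp

theorem stop_add_concat (t s : ℝ≥0) (ω ω' : PathSpace d) :
    stopAt (t + s) (concat t ω ω') = concat t ω (stopAt s ω') := by
  ext1 u
  have h1 : min (min u (t + s)) t = min u t := by
    rw [min_assoc, min_eq_right (le_self_add : t ≤ t + s)]
  have h2 : min u (t + s) - t = min (u - t) s := by
    rcases le_total u (t + s) with h | h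
    · rw [min_eq_left h, min_eq_left (tsub_le_iff_left.2 h)]
    · rw [min_eq_right h, min_eq_right (le_tsub_of_add_le_left h), add_tsub_cancel_left]
  simp [h1, h2]

theorem shift_concat {t : ℝ≥0} {ω ω' : PathSpace d} (h : X 0 ω' = X t ω) :
    shift t (concat t ω ω') = ω' := by
  ext1 u
  have h' : ω' 0 = ω t := h
  simp [h']

theorem concat_shift (t : ℝ≥0) (ω : PathSpace d) : concat t ω (shift t ω) = ω := by
  ext1 u
  rcases le_total u t with h | h
  · simp [tsub_eq_zero_of_le h, min_eq_left h]
  · simp [tsub_add_cancel_of_le h, min_eq_right h]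

theorem shift_stop (t s : ℝ≥0) (ω : PathSpace d) : shift t (stopAt (t + s) ω) = stopAt s (shift t ω) := by
  ext1 u
  simp only [shift_apply, stop_apply]
  rw [add_comm t s, min_add_add_right]

theorem X_add_concat (t s : ℝ≥0) (ω ω' : PathSpace d) :
    X (t + s) (concat t ω ω') = X t ω + (X s ω' - X 0 ω') := by
  simp [X]

/-- The Borel σ-field of the path space is generated by the coordinate process. -/
theorem measurableSpace_eq_iSup_comap :
    instMeasurableSpacePathSpace d = ⨆ t, MeasurableSpace.comap (X t) inferInstance := by
  apply le_antisymm
  · let D : ℕ → ℝ≥0 := TopologicalSpace.denseSeq ℝ≥0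
    let e : PathSpace d → ℕ → E d := fun ω n => ω (D n)
    have he : Measurable e := measurable_pi_iff.2 fun n => (continuous_X (D n)).measurable
    have hinj : Function.Injective e := by
      intro ω ω' h
      refine DFunLike.ext' ?_
      exact Continuous.ext_on (TopologicalSpace.denseRange_denseSeq ℝ≥0) ω.continuous
        ω'.continuous (by rintro _ ⟨n, rfl⟩; exact congrFun h n)
    rw [← (he.measurableEmbedding hinj).comap_eq]
    rw [MeasurableSpace.pi, MeasurableSpace.comap_iSup]
    refine iSup_le fun n => ?_
    rw [MeasurableSpace.comap_comp]
    exact le_iSup (fun t => MeasurableSpace.comap (X (d := d) t) inferInstance) (D n)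
  · exact iSup_le fun t => (continuous_X t).measurable.comap_le

theorem canonicalFiltration_eq_comap (s : ℝ≥0) :
    (canonicalFiltration d s : MeasurableSpace (PathSpace d)) =
      MeasurableSpace.comap (stopAt s) (instMeasurableSpacePathSpace d) := by
  have key : MeasurableSpace.comap (stopAt s) (instMeasurableSpacePathSpace d) =
      ⨆ t, MeasurableSpace.comap (X t ∘ stopAt s) inferInstance := by
    rw [measurableSpace_eq_iSup_comap, MeasurableSpace.comap_iSup]
    simp only [MeasurableSpace.comap_comp]
  rw [key]
  apply le_antisymm
  · refine iSup₂_le fun j hj => ?_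
    have : X (d := d) j = X j ∘ stopAt s := by
      ext1 ω; simp [X, min_eq_left hj]
    conv_lhs => rw [this]
    refine le_trans (le_of_eq ?_)
      (le_iSup (fun t => MeasurableSpace.comap (X (d := d) t ∘ stopAt s) inferInstance) j)
    rw [BorelSpace.measurable_eq (α := E d)]
  · refine iSup_le fun t => ?_
    have : X (d := d) t ∘ stopAt s = X (min t s) := rfl
    rw [this]
    refine le_trans (le_of_eq ?_) (le_iSup₂ (min t s) (min_le_right t s))
    rw [BorelSpace.measurable_eq (α := E d)]

/-- Galmarino's test. It turns measurability with respect to the past into Borel measurability plus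
a pathwise identity under stopping. -/
theorem measurableSet_canonicalFiltration_iff {s : ℝ≥0} {A : Set (PathSpace d)} :
    MeasurableSet[canonicalFiltration d s] A ↔ MeasurableSet A ∧ stopAt s ⁻¹' A = A := by
  rw [canonicalFiltration_eq_comap]
  constructor
  · rintro ⟨A', hA', rfl⟩
    refine ⟨(continuous_stop_right s).measurable hA', ?_⟩
    ext ω
    simp [stop_stop]
  · rintro ⟨h1, h2⟩
    exact ⟨A, h1, h2⟩

theorem measurable_canonicalFiltration_iff {s : ℝ≥0} {Y : Type*} [MeasurableSpace Y]
    [MeasurableSingletonClass Y] {f : PathSpace d → Y} :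
    Measurable[canonicalFiltration d s] f ↔ Measurable f ∧ ∀ ω, f (stopAt s ω) = f ω := by
  constructor
  · intro h
    refine ⟨h.mono ((canonicalFiltration d).le s) le_rfl, fun ω => ?_⟩
    have h1 := h (measurableSet_singleton (f ω))
    have h2 := (measurableSet_canonicalFiltration_iff.1 h1).2
    have : ω ∈ stopAt s ⁻¹' (f ⁻¹' {f ω}) := by rw [h2]; rfl
    exact this
  · rintro ⟨h1, h2⟩ B hB
    exact measurableSet_canonicalFiltration_iff.2 ⟨h1 hB, by ext ω; simp [h2]⟩

end PathSpace

/-! ### Lebesgue measure on the half-line. -/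

section Lebesgue

theorem measurableEmbedding_coe_nnreal : MeasurableEmbedding ((↑) : ℝ≥0 → ℝ) :=
  NNReal.isClosedEmbedding_coe.measurableEmbedding

theorem lebesgue_apply (A : Set ℝ≥0) : lebesgue A = volume (((↑) : ℝ≥0 → ℝ) '' A) :=
  measurableEmbedding_coe_nnreal.comap_apply _ _

theorem lebesgue_Ioc (s r : ℝ≥0) : lebesgue (Ioc s r) = ENNReal.ofReal (r - s) := by
  rw [lebesgue_apply]
  have : ((↑) : ℝ≥0 → ℝ) '' Ioc s r = Ioc (s : ℝ) r := by
    ext x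
    constructor
    · rintro ⟨y, hy, rfl⟩; exact ⟨by exact_mod_cast hy.1, by exact_mod_cast hy.2⟩
    · intro hx
      have hx0 : 0 ≤ x := s.2.trans hx.1.le
      exact ⟨⟨x, hx0⟩, ⟨by exact_mod_cast hx.1, by exact_mod_cast hx.2⟩, rfl⟩
  rw [this, Real.volume_Ioc]

theorem lebesgue_singleton (s : ℝ≥0) : lebesgue {s} = 0 := by
  rw [lebesgue_apply, image_singleton, Real.volume_singleton]

instance instNoAtomsLebesgue : NullSingletonClass lebesgue := ⟨lebesgue_singleton⟩

theorem lebesgue_Iic (r : ℝ≥0) : lebesgue (Iic r) = ENNReal.ofReal r := by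
  have : Iic r = {0} ∪ Ioc 0 r := by
    ext x
    simp only [mem_Iic, mem_union, mem_singleton_iff, mem_Ioc]
    constructor
    · intro h
      rcases eq_or_ne x 0 with h0 | h0
      · exact Or.inl h0
      · exact Or.inr ⟨pos_iff_ne_zero.2 h0, h⟩
    · rintro (rfl | h)
      · exact zero_le
      · exact h.2
  rw [this, measure_union (by simp) measurableSet_Ioc, lebesgue_singleton, lebesgue_Ioc]
  simp

instance instSigmaFiniteLebesgue : SigmaFinite lebesgue := by
  refine ⟨⟨⟨fun n => Iic (n : ℝ≥0), fun _ => trivial, fun n => ?_, ?_⟩⟩⟩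
  · rw [lebesgue_Iic]; exact ENNReal.ofReal_lt_top
  · refine eq_univ_of_forall fun x => mem_iUnion.2 ?_
    obtain ⟨n, hn⟩ := exists_nat_ge x
    exact ⟨n, hn⟩

instance instIsFiniteMeasureRestrictIoc (s r : ℝ≥0) :
    IsFiniteMeasure (lebesgue.restrict (Ioc s r)) :=
  ⟨by rw [Measure.restrict_apply_univ, lebesgue_Ioc]; exact ENNReal.ofReal_lt_top⟩

theorem measureReal_lebesgue_Ioc {s r : ℝ≥0} (h : s ≤ r) :
    lebesgue.real (Ioc s r) = (r : ℝ) - s := by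
  rw [Measure.real, lebesgue_Ioc, ENNReal.toReal_ofReal]
  exact sub_nonneg.2 (by exact_mod_cast h)

theorem map_add_lebesgue (t : ℝ≥0) :
    lebesgue.map (fun s => t + s) = lebesgue.restrict (Ici t) := by
  ext A hA
  rw [Measure.map_apply (by fun_prop) hA, Measure.restrict_apply hA, lebesgue_apply,
    lebesgue_apply]
  have : ((↑) : ℝ≥0 → ℝ) '' (A ∩ Ici t) =
      (fun x : ℝ => (t : ℝ) + x) '' (((↑) : ℝ≥0 → ℝ) '' ((fun s => t + s) ⁻¹' A)) := by
    ext x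
    constructor
    · rintro ⟨y, ⟨hy, hyt⟩, rfl⟩
      refine ⟨((y - t : ℝ≥0) : ℝ), ⟨y - t, ?_, rfl⟩, ?_⟩
      · simpa [add_tsub_cancel_of_le (mem_Ici.1 hyt)] using hy
      · change (t : ℝ) + ((y - t : ℝ≥0) : ℝ) = y
        rw [← NNReal.coe_add, add_tsub_cancel_of_le (mem_Ici.1 hyt)]
    · rintro ⟨_, ⟨y, hy, rfl⟩, rfl⟩
      exact ⟨t + y, ⟨hy, mem_Ici.2 le_self_add⟩, by simp⟩
  rw [this, image_add_left, measure_preimage_add]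

theorem measurableEmbedding_add_left_nnreal (t : ℝ≥0) :
    MeasurableEmbedding (fun s : ℝ≥0 => t + s) :=
  (show Continuous fun s : ℝ≥0 => t + s by fun_prop).measurable.measurableEmbedding
    (add_right_injective t)

theorem setIntegral_Ioc_add {G : Type*} [NormedAddCommGroup G] [NormedSpace ℝ G]
    (t s r : ℝ≥0) (f : ℝ≥0 → G) :
    ∫ u in Ioc (t + s) (t + r), f u ∂lebesgue = ∫ u in Ioc s r, f (t + u) ∂lebesgue := by
  have h1 : (fun u : ℝ≥0 => t + u) ⁻¹' Ioc (t + s) (t + r) = Ioc s r := by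
    ext u; simp
  have h2 : Ioc (t + s) (t + r) ⊆ Ici t := fun u hu => le_self_add.trans hu.1.le
  rw [← h1, ← (measurableEmbedding_add_left_nnreal t).setIntegral_map, map_add_lebesgue,
    Measure.restrict_restrict measurableSet_Ioc, inter_eq_self_of_subset_left h2]

theorem ae_lebesgue_add {p : ℝ≥0 → Prop} (t : ℝ≥0) :
    (∀ᵐ s ∂lebesgue, p (t + s)) ↔ ∀ᵐ s ∂lebesgue, t ≤ s → p s := by
  rw [← (measurableEmbedding_add_left_nnreal t).ae_map_iff (p := p), map_add_lebesgue,
    ae_restrict_iff' measurableSet_Ici]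
  rfl

theorem setIntegral_Iic_eq_Ioc {G : Type*} [NormedAddCommGroup G] [NormedSpace ℝ G]
    (r : ℝ≥0) (f : ℝ≥0 → G) :
    ∫ u in Iic r, f u ∂lebesgue = ∫ u in Ioc 0 r, f u ∂lebesgue := by
  refine setIntegral_congr_set ?_
  have : Iic r = Icc 0 r := by ext x; simp
  rw [this]
  exact Ioc_ae_eq_Icc.symm

theorem setIntegral_Ioc_adjacent {f : ℝ≥0 → ℝ} {s t r : ℝ≥0} (hst : s ≤ t) (htr : t ≤ r)
    (hf : IntegrableOn f (Ioc s r) lebesgue) :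
    ∫ u in Ioc s r, f u ∂lebesgue =
      ∫ u in Ioc s t, f u ∂lebesgue + ∫ u in Ioc t r, f u ∂lebesgue := by
  rw [← Ioc_union_Ioc_eq_Ioc hst htr, setIntegral_union (by simp) measurableSet_Ioc
    (hf.mono_set (Ioc_subset_Ioc_right htr)) (hf.mono_set (Ioc_subset_Ioc_left hst))]

end Lebesgue

/-! ### Optional sampling and stopping for continuous martingales. -/

section OptionalSampling

open Filter Topology

variable {Ω : Type*} {mΩ : MeasurableSpace Ω} {P : Measure Ω} {𝓕 : Filtration ℝ≥0 mΩ}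

theorem unifIntegrable_of_ae_norm_le {ι : Type*} {f g : ι → Ω → ℝ} (hg : UnifIntegrable g 1 P)
    (hfg : ∀ n, ∀ᵐ ω ∂P, ‖f n ω‖ ≤ ‖g n ω‖) : UnifIntegrable f 1 P := by
  intro ε hε
  obtain ⟨δ, hδ, h⟩ := hg hε
  refine ⟨δ, hδ, fun n s hs hsδ => le_trans (eLpNorm_mono_ae ?_) (h n s hs hsδ)⟩
  filter_upwards [hfg n] with ω hω
  by_cases hωs : ω ∈ s
  · simpa [hωs] using hω
  · simp [hωs]

theorem unifIntegrable_one_of_eLpNorm_two_le [IsFiniteMeasure P] {ι : Type*} {f : ι → Ω → ℝ}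
    (hf : ∀ n, AEStronglyMeasurable (f n) P) {K : ℝ≥0} (hK : ∀ n, eLpNorm (f n) 2 P ≤ K) :
    UnifIntegrable f 1 P := by
  intro ε hε
  -- Hölder's inequality gives `‖f 1_s‖₁ ≤ ‖f‖₂ P(s)^{1/2}`; writing `K + 1` avoids a division by
  -- zero.
  refine ⟨(ε / (K + 1)) ^ 2, by positivity, fun n s hs hsδ => ?_⟩
  rw [eLpNorm_indicator_eq_eLpNorm_restrict hs]
  have h1 := eLpNorm_le_eLpNorm_mul_rpow_measure_univ (p := 1) (q := 2) (by norm_num)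
    ((hf n).restrict (s := s))
  refine h1.trans ?_
  rw [Measure.restrict_apply_univ]
  have h2 : eLpNorm (f n) 2 (P.restrict s) ≤ K :=
    (eLpNorm_mono_measure _ Measure.restrict_le_self).trans (hK n)
  have h3 : P s ^ (1 / (1 : ℝ≥0∞).toReal - 1 / (2 : ℝ≥0∞).toReal) ≤
      ENNReal.ofReal (ε / (K + 1)) := by
    have : (1 / (1 : ℝ≥0∞).toReal - 1 / (2 : ℝ≥0∞).toReal) = (1 / 2 : ℝ) := by norm_num
    rw [this]
    calc P s ^ (1 / 2 : ℝ) ≤ (ENNReal.ofReal ((ε / (K + 1)) ^ 2)) ^ (1 / 2 : ℝ) := by gcongr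
      _ = ENNReal.ofReal (ε / (K + 1)) := by
        rw [ENNReal.ofReal_rpow_of_nonneg (by positivity) (by norm_num), ← Real.sqrt_eq_rpow,
          Real.sqrt_sq (by positivity)]
  calc eLpNorm (f n) 2 (P.restrict s) * P s ^ (1 / (1 : ℝ≥0∞).toReal - 1 / (2 : ℝ≥0∞).toReal)
      ≤ K * ENNReal.ofReal (ε / (K + 1)) := by gcongr
    _ = ENNReal.ofReal (K * (ε / (K + 1))) := by
        rw [ENNReal.ofReal_mul (by positivity), ENNReal.ofReal_coe_nnreal]
    _ ≤ ENNReal.ofReal ε := by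
        apply ENNReal.ofReal_le_ofReal
        rw [mul_div_assoc', div_le_iff₀ (by positivity)]
        nlinarith [K.2]

/-- Convergence in `L¹` of uniformly integrable almost surely convergent sequences, in the form of
convergence of integrals. -/
theorem tendsto_setIntegral_of_unifIntegrable [IsFiniteMeasure P] {f : ℕ → Ω → ℝ} {g : Ω → ℝ}
    (hf : ∀ n, Integrable (f n) P) (hg : Integrable g P) (hui : UnifIntegrable f 1 P)
    (hfg : ∀ᵐ ω ∂P, Tendsto (fun n => f n ω) atTop (𝓝 (g ω))) (A : Set Ω) :
    Tendsto (fun n => ∫ ω in A, f n ω ∂P) atTop (𝓝 (∫ ω in A, g ω ∂P)) := by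
  have h := tendsto_Lp_finite_of_tendsto_ae le_rfl ENNReal.one_ne_top
    (fun n => (hf n).aestronglyMeasurable) (memLp_one_iff_integrable.2 hg) hui hfg
  refine tendsto_setIntegral_of_L1' g hg.aestronglyMeasurable (Eventually.of_forall hf) ?_ A
  exact h

theorem integrable_of_unifIntegrable_tendsto [IsFiniteMeasure P] {f : ℕ → Ω → ℝ} {g : Ω → ℝ}
    (hf : ∀ n, AEStronglyMeasurable (f n) P) {K : ℝ≥0} (hK : ∀ n, eLpNorm (f n) 1 P ≤ K)
    (hfg : ∀ᵐ ω ∂P, Tendsto (fun n => f n ω) atTop (𝓝 (g ω))) : Integrable g P := by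
  have hgm : AEStronglyMeasurable g P := aestronglyMeasurable_of_tendsto_ae atTop hf hfg
  rw [← memLp_one_iff_integrable]
  refine ⟨hgm, lt_of_le_of_lt (Lp.eLpNorm_lim_le_liminf_eLpNorm hf g hfg) ?_⟩
  refine lt_of_le_of_lt (liminf_le_of_le (a := (K : ℝ≥0∞)) (by isBoundedDefault) ?_)
    ENNReal.coe_lt_top
  intro b hb
  obtain ⟨n, hn⟩ := hb.exists
  exact hn.trans (hK n)

theorem martingale_of_setIntegral_eq [IsFiniteMeasure P] {M : ℝ≥0 → Ω → ℝ}
    (hM : StronglyAdapted 𝓕 M) (hint : ∀ t, Integrable (M t) P)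
    (h : ∀ s t, s ≤ t → ∀ A, MeasurableSet[𝓕 s] A → ∫ ω in A, M s ω ∂P = ∫ ω in A, M t ω ∂P) :
    Martingale M 𝓕 P := by
  refine ⟨hM, fun s t hst => ?_⟩
  symm
  exact ae_eq_condExp_of_forall_setIntegral_eq (𝓕.le s) (hint t)
    (fun _ _ _ => (hint s).integrableOn) (fun A hA _ => h s t hst A hA)
    (hM s).aestronglyMeasurable

/-- Approximation of a bounded random time from above by the dyadic rationals of level `k`. -/
def dyadicCeil (t : ℝ≥0) (ρ : Ω → ℝ≥0) (k : ℕ) (ω : Ω) : ℝ≥0 :=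
  min t ((⌈ρ ω * 2 ^ k⌉₊ : ℝ≥0) / 2 ^ k)

theorem le_dyadicCeil {t : ℝ≥0} {ρ : Ω → ℝ≥0} (hρ : ∀ ω, ρ ω ≤ t) (k : ℕ) (ω : Ω) :
    ρ ω ≤ dyadicCeil t ρ k ω := by
  refine le_min (hρ ω) ?_
  rw [le_div_iff₀ (by positivity)]
  exact Nat.le_ceil _

theorem tendsto_dyadicCeil {t : ℝ≥0} {ρ : Ω → ℝ≥0} (hρ : ∀ ω, ρ ω ≤ t) (ω : Ω) :
    Tendsto (fun k => dyadicCeil t ρ k ω) atTop (𝓝 (ρ ω)) := by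
  have hlim : Tendsto (fun k : ℕ => ρ ω + (1 / 2 : ℝ≥0) ^ k) atTop (𝓝 (ρ ω)) := by
    have h0 : Tendsto (fun k : ℕ => (1 / 2 : ℝ≥0) ^ k) atTop (𝓝 0) :=
      NNReal.tendsto_pow_atTop_nhds_zero_of_lt_one (by rw [div_lt_one (by norm_num)]; norm_num)
    simpa using tendsto_const_nhds.add h0
  refine tendsto_of_tendsto_of_tendsto_of_le_of_le tendsto_const_nhds hlim
    (fun k => le_dyadicCeil hρ k ω) (fun k => (min_le_right _ _).trans ?_)
  rw [div_le_iff₀ (by positivity), add_mul, ← mul_pow]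
  have h1 : (1 / 2 * 2 : ℝ≥0) = 1 := by norm_num
  rw [h1, one_pow]
  exact (Nat.ceil_lt_add_one zero_le).le

/-- For `i < t`, the rounded time is at most `i` exactly when `ρ` is at most the largest dyadic of
level `k` below `i`, an event already known at that dyadic. -/
theorem isStoppingTime_dyadicCeil (t : ℝ≥0) {ρ : Ω → ℝ≥0}
    (hst : IsStoppingTime 𝓕 fun ω => (ρ ω : WithTop ℝ≥0)) (k : ℕ) :
    IsStoppingTime 𝓕 fun ω => (dyadicCeil t ρ k ω : WithTop ℝ≥0) := by
  intro i
  simp only [WithTop.coe_le_coe]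
  by_cases hti : t ≤ i
  · have : {ω | dyadicCeil t ρ k ω ≤ i} = univ :=
      eq_univ_of_forall fun ω => (min_le_left _ _).trans hti
    rw [this]
    exact MeasurableSet.univ
  · have : {ω | dyadicCeil t ρ k ω ≤ i} = {ω | ρ ω ≤ (⌊i * 2 ^ k⌋₊ : ℝ≥0) / 2 ^ k} := by
      ext ω
      simp only [dyadicCeil, mem_ofPred_eq, min_le_iff, hti, false_or]
      rw [div_le_iff₀ (by positivity), le_div_iff₀ (by positivity), ← Nat.le_floor_iff zero_le,
        Nat.ceil_le]
    rw [this]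
    have hle : (⌊i * 2 ^ k⌋₊ : ℝ≥0) / 2 ^ k ≤ i := by
      rw [div_le_iff₀ (by positivity)]
      exact Nat.floor_le zero_le
    have h := hst ((⌊i * 2 ^ k⌋₊ : ℝ≥0) / 2 ^ k)
    simp only [WithTop.coe_le_coe] at h
    exact 𝓕.mono hle _ h

theorem countable_range_dyadicCeil (t : ℝ≥0) (ρ : Ω → ℝ≥0) (k : ℕ) :
    (range fun ω => (dyadicCeil t ρ k ω : WithTop ℝ≥0)).Countable := by
  refine (countable_range fun n : ℕ => ((min t ((n : ℝ≥0) / 2 ^ k) : ℝ≥0) : WithTop ℝ≥0)).mono ?_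
  rintro _ ⟨ω, rfl⟩
  exact ⟨_, rfl⟩

/-- Optional sampling for continuous martingales at bounded stopping times. -/
theorem Martingale.apply_stoppingTime_ae_eq_condExp [IsFiniteMeasure P] {M : ℝ≥0 → Ω → ℝ}
    (hM : Martingale M 𝓕 P) (hc : ∀ ω, Continuous fun t => M t ω) {t : ℝ≥0} {ρ : Ω → ℝ≥0}
    (hρ : ∀ ω, ρ ω ≤ t) (hst : IsStoppingTime 𝓕 fun ω => (ρ ω : WithTop ℝ≥0)) :
    (fun ω => M (ρ ω) ω) =ᵐ[P] P[M t | hst.measurableSpace] := by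
  have hk : ∀ k, (fun ω => M (dyadicCeil t ρ k ω) ω) =ᵐ[P]
      P[M t | (isStoppingTime_dyadicCeil t hst k).measurableSpace] := by
    intro k
    exact hM.stoppedValue_ae_eq_condExp_of_le_const_of_countable_range
      (isStoppingTime_dyadicCeil t hst k)
      (fun ω => WithTop.coe_le_coe.2 (min_le_left _ _)) (countable_range_dyadicCeil t ρ k)
  -- The sampled values at the countable levels are conditional expectations of the single variable
  -- `M t`. They are thus uniformly integrable, and pathwise convergence passes to integrals.
  have hui := (hM.integrable t).uniformIntegrable_condExp
    fun k => (isStoppingTime_dyadicCeil t hst k).measurableSpace_le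
  have hui' : UniformIntegrable (fun k ω => M (dyadicCeil t ρ k ω) ω) 1 P :=
    hui.ae_eq fun k => (hk k).symm
  have hlim : ∀ ω, Tendsto (fun k => M (dyadicCeil t ρ k ω) ω) atTop (𝓝 (M (ρ ω) ω)) :=
    fun ω => ((hc ω).tendsto _).comp (tendsto_dyadicCeil hρ ω)
  obtain ⟨K, hK⟩ := hui'.2.2
  have hint : Integrable (fun ω => M (ρ ω) ω) P :=
    integrable_of_unifIntegrable_tendsto hui'.1 hK (ae_of_all _ hlim)
  have hmeas : Measurable[hst.measurableSpace] fun ω => M (ρ ω) ω :=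
    measurable_stoppedValue (hM.1.isStronglyProgressive_of_continuous hc) hst
  refine ae_eq_condExp_of_forall_setIntegral_eq hst.measurableSpace_le (hM.integrable t)
    (fun _ _ _ => hint.integrableOn) (fun A hA _ => ?_) hmeas.aestronglyMeasurable
  have hl := tendsto_setIntegral_of_unifIntegrable
    (fun k => integrable_condExp.congr (hk k).symm) hint hui'.2.1 (ae_of_all _ hlim) A
  refine tendsto_nhds_unique hl (tendsto_const_nhds.congr fun k => ?_)
  have hA' : MeasurableSet[(isStoppingTime_dyadicCeil t hst k).measurableSpace] A :=
    IsStoppingTime.measurableSpace_mono hst (isStoppingTime_dyadicCeil t hst k)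
      (fun ω => WithTop.coe_le_coe.2 (le_dyadicCeil hρ k ω)) A hA
  rw [setIntegral_congr_ae (g := P[M t | (isStoppingTime_dyadicCeil t hst k).measurableSpace])
    (hst.measurableSpace_le A hA) ((hk k).mono fun ω h _ => h),
    setIntegral_condExp _ (hM.integrable t) hA']

/-- The random time `t ∧ τ`. -/
def minTime (t : ℝ≥0) (τ : Ω → WithTop ℝ≥0) (ω : Ω) : ℝ≥0 := (min (t : WithTop ℝ≥0) (τ ω)).untopA

theorem coe_minTime (t : ℝ≥0) (τ : Ω → WithTop ℝ≥0) (ω : Ω) :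
    (minTime t τ ω : WithTop ℝ≥0) = min (t : WithTop ℝ≥0) (τ ω) := by
  rw [minTime, WithTop.untopA_eq_untop
    (ne_top_of_le_ne_top WithTop.coe_ne_top (min_le_left _ _)), WithTop.coe_untop]

theorem minTime_le (t : ℝ≥0) (τ : Ω → WithTop ℝ≥0) (ω : Ω) : minTime t τ ω ≤ t := by
  rw [← WithTop.coe_le_coe, coe_minTime]; exact min_le_left _ _

theorem minTime_of_le {t : ℝ≥0} {τ : Ω → WithTop ℝ≥0} {ω : Ω} (h : (t : WithTop ℝ≥0) ≤ τ ω) :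
    minTime t τ ω = t := by
  rw [← WithTop.coe_inj, coe_minTime, min_eq_left h]

theorem isStoppingTime_minTime (t : ℝ≥0) {τ : Ω → WithTop ℝ≥0} (hτ : IsStoppingTime 𝓕 τ) :
    IsStoppingTime 𝓕 fun ω => (minTime t τ ω : WithTop ℝ≥0) := by
  simp only [coe_minTime]
  exact (isStoppingTime_const 𝓕 t).min hτ

theorem stoppedProcess_apply_minTime (M : ℝ≥0 → Ω → ℝ) (τ : Ω → WithTop ℝ≥0) (t : ℝ≥0) (ω : Ω) :
    stoppedProcess M τ t ω = M (minTime t τ ω) ω := rfl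

theorem continuous_stoppedProcess {M : ℝ≥0 → Ω → ℝ} (hc : ∀ ω, Continuous fun t => M t ω)
    (τ : Ω → WithTop ℝ≥0) (ω : Ω) : Continuous fun t => stoppedProcess M τ t ω := by
  have : Continuous fun t => minTime t τ ω := by
    rcases h : τ ω with _ | r
    · have : (fun t => minTime t τ ω) = fun t => t := by
        ext1 t; exact minTime_of_le (by rw [h]; exact le_top)
      rw [this]; exact continuous_id
    · have : (fun t => minTime t τ ω) = fun t => min t r := by
        ext1 t
        rw [← WithTop.coe_inj, coe_minTime, h]
        rfl
      rw [this]; fun_prop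
  exact (hc ω).comp this

/-- A continuous martingale stopped at a stopping time is a martingale. -/
theorem Martingale.stoppedProcess_of_continuous [IsFiniteMeasure P] {M : ℝ≥0 → Ω → ℝ}
    (hM : Martingale M 𝓕 P) (hc : ∀ ω, Continuous fun t => M t ω) {τ : Ω → WithTop ℝ≥0}
    (hτ : IsStoppingTime 𝓕 τ) : Martingale (stoppedProcess M τ) 𝓕 P := by
  have hce : ∀ t, stoppedProcess M τ t =ᵐ[P] P[M t | (isStoppingTime_minTime t hτ).measurableSpace] :=
    fun t => Martingale.apply_stoppingTime_ae_eq_condExp hM hc (minTime_le t τ)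
      (isStoppingTime_minTime t hτ)
  have hint : ∀ t, Integrable (stoppedProcess M τ t) P :=
    fun t => integrable_condExp.congr (hce t).symm
  have hMa := hM.1
  refine martingale_of_setIntegral_eq (hMa.stoppedProcess hc hτ) hint fun s t hst A hA => ?_
  -- The event `A` is split according to `s < τ`. On that part it belongs to the σ-field at `t ∧ τ`,
  -- so optional sampling applies; on the rest the stopped process no longer moves after `s`.
  have hlt : MeasurableSet[𝓕 s] {ω | (s : WithTop ℝ≥0) < τ ω} := hτ.measurableSet_gt s
  have hA' : MeasurableSet[𝓕 s] (A ∩ {ω | (s : WithTop ℝ≥0) < τ ω}) := hA.inter hlt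
  have hA'' : MeasurableSet[(isStoppingTime_minTime t hτ).measurableSpace]
      (A ∩ {ω | (s : WithTop ℝ≥0) < τ ω}) := by
    refine ⟨(le_iSup 𝓕 s) _ hA', fun i => ?_⟩
    by_cases hsi : s ≤ i
    · exact (𝓕.mono hsi _ hA').inter (isStoppingTime_minTime t hτ i)
    · have : A ∩ {ω | (s : WithTop ℝ≥0) < τ ω} ∩ {ω | (minTime t τ ω : WithTop ℝ≥0) ≤ i} = ∅ := by
        ext ω
        simp only [mem_inter_iff, mem_ofPred_eq, coe_minTime, mem_empty_iff_false, iff_false,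
          not_and, not_le, and_imp]
        intro _ h
        rw [not_le] at hsi
        exact lt_min (WithTop.coe_lt_coe.2 (hsi.trans_le hst)) ((WithTop.coe_lt_coe.2 hsi).trans h)
      rw [this]
      exact @MeasurableSet.empty _ (𝓕 i)
  have h1 : ∫ ω in A ∩ {ω | (s : WithTop ℝ≥0) < τ ω}, stoppedProcess M τ t ω ∂P =
      ∫ ω in A ∩ {ω | (s : WithTop ℝ≥0) < τ ω}, stoppedProcess M τ s ω ∂P := by
    rw [setIntegral_congr_ae (𝓕.le s _ hA') ((hce t).mono fun ω h _ => h),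
      setIntegral_condExp _ (hM.integrable t) hA'', ← hM.setIntegral_eq hst hA']
    refine setIntegral_congr_fun (𝓕.le s _ hA') fun ω hω => ?_
    simp only [stoppedProcess_apply_minTime]
    rw [minTime_of_le (le_of_lt hω.2)]
  have h2 : ∫ ω in A \ {ω | (s : WithTop ℝ≥0) < τ ω}, stoppedProcess M τ t ω ∂P =
      ∫ ω in A \ {ω | (s : WithTop ℝ≥0) < τ ω}, stoppedProcess M τ s ω ∂P := by
    refine setIntegral_congr_fun (𝓕.le s _ (hA.diff hlt)) fun ω hω => ?_
    simp only [stoppedProcess_apply_minTime]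
    have hle : τ ω ≤ s := not_lt.1 hω.2
    congr 1
    rw [← WithTop.coe_inj, coe_minTime, coe_minTime, min_eq_right hle,
      min_eq_right (hle.trans (WithTop.coe_le_coe.2 hst))]
  rw [← integral_inter_add_sdiff (𝓕.le s _ hlt) (hint s).integrableOn,
    ← integral_inter_add_sdiff (𝓕.le s _ hlt) (hint t).integrableOn, h1, h2]

end OptionalSampling

/-! ### Removing localization when brackets grow at most linearly. -/

section LocalMartingales

open Filter Topology

variable {Ω : Type*} {mΩ : MeasurableSpace Ω} {P : Measure Ω} {𝓕 : Filtration ℝ≥0 mΩ}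

/-- A local martingale can be replaced by an indistinguishable continuous adapted process that
starts at zero. -/
theorem exists_localizing_of_indistinguishable {Y Y' : ℝ≥0 → Ω → ℝ}
    (hY : Locally (fun Z => Martingale Z 𝓕 P) 𝓕 Y P) (hY' : StronglyAdapted 𝓕 Y')
    (hc : ∀ ω, Continuous fun t => Y' t ω) (h0 : ∀ ω, Y' 0 ω = 0)
    (heq : ∀ᵐ ω ∂P, ∀ t, Y t ω = Y' t ω) :
    ∃ τ : ℕ → Ω → WithTop ℝ≥0, IsLocalizingSequence 𝓕 τ P ∧
      ∀ n, Martingale (stoppedProcess Y' (τ n)) 𝓕 P := by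
  obtain ⟨τ, hτ, hm⟩ := hY
  refine ⟨τ, hτ, fun n => (hm n).congr (hY'.stoppedProcess hc (hτ.isStoppingTime n)) fun t => ?_⟩
  filter_upwards [heq] with ω hω
  change ({ω | ⊥ < τ n ω}.indicator (Y (minTime t (τ n) ω))) ω = Y' (minTime t (τ n) ω) ω
  -- Localization multiplies the stopped process by the indicator of `⊥ < τ n`. Where the stopping
  -- time is zero this agrees with stopping alone because `Y' 0 = 0`.
  by_cases h : ⊥ < τ n ω
  · rw [indicator_of_mem (by exact h), hω]
  · rw [indicator_of_notMem (by exact h)]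
    have h1 : τ n ω = ⊥ := not_bot_lt_iff.1 h
    have h2 : minTime t (τ n) ω = 0 := by
      rw [← WithTop.coe_inj, coe_minTime, h1, min_eq_right bot_le]
      rfl
    rw [h2, h0]

theorem eventually_minTime_eq {τ : ℕ → Ω → WithTop ℝ≥0} {ω : Ω}
    (h : Tendsto (fun n => τ n ω) atTop (𝓝 ⊤)) (t : ℝ≥0) :
    ∀ᶠ n in atTop, minTime t (τ n) ω = t := by
  have : ∀ᶠ n in atTop, (t : WithTop ℝ≥0) < τ n ω :=
    h.eventually (lt_mem_nhds (WithTop.coe_lt_top t))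
  filter_upwards [this] with n hn using minTime_of_le hn.le

theorem eLpNorm_two_le_of_lintegral_sq_le {f : Ω → ℝ} {c : ℝ}
    (h : ∫⁻ ω, ENNReal.ofReal (f ω * f ω) ∂P ≤ ENNReal.ofReal c) :
    eLpNorm f 2 P ≤ ((c.toNNReal ^ (1 / 2 : ℝ) : ℝ≥0) : ℝ≥0∞) := by
  rw [eLpNorm_eq_lintegral_rpow_enorm_toReal (by norm_num) (by norm_num),
    ENNReal.coe_rpow_of_nonneg _ (by norm_num)]
  have h2 : (2 : ℝ≥0∞).toReal = 2 := by norm_num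
  rw [h2]
  refine ENNReal.rpow_le_rpow (le_trans (le_of_eq ?_) h) (by norm_num)
  refine lintegral_congr fun ω => ?_
  rw [← Real.enorm_abs, Real.enorm_of_nonneg (abs_nonneg _),
    ENNReal.ofReal_rpow_of_nonneg (abs_nonneg _) (by norm_num), Real.rpow_two, sq_abs, sq]

variable [IsProbabilityMeasure P]

/-- At the time `t ∧ τ ∧ ρ n` the stopped process `M² - C` has mean zero, so the second moment of
`M` equals the mean of `C`, which is at most `K t`. Fatou's lemma then removes `ρ n`. -/
theorem lintegral_sq_stopped_le {M C : ℝ≥0 → Ω → ℝ} (hM : StronglyAdapted 𝓕 M)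
    (hMc : ∀ ω, Continuous fun t => M t ω) (hM0 : ∀ ω, M 0 ω = 0) (hC : StronglyAdapted 𝓕 C)
    (hCc : ∀ ω, Continuous fun t => C t ω) (hC0 : ∀ ω, C 0 ω = 0) {K : ℝ} (hK : 0 ≤ K)
    (hCK : ∀ t ω, |C t ω| ≤ K * t) {ρ : ℕ → Ω → WithTop ℝ≥0} (hρ : IsLocalizingSequence 𝓕 ρ P)
    (hN : ∀ n, Martingale (stoppedProcess (fun t ω => M t ω * M t ω - C t ω) (ρ n)) 𝓕 P)
    {τ : Ω → WithTop ℝ≥0} (hτ : IsStoppingTime 𝓕 τ) (t : ℝ≥0) :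
    ∫⁻ ω, ENNReal.ofReal (M (minTime t τ ω) ω * M (minTime t τ ω) ω) ∂P ≤
      ENNReal.ofReal (K * t) := by
  set N : ℝ≥0 → Ω → ℝ := fun t ω => M t ω * M t ω - C t ω with hNdef
  have hNc : ∀ ω, Continuous fun t => N t ω := fun ω => ((hMc ω).mul (hMc ω)).sub (hCc ω)
  have key : ∀ n, ∫⁻ ω, ENNReal.ofReal (M (minTime t (τ ⊓ ρ n) ω) ω * M (minTime t (τ ⊓ ρ n) ω) ω)
      ∂P ≤ ENNReal.ofReal (K * t) := by
    intro n
    have hm := Martingale.stoppedProcess_of_continuous (hN n)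
      (continuous_stoppedProcess hNc (ρ n)) hτ
    rw [stoppedProcess_stoppedProcess] at hm
    have hst : IsStoppingTime 𝓕 (τ ⊓ ρ n) := hτ.min (hρ.isStoppingTime n)
    have hint := hm.integrable t
    have h0 : ∫ ω, stoppedProcess N (τ ⊓ ρ n) t ω ∂P = 0 := by
      have := hm.setIntegral_eq (zero_le (a := t)) MeasurableSet.univ
      rw [setIntegral_univ, setIntegral_univ] at this
      rw [← this]
      have hz : ∀ ω, stoppedProcess N (τ ⊓ ρ n) 0 ω = 0 := by
        intro ω
        change N (minTime 0 (τ ⊓ ρ n) ω) ω = 0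
        rw [le_antisymm (minTime_le 0 (τ ⊓ ρ n) ω) zero_le]
        simp [hNdef, hM0, hC0]
      simp [hz]
    have hCm : AEStronglyMeasurable (fun ω => C (minTime t (τ ⊓ ρ n) ω) ω) P :=
      (hC.stronglyMeasurable_stoppedProcess hCc hst t).aestronglyMeasurable
    have hCb : ∀ ω, |C (minTime t (τ ⊓ ρ n) ω) ω| ≤ K * t := fun ω =>
      (hCK _ _).trans (mul_le_mul_of_nonneg_left
        (NNReal.coe_le_coe.2 (minTime_le t (τ ⊓ ρ n) ω)) hK)
    have hCi : Integrable (fun ω => C (minTime t (τ ⊓ ρ n) ω) ω) P :=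
      Integrable.of_bound hCm (K * t) (ae_of_all _ hCb)
    have heq : (fun ω => M (minTime t (τ ⊓ ρ n) ω) ω * M (minTime t (τ ⊓ ρ n) ω) ω) =
        fun ω => stoppedProcess N (τ ⊓ ρ n) t ω + C (minTime t (τ ⊓ ρ n) ω) ω := by
      ext1 ω
      change _ = N (minTime t (τ ⊓ ρ n) ω) ω + _
      simp [hNdef]
    have hMi : Integrable
        (fun ω => M (minTime t (τ ⊓ ρ n) ω) ω * M (minTime t (τ ⊓ ρ n) ω) ω) P := by
      rw [heq]; exact hint.add hCi
    rw [← ofReal_integral_eq_lintegral_ofReal hMi (ae_of_all _ fun ω => mul_self_nonneg _)]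
    refine ENNReal.ofReal_le_ofReal ?_
    rw [heq, integral_add hint hCi, h0, zero_add]
    calc ∫ ω, C (minTime t (τ ⊓ ρ n) ω) ω ∂P ≤ ∫ _, K * t ∂P :=
          integral_mono hCi (integrable_const _) fun ω => (le_abs_self _).trans (hCb ω)
      _ = K * t := by simp
  have hmeas : ∀ n, AEMeasurable (fun ω =>
      ENNReal.ofReal (M (minTime t (τ ⊓ ρ n) ω) ω * M (minTime t (τ ⊓ ρ n) ω) ω)) P := by
    intro n
    have hst : IsStoppingTime 𝓕 (τ ⊓ ρ n) := hτ.min (hρ.isStoppingTime n)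
    have h := (hM.stronglyMeasurable_stoppedProcess hMc hst t).measurable
    exact (h.mul h).ennreal_ofReal.aemeasurable
  have hlim : ∀ᵐ ω ∂P, ENNReal.ofReal (M (minTime t τ ω) ω * M (minTime t τ ω) ω) =
      liminf (fun n =>
        ENNReal.ofReal (M (minTime t (τ ⊓ ρ n) ω) ω * M (minTime t (τ ⊓ ρ n) ω) ω)) atTop := by
    filter_upwards [hρ.tendsto_top] with ω hω
    have : ∀ᶠ n in atTop, minTime t (τ ⊓ ρ n) ω = minTime t τ ω := by
      have : ∀ᶠ n in atTop, (t : WithTop ℝ≥0) < ρ n ω :=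
        hω.eventually (lt_mem_nhds (WithTop.coe_lt_top t))
      filter_upwards [this] with n hn
      rw [← WithTop.coe_inj, coe_minTime, coe_minTime, Pi.inf_apply]
      rw [← min_assoc, min_eq_left ((min_le_left _ _).trans hn.le)]
    rw [liminf_congr (this.mono fun n hn => by rw [hn])]
    simp
  rw [lintegral_congr_ae hlim]
  refine (lintegral_liminf_le' hmeas).trans ?_
  refine liminf_le_of_le (by isBoundedDefault) fun b hb => ?_
  obtain ⟨n, hn⟩ := hb.exists
  exact hn.trans (key n)

/-- A continuous local martingale whose quadratic variation is bounded by a linear function is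
a square integrable martingale. -/
theorem martingale_of_bounded_bracket {M C : ℝ≥0 → Ω → ℝ} (hM : StronglyAdapted 𝓕 M)
    (hMc : ∀ ω, Continuous fun t => M t ω) (hM0 : ∀ ω, M 0 ω = 0) (hC : StronglyAdapted 𝓕 C)
    (hCc : ∀ ω, Continuous fun t => C t ω) (hC0 : ∀ ω, C 0 ω = 0) {K : ℝ} (hK : 0 ≤ K)
    (hCK : ∀ t ω, |C t ω| ≤ K * t) {ρ : ℕ → Ω → WithTop ℝ≥0} (hρ : IsLocalizingSequence 𝓕 ρ P)
    (hN : ∀ n, Martingale (stoppedProcess (fun t ω => M t ω * M t ω - C t ω) (ρ n)) 𝓕 P)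
    {τ : ℕ → Ω → WithTop ℝ≥0} (hτ : IsLocalizingSequence 𝓕 τ P)
    (hMτ : ∀ n, Martingale (stoppedProcess M (τ n)) 𝓕 P) :
    Martingale M 𝓕 P ∧ ∀ t, MemLp (M t) 2 P := by
  have hL2 : ∀ t, MemLp (M t) 2 P := by
    intro t
    refine ⟨((hM t).mono (𝓕.le t)).aestronglyMeasurable, ?_⟩
    -- The stopping time `⊤` gives the second moment of `M t` itself.
    have h := lintegral_sq_stopped_le hM hMc hM0 hC hCc hC0 hK hCK hρ hN
      (τ := fun _ => ⊤) (isLocalizingSequence_const_top 𝓕 P |>.isStoppingTime 0) t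
    have h' : ∀ ω, minTime t (fun _ : Ω => ⊤) ω = t := fun ω => minTime_of_le le_top
    simp only [h'] at h
    exact (eLpNorm_two_le_of_lintegral_sq_le h).trans_lt ENNReal.coe_lt_top
  refine ⟨martingale_of_setIntegral_eq hM (fun t => (hL2 t).integrable (by norm_num)) ?_, hL2⟩
  have hconv : ∀ t A, Tendsto (fun n => ∫ ω in A, stoppedProcess M (τ n) t ω ∂P) atTop
      (𝓝 (∫ ω in A, M t ω ∂P)) := by
    intro t A
    refine tendsto_setIntegral_of_unifIntegrable (fun n => (hMτ n).integrable t)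
      ((hL2 t).integrable (by norm_num)) ?_ ?_ A
    -- The second moment bound does not depend on the localizing time, so the stopped values are
    -- uniformly integrable.
    · refine unifIntegrable_one_of_eLpNorm_two_le
        (fun n => ((hMτ n).integrable t).aestronglyMeasurable)
        (K := (K * t).toNNReal ^ (1 / 2 : ℝ)) fun n => ?_
      exact eLpNorm_two_le_of_lintegral_sq_le
        (lintegral_sq_stopped_le hM hMc hM0 hC hCc hC0 hK hCK hρ hN (hτ.isStoppingTime n) t)
    · filter_upwards [hτ.tendsto_top] with ω hω
      refine tendsto_const_nhds.congr' ?_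
      filter_upwards [eventually_minTime_eq hω t] with n hn
      rw [stoppedProcess_apply_minTime, hn]
  intro s t hst A hA
  refine tendsto_nhds_unique (hconv s A) ((hconv t A).congr fun n => ?_)
  exact ((hMτ n).setIntegral_eq hst hA).symm

/-- The covariation property of square integrable continuous martingales holds without
localization if the bracket is bounded by a linear function. -/
theorem martingale_mul_sub_of_bounded_bracket {M₁ M₂ C : ℝ≥0 → Ω → ℝ}
    (hM₁ : Martingale M₁ 𝓕 P) (hM₂ : Martingale M₂ 𝓕 P) (h₁ : ∀ t, MemLp (M₁ t) 2 P)
    (h₂ : ∀ t, MemLp (M₂ t) 2 P) (hc₁ : ∀ ω, Continuous fun t => M₁ t ω)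
    (hc₂ : ∀ ω, Continuous fun t => M₂ t ω) (hC : StronglyAdapted 𝓕 C) {K : ℝ} (hK : 0 ≤ K)
    (hCK : ∀ t ω, |C t ω| ≤ K * t) {ρ : ℕ → Ω → WithTop ℝ≥0} (hρ : IsLocalizingSequence 𝓕 ρ P)
    (hN : ∀ n, Martingale (stoppedProcess (fun t ω => M₁ t ω * M₂ t ω - C t ω) (ρ n)) 𝓕 P) :
    Martingale (fun t ω => M₁ t ω * M₂ t ω - C t ω) 𝓕 P := by
  have hCi : ∀ t, Integrable (C t) P := fun t =>
    Integrable.of_bound ((hC t).mono (𝓕.le t)).aestronglyMeasurable (K * t)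
      (ae_of_all _ (hCK t))
  have hint : ∀ t, Integrable (fun ω => M₁ t ω * M₂ t ω - C t ω) P := fun t =>
    ((h₁ t).integrable_mul (h₂ t)).sub (hCi t)
  -- Bounded second moments do not make the products uniformly integrable. Optional sampling and
  -- Jensen's inequality dominate the stopped squares by conditional expectations of `M t ^ 2`,
  -- which are uniformly integrable.
  have hsq : ∀ {M : ℝ≥0 → Ω → ℝ}, Martingale M 𝓕 P → (∀ t, MemLp (M t) 2 P) →
      (∀ ω, Continuous fun t => M t ω) → ∀ t n, ∀ᵐ ω ∂P,
      M (minTime t (ρ n) ω) ω ^ 2 ≤ (P[fun ω => M t ω ^ 2 |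
        (isStoppingTime_minTime t (hρ.isStoppingTime n)).measurableSpace]) ω := by
    intro M hM h2 hc t n
    have e := Martingale.apply_stoppingTime_ae_eq_condExp hM hc (minTime_le t (ρ n))
      (isStoppingTime_minTime t (hρ.isStoppingTime n))
    have j := ConvexOn.map_condExp_le_univ (μ := P) (φ := fun x : ℝ => x ^ 2) (f := M t)
      (isStoppingTime_minTime t (hρ.isStoppingTime n)).measurableSpace_le
      (Even.convexOn_pow even_two) (continuous_pow 2).lowerSemicontinuous (hM.integrable t)
      (h2 t).integrable_sq
    filter_upwards [e, j] with ω he hj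
    rw [he]
    exact hj
  refine martingale_of_setIntegral_eq ((hM₁.1.mul hM₂.1).sub hC) hint ?_
  have hconv : ∀ t A, Tendsto (fun n =>
      ∫ ω in A, stoppedProcess (fun t ω => M₁ t ω * M₂ t ω - C t ω) (ρ n) t ω ∂P) atTop
      (𝓝 (∫ ω in A, M₁ t ω * M₂ t ω - C t ω ∂P)) := by
    intro t A
    refine tendsto_setIntegral_of_unifIntegrable (fun n => (hN n).integrable t) (hint t) ?_ ?_ A
    · have u₁ := ((h₁ t).integrable_sq).uniformIntegrable_condExp
        fun n => (isStoppingTime_minTime t (hρ.isStoppingTime n)).measurableSpace_le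
      have u₂ := ((h₂ t).integrable_sq).uniformIntegrable_condExp
        fun n => (isStoppingTime_minTime t (hρ.isStoppingTime n)).measurableSpace_le
      have u₃ : UnifIntegrable (fun (_ : ℕ) (_ : Ω) => K * (t : ℝ)) 1 P :=
        unifIntegrable_const le_rfl ENNReal.one_ne_top (memLp_const _)
      have u := (u₁.2.1.add u₂.2.1 le_rfl u₁.1 u₂.1).add u₃ le_rfl
        (fun n => (u₁.1 n).add (u₂.1 n)) (fun n => aestronglyMeasurable_const)
      refine unifIntegrable_of_ae_norm_le u fun n => ?_
      filter_upwards [hsq hM₁ h₁ hc₁ t n, hsq hM₂ h₂ hc₂ t n] with ω e₁ e₂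
      simp only [Pi.add_apply]
      rw [stoppedProcess_apply_minTime, Real.norm_eq_abs, Real.norm_eq_abs]
      have e₃ : |C (minTime t (ρ n) ω) ω| ≤ K * t := (hCK _ _).trans (mul_le_mul_of_nonneg_left
        (NNReal.coe_le_coe.2 (minTime_le t (ρ n) ω)) hK)
      refine le_trans ?_ (le_abs_self _)
      have e₄ : |M₁ (minTime t (ρ n) ω) ω * M₂ (minTime t (ρ n) ω) ω| ≤
          M₁ (minTime t (ρ n) ω) ω ^ 2 + M₂ (minTime t (ρ n) ω) ω ^ 2 := by
        rw [abs_le]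
        constructor <;> nlinarith [sq_nonneg (M₁ (minTime t (ρ n) ω) ω + M₂ (minTime t (ρ n) ω) ω),
          sq_nonneg (M₁ (minTime t (ρ n) ω) ω - M₂ (minTime t (ρ n) ω) ω)]
      refine (abs_sub _ _).trans ?_
      linarith
    · filter_upwards [hρ.tendsto_top] with ω hω
      refine tendsto_const_nhds.congr' ?_
      filter_upwards [eventually_minTime_eq hω t] with n hn
      rw [stoppedProcess_apply_minTime, hn]
  intro s t hst A hA
  refine tendsto_nhds_unique (hconv s A) ((hconv t A).congr fun n => ?_)
  exact ((hN n).setIntegral_eq hst hA).symm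

end LocalMartingales

/-! ### The martingale problem in terms of increments. -/

section Increments

open Filter Topology

theorem integrableOn_Ioc_of_bound {f : ℝ≥0 → ℝ} {K : ℝ≥0} (hf : Measurable f)
    (hK : ∀ u, |f u| ≤ K) (s r : ℝ≥0) : IntegrableOn f (Ioc s r) lebesgue :=
  Integrable.of_bound hf.aestronglyMeasurable K (ae_of_all _ hK)

theorem abs_setIntegral_Ioc_le {f : ℝ≥0 → ℝ} {K : ℝ≥0} (hK : ∀ u, |f u| ≤ K)
    {s r : ℝ≥0} (h : s ≤ r) : |∫ u in Ioc s r, f u ∂lebesgue| ≤ K * (r - s) := by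
  have := norm_setIntegral_le_of_norm_le_const (μ := lebesgue) (s := Ioc s r) (f := f) (C := K)
    (by rw [lebesgue_Ioc]; exact ENNReal.ofReal_lt_top) fun u _ => hK u
  rwa [measureReal_lebesgue_Ioc h] at this

theorem lipschitzWith_setIntegral_Ioc {f : ℝ≥0 → ℝ} {K : ℝ≥0} (hf : Measurable f)
    (hK : ∀ u, |f u| ≤ K) : LipschitzWith K fun t => ∫ u in Ioc 0 t, f u ∂lebesgue := by
  have key : ∀ s r : ℝ≥0, s ≤ r →
      dist (∫ u in Ioc 0 r, f u ∂lebesgue) (∫ u in Ioc 0 s, f u ∂lebesgue) ≤ K * dist r s := by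
    intro s r hsr
    rw [setIntegral_Ioc_adjacent zero_le hsr (integrableOn_Ioc_of_bound hf hK _ _), Real.dist_eq,
      add_sub_cancel_left, NNReal.dist_eq, abs_of_nonneg (sub_nonneg.2 (NNReal.coe_le_coe.2 hsr))]
    exact abs_setIntegral_Ioc_le hK hsr
  refine LipschitzWith.of_dist_le_mul fun s r => ?_
  rcases le_total s r with h | h
  · rw [dist_comm, dist_comm s r]; exact key s r h
  · exact key r s h

variable {d : ℕ}

/-- The `i`-th coordinate of `X_r - X_s - ∫_s^r β_u du`. -/
def incr (β : ℝ≥0 → PathSpace d → E d) (i : Fin d) (s r : ℝ≥0) (ω : PathSpace d) : ℝ :=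
  X r ω i - X s ω i - ∫ u in Ioc s r, β u ω i ∂lebesgue

/-- The integral `∫_s^r a_ij(X_u) du`. -/
def covInt (a : E d → Matrix (Fin d) (Fin d) ℝ) (i j : Fin d) (s r : ℝ≥0) (ω : PathSpace d) : ℝ :=
  ∫ u in Ioc s r, a (X u ω) i j ∂lebesgue

/-- Bounded Borel functionals of time and path that depend only on the past of the path. -/
structure Nonanticipating (K : ℝ≥0) (β : ℝ≥0 → PathSpace d → E d) : Prop where
  measurable : Measurable (Function.uncurry β)
  stop_eq : ∀ s ω, β s (stopAt s ω) = β s ω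
  bound : ∀ s ω i, |β s ω i| ≤ K

/-- Continuous matrix fields with bounded entries. -/
structure BoundedMatrixField (K : ℝ≥0) (a : E d → Matrix (Fin d) (Fin d) ℝ) : Prop where
  continuous : Continuous a
  bound : ∀ x i j, |a x i j| ≤ K

/-- The increment of `X - ∫ β` over `(s, r]` is square integrable, orthogonal to `𝓕_s`, and has
conditional covariance `∫_s^r a(X_u) du`. -/
structure IncrementProblem (a : E d → Matrix (Fin d) (Fin d) ℝ) (β : ℝ≥0 → PathSpace d → E d)
    (P : Measure (PathSpace d)) (s r : ℝ≥0) : Prop where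
  memLp : ∀ i, MemLp (incr β i s r) 2 P
  fst : ∀ i A, MeasurableSet[canonicalFiltration d s] A → ∫ ω in A, incr β i s r ω ∂P = 0
  snd : ∀ i j A, MeasurableSet[canonicalFiltration d s] A →
    ∫ ω in A, (incr β i s r ω * incr β j s r ω - covInt a i j s r ω) ∂P = 0

variable {a : E d → Matrix (Fin d) (Fin d) ℝ} {β : ℝ≥0 → PathSpace d → E d} {K : ℝ≥0}

theorem measurable_coord (i : Fin d) : Measurable fun x : E d => x i :=
  (EuclideanSpace.proj (𝕜 := ℝ) i).continuous.measurable

theorem measurable_X_coord (s : ℝ≥0) (i : Fin d) :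
    Measurable fun ω : PathSpace d => X s ω i :=
  (measurable_coord i).comp (continuous_X s).measurable

theorem measurable_incr_param {Y : Type*} [MeasurableSpace Y] {B : Y → ℝ≥0 → PathSpace d → E d}
    (hB : Measurable fun p : Y × ℝ≥0 × PathSpace d => B p.1 p.2.1 p.2.2) (i : Fin d) (s r : ℝ≥0) :
    Measurable fun p : Y × PathSpace d => incr (B p.1) i s r p.2 := by
  refine ((measurable_X_coord r i).comp measurable_snd).sub
    ((measurable_X_coord s i).comp measurable_snd) |>.sub ?_
  have h : Measurable (Function.uncurry fun (p : Y × PathSpace d) (u : ℝ≥0) => B p.1 u p.2 i) :=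
    (measurable_coord i).comp (hB.comp (f := fun q : (Y × PathSpace d) × ℝ≥0 =>
      (q.1.1, q.2, q.1.2)) (by fun_prop))
  exact (h.stronglyMeasurable.integral_prod_right (ν := lebesgue.restrict (Ioc s r))).measurable

theorem measurable_incr (hβ : Measurable (Function.uncurry β)) (i : Fin d) (s r : ℝ≥0) :
    Measurable (incr β i s r) := by
  have h := measurable_incr_param (Y := Unit) (B := fun _ => β)
    (hβ.comp (f := fun p : Unit × ℝ≥0 × PathSpace d => p.2) measurable_snd) i s r
  exact h.comp (f := fun ω : PathSpace d => ((), ω)) (by fun_prop)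

theorem BoundedMatrixField.measurable (ha : BoundedMatrixField K a) (i j : Fin d) :
    Measurable fun x => a x i j :=
  ((continuous_apply j).comp ((continuous_apply i).comp ha.continuous)).measurable

theorem BoundedMatrixField.measurable_uncurry (ha : BoundedMatrixField K a) (i j : Fin d) :
    Measurable (Function.uncurry fun (u : ℝ≥0) (ω : PathSpace d) => a (X u ω) i j) :=
  (ha.measurable i j).comp continuous_X_uncurry.measurable

theorem measurable_covInt (ha : BoundedMatrixField K a) (i j : Fin d) (s r : ℝ≥0) :
    Measurable (covInt a i j s r) := by
  have h : Measurable (Function.uncurry fun (ω : PathSpace d) (u : ℝ≥0) => a (X u ω) i j) :=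
    (ha.measurable_uncurry i j).comp measurable_swap
  exact (h.stronglyMeasurable.integral_prod_right (ν := lebesgue.restrict (Ioc s r))).measurable

theorem Nonanticipating.measurable_path (hβ : Nonanticipating K β) (i : Fin d) (ω : PathSpace d) :
    Measurable fun u => β u ω i :=
  (measurable_coord i).comp (hβ.measurable.comp (f := fun u => (u, ω)) (by fun_prop))

theorem BoundedMatrixField.measurable_path (ha : BoundedMatrixField K a) (i j : Fin d)
    (ω : PathSpace d) : Measurable fun u => a (X u ω) i j :=
  (ha.measurable_uncurry i j).comp (f := fun u => (u, ω)) (by fun_prop)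

theorem X_stop {u s : ℝ≥0} (h : u ≤ s) (ω : PathSpace d) : X u (stopAt s ω) = X u ω := by
  simp [X, min_eq_left h]

theorem Nonanticipating.stop_eq_of_le (hβ : Nonanticipating K β) {u s : ℝ≥0} (h : u ≤ s)
    (ω : PathSpace d) : β u (stopAt s ω) = β u ω := by
  rw [← hβ.stop_eq u (stopAt s ω), stop_stop, min_eq_left h, hβ.stop_eq]

theorem incr_stop (hβ : Nonanticipating K β) (i : Fin d) {s r t : ℝ≥0} (hsr : s ≤ r) (hrt : r ≤ t)
    (ω : PathSpace d) : incr β i s r (stopAt t ω) = incr β i s r ω := by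
  unfold incr
  rw [X_stop hrt, X_stop (hsr.trans hrt)]
  congr 1
  refine setIntegral_congr_fun measurableSet_Ioc fun u hu => ?_
  simp only [hβ.stop_eq_of_le (hu.2.trans hrt)]

theorem covInt_stop (i j : Fin d) {s r t : ℝ≥0} (hrt : r ≤ t)
    (ω : PathSpace d) : covInt a i j s r (stopAt t ω) = covInt a i j s r ω := by
  unfold covInt
  refine setIntegral_congr_fun measurableSet_Ioc fun u hu => ?_
  simp only [X_stop (hu.2.trans hrt)]

theorem measurable_incr_filtration (hβ : Nonanticipating K β) (i : Fin d) {s r t : ℝ≥0}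
    (hsr : s ≤ r) (hrt : r ≤ t) : Measurable[canonicalFiltration d t] (incr β i s r) :=
  measurable_canonicalFiltration_iff.2 ⟨measurable_incr hβ.measurable i s r,
    incr_stop hβ i hsr hrt⟩

theorem measurable_covInt_filtration (ha : BoundedMatrixField K a) (i j : Fin d) {s r t : ℝ≥0}
    (hrt : r ≤ t) : Measurable[canonicalFiltration d t] (covInt a i j s r) :=
  measurable_canonicalFiltration_iff.2 ⟨measurable_covInt ha i j s r, covInt_stop i j hrt⟩

theorem abs_covInt_le (ha : BoundedMatrixField K a) (i j : Fin d) {s r : ℝ≥0} (h : s ≤ r)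
    (ω : PathSpace d) : |covInt a i j s r ω| ≤ K * (r - s) :=
  abs_setIntegral_Ioc_le (fun _ => ha.bound _ _ _) h

theorem incr_add (hβ : Nonanticipating K β) (i : Fin d) {s t r : ℝ≥0} (hst : s ≤ t) (htr : t ≤ r)
    (ω : PathSpace d) : incr β i s r ω = incr β i s t ω + incr β i t r ω := by
  unfold incr
  rw [setIntegral_Ioc_adjacent hst htr (integrableOn_Ioc_of_bound (hβ.measurable_path i ω)
    (fun u => hβ.bound u ω i) s r)]
  ring

theorem covInt_add (ha : BoundedMatrixField K a) (i j : Fin d) {s t r : ℝ≥0} (hst : s ≤ t)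
    (htr : t ≤ r) (ω : PathSpace d) :
    covInt a i j s r ω = covInt a i j s t ω + covInt a i j t r ω :=
  setIntegral_Ioc_adjacent hst htr (integrableOn_Ioc_of_bound (ha.measurable_path i j ω)
    (fun _ => ha.bound _ _ _) s r)

theorem incr_add_left {β' : ℝ≥0 → PathSpace d → E d} {ω ω' : PathSpace d} {t : ℝ≥0}
    (hω : shift t ω = ω') (hβ : ∀ u, β (t + u) ω = β' u ω') (i : Fin d) (s r : ℝ≥0) :
    incr β i (t + s) (t + r) ω = incr β' i s r ω' := by
  unfold incr
  rw [setIntegral_Ioc_add]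
  simp only [hβ]
  subst hω
  simp [X, add_comm]

theorem covInt_add_left (t : ℝ≥0) (i j : Fin d) (s r : ℝ≥0) (ω : PathSpace d) :
    covInt a i j (t + s) (t + r) ω = covInt a i j s r (shift t ω) := by
  unfold covInt
  rw [setIntegral_Ioc_add]
  simp [X, add_comm]

theorem continuous_incr (hβ : Nonanticipating K β) (i : Fin d) (ω : PathSpace d) :
    Continuous fun t => incr β i 0 t ω := by
  unfold incr
  refine Continuous.sub (Continuous.sub ?_ continuous_const)
    (lipschitzWith_setIntegral_Ioc (hβ.measurable_path i ω) fun u => hβ.bound u ω i).continuous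
  exact (EuclideanSpace.proj (𝕜 := ℝ) i).continuous.comp ω.continuous

theorem continuous_covInt (ha : BoundedMatrixField K a) (i j : Fin d) (ω : PathSpace d) :
    Continuous fun t => covInt a i j 0 t ω :=
  (lipschitzWith_setIntegral_Ioc (ha.measurable_path i j ω) fun _ => ha.bound _ _ _).continuous

@[simp] theorem incr_self (i : Fin d) (s : ℝ≥0) (ω : PathSpace d) : incr β i s s ω = 0 := by
  simp [incr]

@[simp] theorem covInt_self (i j : Fin d) (s : ℝ≥0) (ω : PathSpace d) :
    covInt a i j s s ω = 0 := by
  simp [covInt]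

variable {P : Measure (PathSpace d)}

theorem integrable_covInt [IsFiniteMeasure P] (ha : BoundedMatrixField K a) (i j : Fin d) {s r : ℝ≥0} (h : s ≤ r) :
    Integrable (covInt a i j s r) P :=
  Integrable.of_bound (measurable_covInt ha i j s r).aestronglyMeasurable (K * (r - s))
    (ae_of_all _ fun ω => abs_covInt_le ha i j h ω)

/-- An increment that is orthogonal to a σ-field is orthogonal to square integrable measurable
multipliers. -/
theorem setIntegral_mul_eq_zero {Ω : Type*} {m mΩ : MeasurableSpace Ω} {P : Measure Ω}
    [IsFiniteMeasure P] (hm : m ≤ mΩ) {f g : Ω → ℝ} (hf : MemLp f 2 P) (hg : MemLp g 2 P)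
    (hgm : Measurable[m] g) (h : ∀ A, MeasurableSet[m] A → ∫ ω in A, f ω ∂P = 0) {A : Set Ω}
    (hA : MeasurableSet[m] A) : ∫ ω in A, g ω * f ω ∂P = 0 := by
  have hfi : Integrable f P := hf.integrable (by norm_num)
  have h0 : (0 : Ω → ℝ) =ᵐ[P] P[f | m] := by
    refine ae_eq_condExp_of_forall_setIntegral_eq hm hfi
      (fun _ _ _ => (integrable_zero _ _ _).integrableOn) (fun B hB _ => ?_)
      stronglyMeasurable_zero.aestronglyMeasurable
    simp [h B hB]
  have hgf : Integrable (g * f) P := hg.integrable_mul hf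
  have h1 := condExp_mul_of_stronglyMeasurable_left (μ := P) (m := m) hgm.stronglyMeasurable hgf hfi
  have h2 := setIntegral_condExp hm hgf hA
  change ∫ ω in A, (g * f) ω ∂P = 0
  rw [← h2, setIntegral_congr_ae (g := fun _ => (0 : ℝ)) (hm A hA)]
  · simp
  · filter_upwards [h0, h1] with ω e0 e1 _
    rw [e1, Pi.mul_apply, ← e0]
    simp

theorem setIntegral_add_add_add {Ω : Type*} {mΩ : MeasurableSpace Ω} {P : Measure Ω}
    {f g u v : Ω → ℝ} (hf : Integrable f P) (hg : Integrable g P) (hu : Integrable u P)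
    (hv : Integrable v P) (A : Set Ω) :
    ∫ ω in A, (f ω + g ω + (u ω + v ω)) ∂P =
      ∫ ω in A, f ω ∂P + ∫ ω in A, g ω ∂P + (∫ ω in A, u ω ∂P + ∫ ω in A, v ω ∂P) := by
  rw [← integral_add hu.integrableOn hv.integrableOn, ← integral_add hf.integrableOn
    hg.integrableOn]
  exact integral_add (hf.add hg).integrableOn (hu.add hv).integrableOn

theorem IncrementProblem.integrable_mul {s r : ℝ≥0} (h : IncrementProblem a β P s r)
    (i j : Fin d) : Integrable (fun ω => incr β i s r ω * incr β j s r ω) P :=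
  (h.memLp i).integrable_mul (h.memLp j)

theorem IncrementProblem.refl (s : ℝ≥0) : IncrementProblem a β P s s where
  memLp i := by
    have : incr β i s s = 0 := by ext1 ω; simp
    rw [this]; exact MemLp.zero
  fst i A _ := by simp
  snd i j A _ := by simp

variable [IsProbabilityMeasure P]

/-- The cross terms vanish: the earlier increment is square integrable and `𝓕_t`-measurable, the
later one is orthogonal to `𝓕_t`. This joins the problems before and after the gluing time. -/
theorem IncrementProblem.trans (ha : BoundedMatrixField K a) (hβ : Nonanticipating K β)
    {s t r : ℝ≥0} (hst : s ≤ t) (htr : t ≤ r) (h₁ : IncrementProblem a β P s t)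
    (h₂ : IncrementProblem a β P t r) : IncrementProblem a β P s r where
  memLp i := by
    have : incr β i s r = incr β i s t + incr β i t r := by
      ext1 ω; exact incr_add hβ i hst htr ω
    rw [this]
    exact (h₁.memLp i).add (h₂.memLp i)
  fst i A hA := by
    have hA' := (canonicalFiltration d).mono hst _ hA
    simp only [incr_add hβ i hst htr]
    rw [integral_add ((h₁.memLp i).integrable (by norm_num)).integrableOn
      ((h₂.memLp i).integrable (by norm_num)).integrableOn, h₁.fst i A hA, h₂.fst i A hA', add_zero]
  snd i j A hA := by
    have hA' := (canonicalFiltration d).mono hst _ hA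
    have c₁ := setIntegral_mul_eq_zero ((canonicalFiltration d).le t) (h₂.memLp j) (h₁.memLp i)
      (measurable_incr_filtration hβ i hst le_rfl) (h₂.fst j) hA'
    have c₂ := setIntegral_mul_eq_zero ((canonicalFiltration d).le t) (h₂.memLp i) (h₁.memLp j)
      (measurable_incr_filtration hβ j hst le_rfl) (h₂.fst i) hA'
    have heq : ∀ ω, incr β i s r ω * incr β j s r ω - covInt a i j s r ω =
        ((incr β i s t ω * incr β j s t ω - covInt a i j s t ω) +
        (incr β i t r ω * incr β j t r ω - covInt a i j t r ω)) +
        (incr β i s t ω * incr β j t r ω + incr β j s t ω * incr β i t r ω) := by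
      intro ω
      rw [incr_add hβ i hst htr, incr_add hβ j hst htr, covInt_add ha i j hst htr]
      ring
    simp only [heq]
    have i₁ : Integrable (fun ω => incr β i s t ω * incr β j s t ω - covInt a i j s t ω) P :=
      (h₁.integrable_mul i j).sub (integrable_covInt ha i j hst)
    have i₂ : Integrable (fun ω => incr β i t r ω * incr β j t r ω - covInt a i j t r ω) P :=
      (h₂.integrable_mul i j).sub (integrable_covInt ha i j htr)
    have i₃ : Integrable (fun ω => incr β i s t ω * incr β j t r ω) P :=
      (h₁.memLp i).integrable_mul (h₂.memLp j)
    have i₄ : Integrable (fun ω => incr β j s t ω * incr β i t r ω) P :=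
      (h₁.memLp j).integrable_mul (h₂.memLp i)
    rw [setIntegral_add_add_add i₁ i₂ i₃ i₄, c₁, c₂, h₁.snd i j A hA, h₂.snd i j A hA']
    simp

/-- The coordinate process solves the martingale problem with drift `β` and diffusion `a`. -/
def MartingaleProblem (a : E d → Matrix (Fin d) (Fin d) ℝ) (β : ℝ≥0 → PathSpace d → E d)
    (P : Measure (PathSpace d)) : Prop :=
  ∀ s r, s ≤ r → IncrementProblem a β P s r

theorem stronglyAdapted_incr (hβ : Nonanticipating K β) (i : Fin d) :
    StronglyAdapted (canonicalFiltration d) fun t => incr β i 0 t :=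
  fun _ => (measurable_incr_filtration hβ i zero_le le_rfl).stronglyMeasurable

theorem stronglyAdapted_covInt (ha : BoundedMatrixField K a) (i j : Fin d) :
    StronglyAdapted (canonicalFiltration d) fun t => covInt a i j 0 t :=
  fun _ => (measurable_covInt_filtration ha i j le_rfl).stronglyMeasurable

theorem MartingaleProblem.martingale_incr (hβ : Nonanticipating K β)
    (h : MartingaleProblem a β P) (i : Fin d) :
    Martingale (fun t => incr β i 0 t) (canonicalFiltration d) P := by
  refine martingale_of_setIntegral_eq (stronglyAdapted_incr hβ i)
    (fun t => ((h 0 t zero_le).memLp i).integrable (by norm_num)) fun s r hsr A hA => ?_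
  simp only [incr_add hβ i zero_le hsr]
  rw [integral_add (((h 0 s zero_le).memLp i).integrable (by norm_num)).integrableOn
    (((h s r hsr).memLp i).integrable (by norm_num)).integrableOn, (h s r hsr).fst i A hA, add_zero]

/-- Separates what is known at time `s` from the new increment. The last two products integrate to
zero over `𝓕_s`-events, which makes the passage between increments and martingales work in both
directions. -/
theorem mul_sub_covInt_eq (ha : BoundedMatrixField K a) (hβ : Nonanticipating K β) (i j : Fin d)
    {s r : ℝ≥0} (hsr : s ≤ r) (ω : PathSpace d) :
    incr β i 0 r ω * incr β j 0 r ω - covInt a i j 0 r ω =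
      (incr β i 0 s ω * incr β j 0 s ω - covInt a i j 0 s ω) +
      (incr β i s r ω * incr β j s r ω - covInt a i j s r ω) +
      (incr β i 0 s ω * incr β j s r ω + incr β j 0 s ω * incr β i s r ω) := by
  rw [incr_add hβ i zero_le hsr, incr_add hβ j zero_le hsr, covInt_add ha i j zero_le hsr]
  ring

theorem MartingaleProblem.martingale_mul (ha : BoundedMatrixField K a)
    (hβ : Nonanticipating K β) (h : MartingaleProblem a β P) (i j : Fin d) :
    Martingale (fun t ω => incr β i 0 t ω * incr β j 0 t ω - covInt a i j 0 t ω)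
      (canonicalFiltration d) P := by
  have hint : ∀ t, Integrable (fun ω => incr β i 0 t ω * incr β j 0 t ω - covInt a i j 0 t ω) P :=
    fun t => ((h 0 t zero_le).integrable_mul i j).sub (integrable_covInt ha i j zero_le)
  refine martingale_of_setIntegral_eq (((stronglyAdapted_incr hβ i).mul
    (stronglyAdapted_incr hβ j)).sub (stronglyAdapted_covInt ha i j)) hint fun s r hsr A hA => ?_
  have c₁ := setIntegral_mul_eq_zero ((canonicalFiltration d).le s) ((h s r hsr).memLp j)
    ((h 0 s zero_le).memLp i) (measurable_incr_filtration hβ i zero_le le_rfl)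
    ((h s r hsr).fst j) hA
  have c₂ := setIntegral_mul_eq_zero ((canonicalFiltration d).le s) ((h s r hsr).memLp i)
    ((h 0 s zero_le).memLp j) (measurable_incr_filtration hβ j zero_le le_rfl)
    ((h s r hsr).fst i) hA
  have i₂ : Integrable (fun ω => incr β i s r ω * incr β j s r ω - covInt a i j s r ω) P :=
    ((h s r hsr).integrable_mul i j).sub (integrable_covInt ha i j hsr)
  have i₃ : Integrable (fun ω => incr β i 0 s ω * incr β j s r ω) P :=
    ((h 0 s zero_le).memLp i).integrable_mul ((h s r hsr).memLp j)
  have i₄ : Integrable (fun ω => incr β j 0 s ω * incr β i s r ω) P :=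
    ((h 0 s zero_le).memLp j).integrable_mul ((h s r hsr).memLp i)
  simp only [mul_sub_covInt_eq ha hβ i j hsr]
  rw [setIntegral_add_add_add (hint s) i₂ i₃ i₄, c₁, c₂, (h s r hsr).snd i j A hA]
  simp

theorem martingaleProblem_of_martingale (ha : BoundedMatrixField K a)
    (hβ : Nonanticipating K β)
    (h₁ : ∀ i, Martingale (fun t => incr β i 0 t) (canonicalFiltration d) P)
    (h₂ : ∀ i t, MemLp (incr β i 0 t) 2 P)
    (h₃ : ∀ i j, Martingale (fun t ω => incr β i 0 t ω * incr β j 0 t ω - covInt a i j 0 t ω)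
      (canonicalFiltration d) P) : MartingaleProblem a β P := by
  intro s r hsr
  have hL : ∀ i, MemLp (incr β i s r) 2 P := by
    intro i
    have : incr β i s r = incr β i 0 r - incr β i 0 s := by
      ext1 ω
      rw [Pi.sub_apply, incr_add hβ i zero_le hsr]
      ring
    rw [this]
    exact (h₂ i r).sub (h₂ i s)
  have hfst : ∀ i A, MeasurableSet[canonicalFiltration d s] A →
      ∫ ω in A, incr β i s r ω ∂P = 0 := by
    intro i A hA
    have e := (h₁ i).setIntegral_eq hsr hA
    simp only [incr_add hβ i zero_le hsr] at e
    rw [integral_add ((h₂ i s).integrable (by norm_num)).integrableOn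
      ((hL i).integrable (by norm_num)).integrableOn] at e
    linarith
  refine ⟨hL, hfst, fun i j A hA => ?_⟩
  have c₁ := setIntegral_mul_eq_zero ((canonicalFiltration d).le s) (hL j)
    (h₂ i s) (measurable_incr_filtration hβ i zero_le le_rfl) (hfst j) hA
  have c₂ := setIntegral_mul_eq_zero ((canonicalFiltration d).le s) (hL i)
    (h₂ j s) (measurable_incr_filtration hβ j zero_le le_rfl) (hfst i) hA
  have i₁ := (h₃ i j).integrable s
  have i₂ : Integrable (fun ω => incr β i s r ω * incr β j s r ω - covInt a i j s r ω) P :=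
    ((hL i).integrable_mul (hL j)).sub (integrable_covInt ha i j hsr)
  have i₃ : Integrable (fun ω => incr β i 0 s ω * incr β j s r ω) P :=
    (h₂ i s).integrable_mul (hL j)
  have i₄ : Integrable (fun ω => incr β j 0 s ω * incr β i s r ω) P :=
    (h₂ j s).integrable_mul (hL i)
  have e := (h₃ i j).setIntegral_eq hsr hA
  simp only [mul_sub_covInt_eq ha hβ i j hsr] at e
  rw [setIntegral_add_add_add i₁ i₂ i₃ i₄, c₁, c₂] at e
  linarith

end Increments

/-! ### A version of the drift density that depends only on the past. -/

section Differentiation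

open Filter Topology

theorem map_coe_lebesgue :
    lebesgue.map ((↑) : ℝ≥0 → ℝ) = (volume : Measure ℝ).restrict (Ici 0) := by
  have : range ((↑) : ℝ≥0 → ℝ) = Ici 0 := by
    ext x
    exact ⟨by rintro ⟨y, rfl⟩; exact y.2, fun h => ⟨⟨x, h⟩, rfl⟩⟩
  rw [lebesgue, measurableEmbedding_coe_nnreal.map_comap, this]

/-- The interval need not contain `x`; it suffices that its endpoints are within a fixed multiple of
its length, since then the first-order errors at both are `o(h)`. -/
theorem tendsto_difference_quotient {F : ℝ → ℝ} {F' x : ℝ} (hF : HasDerivAt F F' x)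
    {y z h : ℕ → ℝ} (hh : Tendsto h atTop (𝓝 0)) (hpos : ∀ n, 0 < h n)
    (hy : ∀ᶠ n in atTop, |y n - x| ≤ 2 * h n) (hz : ∀ᶠ n in atTop, |z n - x| ≤ 2 * h n)
    (hyz : ∀ᶠ n in atTop, y n - z n = h n) :
    Tendsto (fun n => (h n)⁻¹ * (F (y n) - F (z n))) atTop (𝓝 F') := by
  have hlim : ∀ w : ℕ → ℝ, (∀ᶠ n in atTop, |w n - x| ≤ 2 * h n) →
      Tendsto (fun n => (h n)⁻¹ * (F (w n) - F x - (w n - x) * F')) atTop (𝓝 0) := by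
    intro w hw
    have hwx : Tendsto w atTop (𝓝 x) := by
      rw [tendsto_iff_norm_sub_tendsto_zero]
      refine squeeze_zero' (Eventually.of_forall fun _ => norm_nonneg _) hw ?_
      simpa using hh.const_mul 2
    have ho := (hasDerivAt_iff_isLittleO.1 hF).comp_tendsto hwx
    have hO : (fun n => w n - x) =O[atTop] h := by
      refine Asymptotics.IsBigO.of_bound 2 ?_
      filter_upwards [hw] with n hn
      rw [Real.norm_eq_abs, Real.norm_eq_abs, abs_of_pos (hpos n)]
      exact hn
    have := (ho.trans_isBigO hO).tendsto_div_nhds_zero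
    refine this.congr fun n => ?_
    simp [div_eq_inv_mul]
  have h1 := (hlim y hy).sub (hlim z hz)
  have h2 : Tendsto (fun n => (h n)⁻¹ * (F (y n) - F x - (y n - x) * F') -
      (h n)⁻¹ * (F (z n) - F x - (z n - x) * F') + F') atTop (𝓝 F') := by
    simpa using h1.add_const F'
  refine h2.congr' ?_
  filter_upwards [hyz] with n hn
  have hne := (hpos n).ne'
  have : y n = z n + h n := by linarith
  rw [this]
  field_simp
  ring

/-- Lebesgue differentiation along dyadic intervals to the left of the point. -/
theorem ae_tendsto_dyadic_quotient {f : ℝ≥0 → ℝ} (hf : ∀ t, IntegrableOn f (Iic t) lebesgue) :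
    ∀ᵐ s ∂lebesgue, Tendsto (fun n : ℕ => 2 ^ n *
      (∫ u in Iic ((⌊s * 2 ^ n⌋₊ : ℝ≥0) / 2 ^ n), f u ∂lebesgue -
        ∫ u in Iic (((⌊s * 2 ^ n⌋₊ - 1 : ℕ) : ℝ≥0) / 2 ^ n), f u ∂lebesgue)) atTop (𝓝 (f s)) := by
  -- Extension by zero brings the problem to the real line, where Lebesgue's differentiation theorem
  -- applies.
  let g : ℝ → ℝ := (Ici 0).indicator fun x => f x.toNNReal
  have hg : LocallyIntegrable g volume := by
    intro x
    refine ⟨Iio (x + 1), Iio_mem_nhds (by linarith), ?_⟩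
    have h1 : IntegrableOn (fun y : ℝ => f y.toNNReal) (Iic (x + 1)) (lebesgue.map (↑)) := by
      rw [measurableEmbedding_coe_nnreal.integrableOn_map_iff]
      have : (((↑) : ℝ≥0 → ℝ) ⁻¹' Iic (x + 1)) ⊆ Iic (x + 1).toNNReal := fun u hu =>
        NNReal.le_toNNReal_of_coe_le hu
      refine IntegrableOn.mono_set ?_ this
      simpa [Function.comp_def] using hf (x + 1).toNNReal
    rw [map_coe_lebesgue, IntegrableOn, Measure.restrict_restrict measurableSet_Iic] at h1
    rw [integrableOn_indicator_iff measurableSet_Ici]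
    refine IntegrableOn.mono_set h1 ?_
    exact fun y hy => ⟨(mem_Iio.1 hy.2).le, hy.1⟩
  have hint : ∀ q : ℝ≥0, ∫ u in Iic q, f u ∂lebesgue = ∫ x in (0 : ℝ)..q, g x := by
    intro q
    rw [intervalIntegral.integral_of_le (NNReal.coe_nonneg q), setIntegral_Iic_eq_Ioc]
    have h1 : ∫ x in Ioc (0 : ℝ) q, g x = ∫ x in Ioc (0 : ℝ) q, f x.toNNReal :=
      setIntegral_congr_fun measurableSet_Ioc fun x hx =>
        indicator_of_mem (show x ∈ Ici 0 from hx.1.le) _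
    have h2 : Ioc (0 : ℝ) q = Ioc (0 : ℝ) q ∩ Ici 0 :=
      (inter_eq_self_of_subset_left fun x hx => hx.1.le).symm
    rw [h1, h2, ← Measure.restrict_restrict measurableSet_Ioc, ← map_coe_lebesgue,
      measurableEmbedding_coe_nnreal.setIntegral_map]
    have h3 : (((↑) : ℝ≥0 → ℝ) ⁻¹' Ioc 0 q) = Ioc 0 q := by
      ext u; simp
    rw [h3]
    simp
  have hae : ∀ᵐ s : ℝ≥0 ∂lebesgue,
      HasDerivAt (fun x => ∫ t in (0 : ℝ)..x, g t) (g (s : ℝ)) (s : ℝ) := by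
    have h1 : ∀ᵐ x ∂(lebesgue.map ((↑) : ℝ≥0 → ℝ)),
        HasDerivAt (fun x => ∫ t in (0 : ℝ)..x, g t) (g x) x := by
      rw [map_coe_lebesgue]
      exact ae_restrict_of_ae ((LocallyIntegrable.ae_hasDerivAt_integral hg).mono fun x hx => hx 0)
    exact measurableEmbedding_coe_nnreal.ae_map_iff.1 h1
  have h0 : ∀ᵐ s ∂lebesgue, s ≠ 0 := by
    rw [ae_iff]; simp
  filter_upwards [hae, h0] with s hs hs0
  have hgs : g s = f s := by
    simp [g]
  rw [hgs] at hs
  have hh : Tendsto (fun n : ℕ => ((2 : ℝ) ^ n)⁻¹) atTop (𝓝 0) := by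
    simp_rw [← inv_pow]
    exact tendsto_pow_atTop_nhds_zero_of_lt_one (by norm_num) (by norm_num)
  -- From this level on the truncated subtraction `⌊s * 2 ^ n⌋₊ - 1` is a genuine one; this needs `s
  -- ≠ 0`.
  have hk : ∀ᶠ n : ℕ in atTop, 1 ≤ ⌊s * 2 ^ n⌋₊ := by
    have hs' : (0 : ℝ) < s := NNReal.coe_pos.2 (pos_iff_ne_zero.2 hs0)
    filter_upwards [hh.eventually (gt_mem_nhds hs')] with n hn
    rw [Nat.one_le_floor_iff]
    rw [← NNReal.coe_le_coe]
    push_cast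
    rw [inv_lt_iff_one_lt_mul₀ (by positivity)] at hn
    linarith
  have hfl : ∀ n : ℕ, ((⌊s * 2 ^ n⌋₊ : ℝ≥0) : ℝ) ≤ s * 2 ^ n := fun n => by
    have := Nat.floor_le (zero_le (a := s * 2 ^ n))
    exact_mod_cast this
  have hfl' : ∀ n : ℕ, (s : ℝ) * 2 ^ n < ((⌊s * 2 ^ n⌋₊ : ℝ≥0) : ℝ) + 1 := fun n => by
    have := Nat.lt_floor_add_one (s * 2 ^ n)
    exact_mod_cast this
  have hcast : ∀ᶠ n : ℕ in atTop,
      (((⌊s * 2 ^ n⌋₊ - 1 : ℕ) : ℝ≥0) : ℝ) = ((⌊s * 2 ^ n⌋₊ : ℝ≥0) : ℝ) - 1 := by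
    filter_upwards [hk] with n hn
    rw [NNReal.coe_natCast, NNReal.coe_natCast, Nat.cast_sub hn, Nat.cast_one]
  have := tendsto_difference_quotient hs (h := fun n : ℕ => ((2 : ℝ) ^ n)⁻¹) hh
    (fun n => by positivity)
    (y := fun n => (((⌊s * 2 ^ n⌋₊ : ℝ≥0) / 2 ^ n : ℝ≥0) : ℝ))
    (z := fun n => ((((⌊s * 2 ^ n⌋₊ - 1 : ℕ) : ℝ≥0) / 2 ^ n : ℝ≥0) : ℝ)) ?_ ?_ ?_
  · refine this.congr fun n => ?_
    rw [inv_inv, hint, hint]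
  · refine Eventually.of_forall fun n => ?_
    rw [NNReal.coe_div, NNReal.coe_pow, NNReal.coe_ofNat, abs_le]
    have h2 : (0 : ℝ) < 2 ^ n := by positivity
    constructor
    · rw [neg_le_iff_add_nonneg, ← sub_nonneg]
      field_simp
      linarith [hfl' n]
    · rw [← sub_nonneg]
      field_simp
      linarith [hfl n]
  · filter_upwards [hcast] with n hn
    rw [NNReal.coe_div, NNReal.coe_pow, NNReal.coe_ofNat, hn, abs_le]
    have h2 : (0 : ℝ) < 2 ^ n := by positivity
    constructor
    · rw [neg_le_iff_add_nonneg, ← sub_nonneg]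
      field_simp
      linarith [hfl' n]
    · rw [← sub_nonneg]
      field_simp
      linarith [hfl n]
  · filter_upwards [hcast] with n hn
    rw [NNReal.coe_div, NNReal.coe_div, NNReal.coe_pow, NNReal.coe_ofNat, hn]
    field_simp
    ring

variable {d : ℕ}

/-- The dyadic left difference quotient of an adapted process. -/
def dyadicQuotient (A : ℝ≥0 → PathSpace d → ℝ) (n : ℕ) (s : ℝ≥0) (ω : PathSpace d) : ℝ :=
  2 ^ n * (A ((⌊s * 2 ^ n⌋₊ : ℝ≥0) / 2 ^ n) ω - A (((⌊s * 2 ^ n⌋₊ - 1 : ℕ) : ℝ≥0) / 2 ^ n) ω)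

theorem measurable_dyadicQuotient {A : ℝ≥0 → PathSpace d → ℝ} (hA : ∀ t, Measurable (A t))
    (n : ℕ) : Measurable (Function.uncurry (dyadicQuotient A n)) := by
  let g : ℕ → PathSpace d → ℝ := fun k ω =>
    (2 : ℝ) ^ n * (A ((k : ℝ≥0) / 2 ^ n) ω - A (((k - 1 : ℕ) : ℝ≥0) / 2 ^ n) ω)
  have hg : ∀ k, Measurable (g k) := fun k => ((hA _).sub (hA _)).const_mul _
  have h : Measurable fun p : ℕ × PathSpace d => g p.1 p.2 :=
    measurable_from_prod_countable_right hg
  have h2 : Measurable fun p : ℝ≥0 × PathSpace d => (⌊p.1 * 2 ^ n⌋₊, p.2) :=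
    (Nat.measurable_floor.comp (measurable_fst.mul_const _)).prodMk measurable_snd
  have e : Function.uncurry (dyadicQuotient A n) =
      (fun p : ℕ × PathSpace d => g p.1 p.2) ∘
        fun p : ℝ≥0 × PathSpace d => (⌊p.1 * 2 ^ n⌋₊, p.2) := by
    funext p
    rfl
  rw [e]
  exact h.comp h2

/-- Both sampling times are at most `s`; this is why the quotient is taken over a dyadic interval
ending at or before `s`. -/
theorem dyadicQuotient_stop {A : ℝ≥0 → PathSpace d → ℝ}
    (hA : ∀ t, Measurable[canonicalFiltration d t] (A t)) (n : ℕ) (s : ℝ≥0) (ω : PathSpace d) :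
    dyadicQuotient A n s (stopAt s ω) = dyadicQuotient A n s ω := by
  have hle : ∀ k : ℕ, k ≤ ⌊s * 2 ^ n⌋₊ → (k : ℝ≥0) / 2 ^ n ≤ s := by
    intro k hk
    rw [div_le_iff₀ (by positivity)]
    exact (Nat.cast_le.2 hk).trans (Nat.floor_le zero_le)
  have hst : ∀ q ≤ s, A q (stopAt s ω) = A q ω := by
    intro q hq
    have h := (measurable_canonicalFiltration_iff.1 (hA q)).2
    rw [← h (stopAt s ω), stop_stop, min_eq_left hq, h]
  unfold dyadicQuotient
  rw [hst _ (hle _ le_rfl), hst _ (hle _ (Nat.sub_le _ _))]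

/-- A nonanticipating version of the Lebesgue density of an adapted process. -/
def nonanticipatingDensity (K : ℝ≥0) (B : ℝ≥0 → PathSpace d → E d) (s : ℝ≥0) (ω : PathSpace d) :
    E d :=
  WithLp.toLp 2 fun i =>
    max (-K) (min K (limsup (fun n => dyadicQuotient (fun t ω => B t ω i) n s ω) atTop))

/-- The truncated limsup has a value even where the quotients diverge, so dependence on the past and
the bound hold for every time and path, with no exceptional set. -/
theorem nonanticipating_density (K : ℝ≥0) {B : ℝ≥0 → PathSpace d → E d}
    (hB : StronglyAdapted (canonicalFiltration d) B) :
    Nonanticipating K (nonanticipatingDensity K B) where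
  measurable := by
    have hB' : ∀ i t, Measurable fun ω => B t ω i := fun i t =>
      (measurable_coord i).comp ((hB t).mono ((canonicalFiltration d).le t)).measurable
    refine (PiLp.continuous_toLp 2 _).measurable.comp (measurable_pi_iff.2 fun i => ?_)
    exact measurable_const.max (measurable_const.min
      (Measurable.limsup fun n => measurable_dyadicQuotient (hB' i) n))
  stop_eq s ω := by
    have hB' : ∀ i t, Measurable[canonicalFiltration d t] fun ω => B t ω i := fun i t =>
      (measurable_coord i).comp (hB t).measurable
    simp only [nonanticipatingDensity, dyadicQuotient_stop (hB' _)]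
  bound s ω i := by
    simp only [nonanticipatingDensity, abs_le]
    exact ⟨le_max_left _ _, max_le (by linarith [K.2]) (min_le_left _ _)⟩

theorem nonanticipatingDensity_eq {K : ℝ≥0} {B : ℝ≥0 → PathSpace d → E d} {s : ℝ≥0}
    {ω : PathSpace d} {v : E d} (hv : ∀ i, |v i| ≤ K)
    (h : ∀ i, Tendsto (fun n => dyadicQuotient (fun t ω => B t ω i) n s ω) atTop (𝓝 (v i))) :
    nonanticipatingDensity K B s ω = v := by
  ext i
  simp only [nonanticipatingDensity]
  rw [(h i).limsup_eq, min_eq_right (abs_le.1 (hv i)).2, max_eq_right (abs_le.1 (hv i)).1]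

end Differentiation

/-! ### Membership in `R` as a martingale problem with a control. -/

section Characterization

open Filter Topology

theorem LipschitzWith.locallyBoundedVariationOn_nnreal {G : Type*} [PseudoEMetricSpace G]
    {f : ℝ≥0 → G} {K : ℝ≥0} (hf : LipschitzWith K f) : LocallyBoundedVariationOn f univ := by
  have h1 : LipschitzWith (K * 1) (f ∘ Real.toNNReal) := hf.comp Real.lipschitzWith_toNNReal
  have h2 : MonotoneOn ((↑) : ℝ≥0 → ℝ) univ := fun x _ y _ h => NNReal.coe_le_coe.2 h
  have h3 := h1.comp_locallyBoundedVariationOn h2.locallyBoundedVariationOn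
  have h4 : (f ∘ Real.toNNReal) ∘ ((↑) : ℝ≥0 → ℝ) = f := by
    ext1 t; simp
  rwa [h4] at h3

variable {d : ℕ} {F : Type*} {b : F × E d → E d} {a : E d → Matrix (Fin d) (Fin d) ℝ} {K : ℝ≥0}

/-- The graph of the correspondence `x ↦ b(F, x)`. -/
def driftSet (b : F × E d → E d) : Set (E d × E d) := {p | ∃ f, p.2 = b (f, p.1)}

/-- Projection along the compact space `F` is a closed map. Closedness makes the drift constraint a
Borel condition. -/
theorem isClosed_driftSet [TopologicalSpace F] [CompactSpace F] (hb : Continuous b) :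
    IsClosed (driftSet b) := by
  have h : IsClosed {q : F × (E d × E d) | q.2.2 = b (q.1, q.2.1)} :=
    isClosed_eq (by fun_prop) (by fun_prop)
  have h2 : driftSet b = Prod.snd '' {q : F × (E d × E d) | q.2.2 = b (q.1, q.2.1)} := by
    ext p
    constructor
    · rintro ⟨f, hf⟩
      exact ⟨(f, p), hf, rfl⟩
    · rintro ⟨⟨f, p⟩, hf, rfl⟩
      exact ⟨f, hf⟩
  rw [h2]
  exact isClosedMap_snd_of_compactSpace _ h

/-- Under `P` the coordinate process solves the martingale problem with diffusion coefficient `a`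
and the nonanticipating drift `β`, which takes its values in the drift set `b(F, X)`. -/
structure IsControlledLaw (b : F × E d → E d) (a : E d → Matrix (Fin d) (Fin d) ℝ) (K : ℝ≥0)
    (β : ℝ≥0 → PathSpace d → E d) (P : Measure (PathSpace d)) : Prop where
  nonanticipating : Nonanticipating K β
  martingaleProblem : MartingaleProblem a β P
  drift : ∀ᵐ ω ∂P, ∀ᵐ s ∂lebesgue, (X s ω, β s ω) ∈ driftSet b

/-- All values in `Theta` share the diffusion component `a x`, so `C` must be `∫ a(X)`, which grows
at most linearly. Hence localization can be removed, and `B` can be rewritten as the integral of its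
nonanticipating density. -/
theorem exists_isControlledLaw_of_hasDifferentialCharacteristics (ha : BoundedMatrixField K a)
    (hb : ∀ f x i, |b (f, x) i| ≤ K) {P : Measure (PathSpace d)} [IsProbabilityMeasure P]
    {β₀ : ℝ≥0 → PathSpace d → E d} {γ₀ : ℝ≥0 → PathSpace d → Matrix (Fin d) (Fin d) ℝ}
    (h : HasDifferentialCharacteristics P β₀ γ₀)
    (hΘ : ∀ᵐ p ∂(lebesgue.prod P), (β₀ p.1 p.2, γ₀ p.1 p.2) ∈ Theta b a (X p.1 p.2)) :
    ∃ β, IsControlledLaw b a K β P := by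
  obtain ⟨B, C, hch, hB, hC⟩ := h
  set β := nonanticipatingDensity K B with hβdef
  have hβ : Nonanticipating K β := nonanticipating_density K hch.adapted_fst
  have hΘ' : ∀ᵐ ω ∂P, ∀ᵐ s ∂lebesgue, (β₀ s ω, γ₀ s ω) ∈ Theta b a (X s ω) :=
    Measure.ae_ae_of_ae_prod (Measure.measurePreserving_swap.quasiMeasurePreserving.ae hΘ)
  -- Lebesgue differentiation of `B` recovers `β₀`; truncation at `K` changes nothing because the
  -- values have the form `b (f, X)`.
  have hβ₀ : ∀ᵐ ω ∂P, ∀ᵐ s ∂lebesgue, β s ω = β₀ s ω := by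
    filter_upwards [hΘ', ae_all_iff.2 fun i => (hB i).integrable,
      ae_all_iff.2 fun i => (hB i).eq_integral] with ω h1 h2 h3
    filter_upwards [h1, ae_all_iff.2 fun i => ae_tendsto_dyadic_quotient (h2 i)] with s h4 h5
    obtain ⟨f, hf⟩ := h4
    refine nonanticipatingDensity_eq (fun i => ?_) fun i => ?_
    · have hf' : β₀ s ω = b (f, X s ω) := (Prod.ext_iff.1 hf).1
      rw [hf']
      exact hb _ _ _
    · simpa only [dyadicQuotient, h3 i] using h5 i
  have hmart : ∀ᵐ ω ∂P, ∀ i t, martPart B t ω i = incr β i 0 t ω := by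
    filter_upwards [hβ₀, ae_all_iff.2 fun i => (hB i).eq_integral] with ω h1 h2 i t
    simp only [martPart, incr, PiLp.sub_apply, h2 i, setIntegral_Iic_eq_Ioc]
    congr 1
    refine integral_congr_ae (ae_restrict_of_ae ?_)
    filter_upwards [h1] with s hs
    rw [hs]
  have hcov : ∀ᵐ ω ∂P, ∀ i j t, C t ω i j = covInt a i j 0 t ω := by
    filter_upwards [hΘ', ae_all_iff.2 fun i => ae_all_iff.2 fun j => (hC i j).eq_integral]
      with ω h1 h2 i j t
    simp only [covInt, h2 i j, setIntegral_Iic_eq_Ioc]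
    refine integral_congr_ae (ae_restrict_of_ae ?_)
    filter_upwards [h1] with s hs
    obtain ⟨f, hf⟩ := hs
    have hf' : γ₀ s ω = a (X s ω) := (Prod.ext_iff.1 hf).2
    exact congrFun (congrFun hf' i) j
  have hCK : ∀ i j t ω, |covInt a i j 0 t ω| ≤ K * (t : ℝ) := fun i j t ω => by
    simpa using abs_covInt_le ha i j (zero_le (a := t)) ω
  have hprod : ∀ i j, ∃ ρ : ℕ → PathSpace d → WithTop ℝ≥0,
      IsLocalizingSequence (canonicalFiltration d) ρ P ∧ ∀ n, Martingale (stoppedProcess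
        (fun t ω => incr β i 0 t ω * incr β j 0 t ω - covInt a i j 0 t ω) (ρ n))
        (canonicalFiltration d) P := by
    intro i j
    refine exists_localizing_of_indistinguishable (hch.covariation i j)
      (((stronglyAdapted_incr hβ i).mul (stronglyAdapted_incr hβ j)).sub
        (stronglyAdapted_covInt ha i j))
      (fun ω => ((continuous_incr hβ i ω).mul (continuous_incr hβ j ω)).sub
        (continuous_covInt ha i j ω)) (fun ω => by simp) ?_
    filter_upwards [hmart, hcov] with ω h1 h2 t
    rw [h1, h1, h2]
  have hM : ∀ i, Martingale (fun t => incr β i 0 t) (canonicalFiltration d) P ∧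
      ∀ t, MemLp (incr β i 0 t) 2 P := by
    intro i
    obtain ⟨τ, hτ, hτm⟩ := exists_localizing_of_indistinguishable (hch.localMartingale i)
      (stronglyAdapted_incr hβ i) (continuous_incr hβ i) (fun ω => by simp) (by
        filter_upwards [hmart] with ω h1 t using h1 i t)
    obtain ⟨ρ, hρ, hρm⟩ := hprod i i
    exact martingale_of_bounded_bracket (stronglyAdapted_incr hβ i) (continuous_incr hβ i)
      (fun ω => by simp) (stronglyAdapted_covInt ha i i) (continuous_covInt ha i i)
      (fun ω => by simp) K.2 (hCK i i) hρ hρm hτ hτm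
  refine ⟨β, hβ, martingaleProblem_of_martingale ha hβ (fun i => (hM i).1) (fun i => (hM i).2)
    fun i j => ?_, ?_⟩
  · obtain ⟨ρ, hρ, hρm⟩ := hprod i j
    exact martingale_mul_sub_of_bounded_bracket (hM i).1 (hM j).1 (hM i).2 (hM j).2
      (continuous_incr hβ i) (continuous_incr hβ j) (stronglyAdapted_covInt ha i j) K.2
      (hCK i j) hρ hρm
  · filter_upwards [hβ₀, hΘ'] with ω h1 h2
    filter_upwards [h1, h2] with s h3 h4
    obtain ⟨f, hf⟩ := h4
    exact ⟨f, h3.trans (Prod.ext_iff.1 hf).1⟩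

theorem Nonanticipating.lipschitzWith_integral {β : ℝ≥0 → PathSpace d → E d}
    (hβ : Nonanticipating K β) (ω : PathSpace d) :
    ∃ L, LipschitzWith L fun t =>
      (WithLp.toLp 2 fun i => ∫ u in Ioc 0 t, β u ω i ∂lebesgue : E d) :=
  ⟨_, (PiLp.lipschitzWith_toLp 2 _).comp (LipschitzWith.of_dist_le_mul fun s t => by
    refine (dist_pi_le_iff (by positivity)).2 fun i => ?_
    exact (lipschitzWith_setIntegral_Ioc (hβ.measurable_path i ω)
      fun u => hβ.bound u ω i).dist_le_mul s t)⟩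

/-- Integrals of bounded densities are Lipschitz along every path, which gives the path properties,
and true martingales are local martingales. -/
theorem IsControlledLaw.hasDifferentialCharacteristics (ha : BoundedMatrixField K a)
    {β : ℝ≥0 → PathSpace d → E d} {P : Measure (PathSpace d)} [IsProbabilityMeasure P]
    (h : IsControlledLaw b a K β P) :
    HasDifferentialCharacteristics P β fun t ω => a (X t ω) := by
  have hβ := h.nonanticipating
  have hmart : ∀ i t ω, martPart (fun t ω =>
      (WithLp.toLp 2 fun i => ∫ u in Ioc 0 t, β u ω i ∂lebesgue : E d)) t ω i =
      incr β i 0 t ω := by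
    intro i t ω
    simp [martPart, incr]
  refine ⟨fun t ω => WithLp.toLp 2 fun i => ∫ u in Ioc 0 t, β u ω i ∂lebesgue,
    fun t ω => Matrix.of fun i j => covInt a i j 0 t ω, ?_, fun i => ?_, fun i j => ?_⟩
  · constructor
    · intro t
      refine Measurable.stronglyMeasurable (measurable_canonicalFiltration_iff.2 ⟨?_, fun ω => ?_⟩)
      · refine (PiLp.continuous_toLp 2 _).measurable.comp (measurable_pi_iff.2 fun i => ?_)
        have := ((measurable_X_coord t i).sub (measurable_X_coord 0 i)).sub
          (measurable_incr hβ.measurable i 0 t)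
        have e : (fun ω => ∫ u in Ioc 0 t, β u ω i ∂lebesgue) =
            ((fun ω => X t ω i) - fun ω => X 0 ω i) - incr β i 0 t := by
          ext ω
          simp [incr]
        rw [e]
        exact this
      · refine congrArg (WithLp.toLp 2) (funext fun i => ?_)
        refine setIntegral_congr_fun measurableSet_Ioc fun u hu => ?_
        simp only [hβ.stop_eq_of_le hu.2]
    · refine ae_of_all _ fun ω => ?_
      ext i
      simp
    · refine ae_of_all _ fun ω => ?_
      obtain ⟨L, hL⟩ := hβ.lipschitzWith_integral ω
      exact hL.continuous
    · refine ae_of_all _ fun ω => ?_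
      obtain ⟨L, hL⟩ := hβ.lipschitzWith_integral ω
      exact LipschitzWith.locallyBoundedVariationOn_nnreal hL
    · exact fun i j => stronglyAdapted_covInt ha i j
    · refine ae_of_all _ fun ω => ?_
      ext i j
      simp
    · exact ae_of_all _ fun ω i j => continuous_covInt ha i j ω
    · exact ae_of_all _ fun ω i j => LipschitzWith.locallyBoundedVariationOn_nnreal
        (lipschitzWith_setIntegral_Ioc (ha.measurable_path i j ω) fun _ => ha.bound _ _ _)
    · intro i
      simp only [hmart]
      exact Locally.of_prop (h.martingaleProblem.martingale_incr hβ i)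
    · intro i j
      simp only [hmart]
      exact Locally.of_prop (h.martingaleProblem.martingale_mul ha hβ i j)
  · refine ⟨(measurable_coord i).comp hβ.measurable, ae_of_all _ fun ω t => ?_,
      ae_of_all _ fun ω t => ?_⟩
    · have : Iic t = Icc 0 t := by ext x; simp
      rw [this, integrableOn_Icc_iff_integrableOn_Ioc]
      exact integrableOn_Ioc_of_bound (hβ.measurable_path i ω) (fun u => hβ.bound u ω i) 0 t
    · rw [setIntegral_Iic_eq_Ioc]
  · refine ⟨ha.measurable_uncurry i j, ae_of_all _ fun ω t => ?_, ae_of_all _ fun ω t => ?_⟩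
    · have : Iic t = Icc 0 t := by ext x; simp
      rw [this, integrableOn_Icc_iff_integrableOn_Ioc]
      exact integrableOn_Ioc_of_bound (ha.measurable_path i j ω) (fun _ => ha.bound _ _ _) 0 t
    · rw [setIntegral_Iic_eq_Ioc]
      rfl

/-- The interface to the rest of the argument: existential processes and localizing sequences are
replaced by one control and integral identities, which can be conditioned, pasted and tested for
measurability. -/
theorem mem_R_iff (ha : BoundedMatrixField K a) (hb : ∀ f x i, |b (f, x) i| ≤ K)
    (hV : MeasurableSet (driftSet b)) {x : E d}
    {P : ProbabilityMeasure (PathSpace d)} :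
    P ∈ R b a x ↔ (∀ᵐ ω ∂(P : Measure (PathSpace d)), X 0 ω = x) ∧
      ∃ β, IsControlledLaw b a K β (P : Measure (PathSpace d)) := by
  have hX : (P : Measure (PathSpace d)).map (X 0) = Measure.dirac x ↔
      ∀ᵐ ω ∂(P : Measure (PathSpace d)), X 0 ω = x := by
    have hm := (continuous_X (d := d) 0).measurable
    constructor
    · intro h
      have : ∀ᵐ y ∂(P : Measure (PathSpace d)).map (X 0), y = x := by
        rw [h, ae_dirac_eq]
        simp
      exact ae_of_ae_map hm.aemeasurable this
    · intro h
      rw [Measure.map_congr (g := fun _ => x) h, Measure.map_const]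
      simp
  constructor
  · rintro ⟨_, h0, β₀, γ₀, h, hΘ⟩
    exact ⟨hX.1 h0, exists_isControlledLaw_of_hasDifferentialCharacteristics ha hb h hΘ⟩
  · rintro ⟨h0, β, h⟩
    have hd := h.hasDifferentialCharacteristics ha
    refine ⟨⟨?_, _, _, hd⟩, hX.2 h0, _, _, hd, ?_⟩
    · obtain ⟨B, C, hBC, -⟩ := hd
      exact ⟨B, C, hBC⟩
    · have hset : MeasurableSet {p : ℝ≥0 × PathSpace d | (X p.1 p.2, β p.1 p.2) ∈ driftSet b} :=
        hV.preimage (continuous_X_uncurry.measurable.prodMk h.nonanticipating.measurable)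
      have h1 : ∀ᵐ s ∂lebesgue, ∀ᵐ ω ∂(P : Measure (PathSpace d)),
          (X s ω, β s ω) ∈ driftSet b := (Measure.ae_ae_comm hset).2 h.drift
      filter_upwards [(Measure.ae_prod_iff_ae_ae hset).2 h1] with p hp
      obtain ⟨f, hf⟩ := hp
      have hf' : β p.1 p.2 = b (f, X p.1 p.2) := hf
      exact ⟨f, by rw [hf']⟩

/-- An empty `Theta` would force an almost everywhere false property under the nonzero measure `λ ⊗
P`. -/
theorem R_eq_empty [IsEmpty F] (x : E d) : R b a x = ∅ := by
  rw [eq_empty_iff_forall_notMem]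
  rintro P ⟨_, _, β, γ, _, hΘ⟩
  have h : ∀ᵐ p ∂(lebesgue.prod (P : Measure (PathSpace d))), False := by
    filter_upwards [hΘ] with p hp
    obtain ⟨f, _⟩ := hp
    exact isEmptyElim f
  have h1 := Measure.ae_ae_of_ae_prod h
  have h2 : ∀ᵐ s ∂lebesgue, False := by
    filter_upwards [h1] with s hs
    exact IsProbabilityMeasure.ne_zero (P : Measure (PathSpace d)) (by simpa using hs)
  rw [eventually_false_iff_eq_bot, ae_eq_bot] at h2
  have h3 : lebesgue (Ioc 0 1) = 1 := by
    rw [lebesgue_Ioc]; simp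
  simp [h2] at h3

/-- Unit vectors bound the diagonal of `a x`. Nonnegativity of the quadratic form at `e_i ± e_j`
gives `2 |a_ij| ≤ a_ii + a_jj`. Some `f` is needed because the bounds are quantified over `F`. -/
theorem BoundedElliptic.exists_bound [TopologicalSpace F] [Nonempty F]
    (ha : ∀ x, (a x).PosSemidef) (h : BoundedElliptic b a) :
    ∃ K : ℝ≥0, BoundedMatrixField K a ∧ ∀ f x i, |b (f, x) i| ≤ K := by
  obtain ⟨K, hK, hbd⟩ := h.bounds
  refine ⟨⟨K, hK.le⟩, ⟨h.continuous_a, fun x i j => ?_⟩, fun f x i => ?_⟩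
  · have hdiag : ∀ i, a x i i ≤ K := by
      intro i
      have := (hbd (Classical.arbitrary F) x (EuclideanSpace.single i 1)).2.2
      simpa using this
    have hs : a x j i = a x i j := by
      have := (ha x).1.apply i j
      simpa using this
    have hp := (ha x).dotProduct_mulVec_nonneg (Pi.single i 1 + Pi.single j 1)
    have hm := (ha x).dotProduct_mulVec_nonneg (Pi.single i 1 - Pi.single j 1)
    simp [Matrix.mulVec_add, Matrix.mulVec_sub, hs] at hp hm
    change |a x i j| ≤ K
    rw [abs_le]
    constructor <;> linarith [hdiag i, hdiag j]
  · exact (PiLp.norm_apply_le (b (f, x)) i).trans (hbd f x 0).1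

end Characterization

/-! ### Reduction to countably many events and times. -/

section CountableReduction

open Filter Topology

theorem exists_sequence_piSystem (α : Type*) [MeasurableSpace α]
    [MeasurableSpace.CountablyGenerated α] :
    ∃ A : ℕ → Set α, IsPiSystem (range A) ∧
      MeasurableSpace.generateFrom (range A) = ‹MeasurableSpace α› ∧ univ ∈ range A := by
  obtain ⟨b, hbc, hb⟩ := MeasurableSpace.CountablyGenerated.isCountablyGenerated (α := α)
  have halg := isSetAlgebra_generateSetAlgebra (𝒜 := b)
  obtain ⟨A, hA⟩ := (countable_generateSetAlgebra hbc).exists_eq_range ⟨univ, halg.univ_mem⟩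
  refine ⟨A, ?_, ?_, ?_⟩
  · rw [← hA]
    exact fun s hs t ht _ => halg.inter_mem hs ht
  · rw [← hA, generateFrom_generateSetAlgebra_eq, hb]
  · rw [← hA]
    exact halg.univ_mem

variable {d : ℕ}

/-- A sequence enumerating a countable π-system that generates the Borel σ-field of the path
space. -/
def pathSets (d : ℕ) : ℕ → Set (PathSpace d) := (exists_sequence_piSystem (PathSpace d)).choose

theorem isPiSystem_range_pathSets : IsPiSystem (range (pathSets d)) :=
  (exists_sequence_piSystem (PathSpace d)).choose_spec.1

theorem generateFrom_range_pathSets :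
    MeasurableSpace.generateFrom (range (pathSets d)) = instMeasurableSpacePathSpace d :=
  (exists_sequence_piSystem (PathSpace d)).choose_spec.2.1

theorem univ_mem_range_pathSets : univ ∈ range (pathSets d) :=
  (exists_sequence_piSystem (PathSpace d)).choose_spec.2.2

theorem measurableSet_pathSets (k : ℕ) : MeasurableSet (pathSets d k) := by
  have h : MeasurableSet[MeasurableSpace.generateFrom (range (pathSets d))] (pathSets d k) :=
    MeasurableSpace.measurableSet_generateFrom (mem_range_self k)
  rwa [generateFrom_range_pathSets] at h

theorem measurable_stop (s : ℝ≥0) : Measurable (stopAt (d := d) s) :=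
  (continuous_stop_right s).measurable

theorem measurableSet_stop_preimage {s : ℝ≥0} {A : Set (PathSpace d)} (hA : MeasurableSet A) :
    MeasurableSet[canonicalFiltration d s] (stopAt s ⁻¹' A) :=
  measurableSet_canonicalFiltration_iff.2 ⟨measurable_stop s hA, by
    ext ω
    simp [stop_stop]⟩

/-- A Dynkin class argument for preimages under stopping; having `univ` in the π-system supplies the
total integral needed for complements. -/
theorem setIntegral_eq_zero_of_pathSets {P : Measure (PathSpace d)} {s : ℝ≥0}
    {f : PathSpace d → ℝ} (hf : Integrable f P)
    (h : ∀ k, ∫ ω in stopAt s ⁻¹' pathSets d k, f ω ∂P = 0) {A : Set (PathSpace d)}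
    (hA : MeasurableSet[canonicalFiltration d s] A) : ∫ ω in A, f ω ∂P = 0 := by
  have huniv : ∫ ω, f ω ∂P = 0 := by
    obtain ⟨k, hk⟩ := univ_mem_range_pathSets (d := d)
    simpa [hk] using h k
  have key : ∀ B : Set (PathSpace d), MeasurableSet B → ∫ ω in stopAt s ⁻¹' B, f ω ∂P = 0 := by
    intro B hB
    induction B, hB using MeasurableSpace.induction_on_inter generateFrom_range_pathSets.symm
      isPiSystem_range_pathSets with
    | empty => simp
    | basic B hB =>
      obtain ⟨k, rfl⟩ := hB
      exact h k
    | compl B hB ih =>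
      rw [preimage_compl, setIntegral_compl (measurable_stop s hB) hf, ih, huniv, sub_zero]
    | iUnion B hd hB ih =>
      rw [preimage_iUnion, integral_iUnion (fun i => measurable_stop s (hB i))
        (fun i j hij => (hd hij).preimage _) hf.integrableOn]
      simp [ih]
  obtain ⟨hA1, hA2⟩ := measurableSet_canonicalFiltration_iff.1 hA
  rw [← hA2]
  exact key A hA1

theorem tendsto_setIntegral_mul {P : Measure (PathSpace d)} {f g : ℕ → PathSpace d → ℝ} {f' g' : PathSpace d → ℝ}
    (hf : ∀ n, MemLp (f n) 2 P) (hg : ∀ n, MemLp (g n) 2 P) (hf' : MemLp f' 2 P)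
    (hg' : MemLp g' 2 P) (hff : Tendsto (fun n => eLpNorm (f n - f') 2 P) atTop (𝓝 0))
    (hgg : Tendsto (fun n => eLpNorm (g n - g') 2 P) atTop (𝓝 0)) (A : Set (PathSpace d)) :
    Tendsto (fun n => ∫ ω in A, f n ω * g n ω ∂P) atTop (𝓝 (∫ ω in A, f' ω * g' ω ∂P)) := by
  have hr : ∀ h : ℕ → PathSpace d → ℝ, Tendsto (fun n => eLpNorm (h n) 2 P) atTop (𝓝 0) →
      Tendsto (fun n => eLpNorm (h n) 2 (P.restrict A)) atTop (𝓝 0) := fun h hh =>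
    tendsto_of_tendsto_of_tendsto_of_le_of_le tendsto_const_nhds hh (fun _ => zero_le)
      fun n => eLpNorm_mono_measure _ Measure.restrict_le_self
  have h1 := (Lp.tendsto_Lp_iff_tendsto_eLpNorm'' f (fun n => (hf n).restrict A) f'
    (hf'.restrict A)).2 (hr _ hff)
  have h2 := (Lp.tendsto_Lp_iff_tendsto_eLpNorm'' g (fun n => (hg n).restrict A) g'
    (hg'.restrict A)).2 (hr _ hgg)
  have h3 := Tendsto.inner (𝕜 := ℝ) h1 h2
  have h4 : ∀ {u v : PathSpace d → ℝ} (hu : MemLp u 2 (P.restrict A))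
      (hv : MemLp v 2 (P.restrict A)),
      inner ℝ (hu.toLp u) (hv.toLp v) = ∫ ω in A, u ω * v ω ∂P := by
    intro u v hu hv
    rw [L2.inner_def]
    refine integral_congr_ae ?_
    filter_upwards [hu.coeFn_toLp, hv.coeFn_toLp] with ω e1 e2
    rw [e1, e2]
    simp [mul_comm]
  simpa only [h4] using h3

variable {a : E d → Matrix (Fin d) (Fin d) ℝ} {β : ℝ≥0 → PathSpace d → E d} {K : ℝ≥0}
  {P : Measure (PathSpace d)} [IsProbabilityMeasure P]

/-- With countably many test events, exceptional null sets can be united and the conditions are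
Borel in parameters. -/
theorem incrementProblem_iff (ha : BoundedMatrixField K a) {s r : ℝ≥0} (hsr : s ≤ r) :
    IncrementProblem a β P s r ↔ (∀ i, MemLp (incr β i s r) 2 P) ∧
      (∀ i k, ∫ ω in stopAt s ⁻¹' pathSets d k, incr β i s r ω ∂P = 0) ∧
      ∀ i j k, ∫ ω in stopAt s ⁻¹' pathSets d k,
        (incr β i s r ω * incr β j s r ω - covInt a i j s r ω) ∂P = 0 := by
  constructor
  · intro h
    exact ⟨h.memLp, fun i k => h.fst i _ (measurableSet_stop_preimage (measurableSet_pathSets k)),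
      fun i j k => h.snd i j _ (measurableSet_stop_preimage (measurableSet_pathSets k))⟩
  · rintro ⟨h0, h1, h2⟩
    exact ⟨h0, fun i A hA => setIntegral_eq_zero_of_pathSets ((h0 i).integrable (by norm_num))
      (h1 i) hA, fun i j A hA => setIntegral_eq_zero_of_pathSets
        (((h0 i).integrable_mul (h0 j)).sub (integrable_covInt ha i j hsr)) (h2 i j) hA⟩

theorem IncrementProblem.lintegral_sq_le (ha : BoundedMatrixField K a) {s r : ℝ≥0} (hsr : s ≤ r)
    (h : IncrementProblem a β P s r) (i : Fin d) :
    ∫⁻ ω, ENNReal.ofReal (incr β i s r ω * incr β i s r ω) ∂P ≤ ENNReal.ofReal (K * (r - s)) := by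
  have hi := h.integrable_mul i i
  rw [← ofReal_integral_eq_lintegral_ofReal hi (ae_of_all _ fun ω => mul_self_nonneg _)]
  refine ENNReal.ofReal_le_ofReal ?_
  have h1 := h.snd i i univ MeasurableSet.univ
  rw [setIntegral_univ, integral_sub hi (integrable_covInt ha i i hsr), sub_eq_zero] at h1
  rw [h1]
  have h2 : ∫ ω, covInt a i i s r ω ∂P ≤ ∫ _, (K * (r - s) : ℝ) ∂P :=
    integral_mono (integrable_covInt ha i i hsr) (integrable_const _)
      fun ω => (abs_le.1 (abs_covInt_le ha i i hsr ω)).2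
  simpa using h2

theorem incr_eq_sub (hβ : Nonanticipating K β) (i : Fin d) {s r : ℝ≥0} (hsr : s ≤ r)
    (ω : PathSpace d) : incr β i s r ω = incr β i 0 r ω - incr β i 0 s ω := by
  rw [incr_add hβ i zero_le hsr]
  ring

theorem covInt_eq_sub (ha : BoundedMatrixField K a) (i j : Fin d) {s r : ℝ≥0} (hsr : s ≤ r)
    (ω : PathSpace d) : covInt a i j s r ω = covInt a i j 0 r ω - covInt a i j 0 s ω := by
  rw [covInt_add ha i j zero_le hsr]
  ring

theorem exists_seq_tendsto_of_dense {D : Set ℝ≥0} (hD : Dense D) (s : ℝ≥0) :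
    ∃ u : ℕ → ℝ≥0, (∀ n, s < u n) ∧ (∀ n, u n ∈ D) ∧ Tendsto u atTop (𝓝 s) := by
  obtain ⟨u, -, h1, h2⟩ := hD.exists_seq_strictAnti_tendsto s
  exact ⟨u, fun n => (h1 n).1, fun n => (h1 n).2, h2⟩

/-- Approach `s` from the right through `D`. Increments from those times have second moment at most
`K (r - s)`, and Fatou's lemma extends this to `s`. -/
theorem eLpNorm_incr_le_of_dense (ha : BoundedMatrixField K a) (hβ : Nonanticipating K β)
    {D : Set ℝ≥0} (hD : Dense D)
    (h : ∀ s ∈ D, ∀ r ∈ D, s ≤ r → IncrementProblem a β P s r) (i : Fin d) {s r : ℝ≥0}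
    (hr : r ∈ D) (hsr : s < r) :
    eLpNorm (incr β i s r) 2 P ≤
      (((K * (r - s : ℝ)).toNNReal ^ (1 / 2 : ℝ) : ℝ≥0) : ℝ≥0∞) := by
  obtain ⟨u, hu1, hu2, hu3⟩ := exists_seq_tendsto_of_dense hD s
  have hev : ∀ᶠ n in atTop, u n ≤ r := (hu3.eventually (gt_mem_nhds hsr)).mono fun _ => le_of_lt
  have hlim : ∀ ω, Tendsto (fun n => incr β i (u n) r ω) atTop (𝓝 (incr β i s r ω)) := by
    intro ω
    rw [incr_eq_sub hβ i hsr.le]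
    refine Tendsto.congr' (f₁ := fun n => incr β i 0 r ω - incr β i 0 (u n) ω) ?_ ?_
    · filter_upwards [hev] with n hn using (incr_eq_sub hβ i hn ω).symm
    · exact tendsto_const_nhds.sub (((continuous_incr hβ i ω).tendsto s).comp hu3)
  refine (Lp.eLpNorm_lim_le_liminf_eLpNorm
    (fun n => (measurable_incr hβ.measurable i (u n) r).aestronglyMeasurable) _
    (ae_of_all _ hlim)).trans ?_
  refine liminf_le_of_le (by isBoundedDefault) fun b hb => ?_
  obtain ⟨n, hn1, hn2⟩ := (hb.and hev).exists
  refine hn1.trans ((eLpNorm_two_le_of_lintegral_sq_le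
    ((h _ (hu2 n) r hr hn2).lintegral_sq_le ha hn2 i)).trans ?_)
  have : (s : ℝ) ≤ u n := NNReal.coe_le_coe.2 (hu1 n).le
  gcongr

/-- The martingale problem has to be checked only along a dense set of times. -/
theorem martingaleProblem_of_dense (ha : BoundedMatrixField K a) (hβ : Nonanticipating K β)
    {D : Set ℝ≥0} (hD : Dense D)
    (h : ∀ s ∈ D, ∀ r ∈ D, s ≤ r → IncrementProblem a β P s r) : MartingaleProblem a β P := by
  intro s r hsr
  rcases hsr.eq_or_lt with rfl | hlt
  · exact IncrementProblem.refl s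
  have hM : ∀ i {t : ℝ≥0} {u : ℝ≥0}, u ∈ D → t < u → MemLp (incr β i t u) 2 P := fun i t u hu htu =>
    ⟨(measurable_incr hβ.measurable i t u).aestronglyMeasurable,
      (eLpNorm_incr_le_of_dense ha hβ hD h i hu htu).trans_lt ENNReal.coe_lt_top⟩
  have hsmall : ∀ i (t : ℝ≥0) (u : ℕ → ℝ≥0), (∀ n, t < u n) → (∀ n, u n ∈ D) →
      Tendsto u atTop (𝓝 t) → Tendsto (fun n => eLpNorm (incr β i t (u n)) 2 P) atTop (𝓝 0) := by
    intro i t u h1 h2 h3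
    refine tendsto_of_tendsto_of_tendsto_of_le_of_le tendsto_const_nhds ?_ (fun _ => zero_le)
      fun n => eLpNorm_incr_le_of_dense ha hβ hD h i (h2 n) (h1 n)
    have h4 : Continuous fun v : ℝ≥0 =>
        (((K * (v - t : ℝ)).toNNReal ^ (1 / 2 : ℝ) : ℝ≥0) : ℝ≥0∞) := by
      refine ENNReal.continuous_coe.comp ((NNReal.continuous_rpow_const (by norm_num)).comp ?_)
      fun_prop
    have h5 := (h4.tendsto t).comp h3
    simpa [Function.comp_def] using h5
  -- Approximation from the right keeps every event of `𝓕_s` in `𝓕_{u n}`, so the same test event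
  -- serves along the sequence.
  obtain ⟨u, hu1, hu2, hu3⟩ := exists_seq_tendsto_of_dense hD s
  obtain ⟨v, hv1, hv2, hv3⟩ := exists_seq_tendsto_of_dense hD r
  obtain ⟨N, hN⟩ := eventually_atTop.1 (hu3.eventually (gt_mem_nhds hlt))
  have huv : ∀ n, u (n + N) ≤ v n := fun n => ((hN (n + N) (by omega)).trans (hv1 n)).le
  have hu3' : Tendsto (fun n => u (n + N)) atTop (𝓝 s) := hu3.comp (tendsto_add_atTop_nat N)
  have hL : ∀ i, MemLp (incr β i s r) 2 P := by
    intro i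
    have e : incr β i s r = incr β i s (v 0) - incr β i r (v 0) := by
      ext ω
      rw [Pi.sub_apply, incr_add hβ i hlt.le (hv1 0).le]
      ring
    rw [e]
    exact (hM i (hv2 0) (hlt.trans (hv1 0))).sub (hM i (hv2 0) (hv1 0))
  have hLn : ∀ i n, MemLp (incr β i (u (n + N)) (v n)) 2 P := fun i n =>
    (h _ (hu2 _) _ (hv2 n) (huv n)).memLp i
  -- The two increments differ only over `(r, v n]` and `(s, u (n + N)]`, short intervals on which
  -- the `L²` norm is small.
  have hconv : ∀ i, Tendsto (fun n => eLpNorm (incr β i (u (n + N)) (v n) - incr β i s r) 2 P)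
      atTop (𝓝 0) := by
    intro i
    have h1 := (hsmall i r v hv1 hv2 hv3).add
      (hsmall i s (fun n => u (n + N)) (fun n => hu1 _) (fun n => hu2 _) hu3')
    rw [add_zero] at h1
    refine tendsto_of_tendsto_of_tendsto_of_le_of_le tendsto_const_nhds h1 (fun _ => zero_le)
      fun n => ?_
    have e : incr β i (u (n + N)) (v n) - incr β i s r =
        incr β i r (v n) - incr β i s (u (n + N)) := by
      ext ω
      simp only [Pi.sub_apply]
      rw [incr_eq_sub hβ i (huv n), incr_eq_sub hβ i hsr, incr_eq_sub hβ i (hv1 n).le,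
        incr_eq_sub hβ i (hu1 _).le]
      ring
    dsimp only
    rw [e]
    exact eLpNorm_sub_le (measurable_incr hβ.measurable i _ _).aestronglyMeasurable
      (measurable_incr hβ.measurable i _ _).aestronglyMeasurable (by norm_num)
  have hmono : ∀ n A, MeasurableSet[canonicalFiltration d s] A →
      MeasurableSet[canonicalFiltration d (u (n + N))] A := fun n A hA =>
    (canonicalFiltration d).mono (hu1 (n + N)).le _ hA
  refine ⟨hL, fun i A hA => ?_, fun i j A hA => ?_⟩
  · have h1 := tendsto_setIntegral_mul (hLn i) (fun _ => memLp_const (1 : ℝ)) (hL i)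
      (memLp_const (1 : ℝ)) (hconv i) (by simp) A
    simp only [mul_one] at h1
    refine tendsto_nhds_unique h1 (tendsto_const_nhds.congr fun n => ?_)
    exact ((h _ (hu2 _) _ (hv2 n) (huv n)).fst i A (hmono n A hA)).symm
  · have h1 := tendsto_setIntegral_mul (hLn i) (hLn j) (hL i) (hL j) (hconv i) (hconv j) A
    have h2 : Tendsto (fun n => ∫ ω in A, covInt a i j (u (n + N)) (v n) ω ∂P) atTop
        (𝓝 (∫ ω in A, covInt a i j s r ω ∂P)) := by
      refine tendsto_integral_filter_of_dominated_convergence (fun _ => K * (r + 1 : ℝ)) ?_ ?_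
        (integrable_const _) ?_
      · exact Eventually.of_forall fun n => (measurable_covInt ha i j _ _).aestronglyMeasurable
      · filter_upwards [hv3.eventually (gt_mem_nhds (lt_add_one r))] with n hn
        refine ae_of_all _ fun ω => (abs_covInt_le ha i j (huv n) ω).trans ?_
        have : (v n : ℝ) ≤ r + 1 := by exact_mod_cast hn.le
        have h0 : (0 : ℝ) ≤ u (n + N) := NNReal.coe_nonneg _
        gcongr
        linarith
      · refine ae_of_all _ fun ω => ?_
        have hc := continuous_covInt ha i j ω
        rw [covInt_eq_sub ha i j hsr]
        refine Tendsto.congr (f₁ := fun n => covInt a i j 0 (v n) ω -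
          covInt a i j 0 (u (n + N)) ω) (fun n => (covInt_eq_sub ha i j (huv n) ω).symm) ?_
        exact ((hc.tendsto r).comp hv3).sub ((hc.tendsto s).comp hu3')
    have hi : Integrable (fun ω => incr β i s r ω * incr β j s r ω) P :=
      (hL i).integrable_mul (hL j)
    rw [integral_sub hi.integrableOn (integrable_covInt ha i j hsr).integrableOn]
    refine tendsto_nhds_unique (h1.sub h2) (tendsto_const_nhds.congr fun n => ?_)
    have h3 := h _ (hu2 _) _ (hv2 n) (huv n)
    rw [← integral_sub (h3.integrable_mul i j).integrableOn
      (integrable_covInt ha i j (huv n)).integrableOn]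
    exact (h3.snd i j A (hmono n A hA)).symm

end CountableReduction

/-! ### Stability under conditioning on the past. -/

section Conditioning

open Filter Topology

section CompProd

variable {α γ : Type*} [MeasurableSpace α] [MeasurableSpace γ] {ν : Measure α} [IsFiniteMeasure ν]
  {κ : Kernel α γ} [IsMarkovKernel κ] {f : α × γ → ℝ}

/-- The inner integral is an integrable function of `η` whose integral over every `B` vanishes. The
null set depends on `A`, hence the need for a countable family of test events. -/
theorem ae_setIntegral_eq_zero_of_compProd (hf : Integrable f (ν ⊗ₘ κ)) {A : Set γ}
    (hA : MeasurableSet A)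
    (h : ∀ B, MeasurableSet B → ∫ p in B ×ˢ A, f p ∂(ν ⊗ₘ κ) = 0) :
    ∀ᵐ η ∂ν, ∫ z in A, f (η, z) ∂(κ η) = 0 := by
  have hi : Integrable (fun η => ∫ z in A, f (η, z) ∂(κ η)) ν := by
    have h0 : Integrable ((univ ×ˢ A).indicator f) (ν ⊗ₘ κ) :=
      hf.indicator (MeasurableSet.univ.prod hA)
    rw [Measure.compProd] at h0
    have h1 := h0.integral_compProd
    simp only [Kernel.const_apply, Kernel.prodMkLeft_apply] at h1
    refine h1.congr (ae_of_all _ fun η => ?_)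
    dsimp only
    rw [← integral_indicator hA]
    refine integral_congr_ae (ae_of_all _ fun z => ?_)
    by_cases hz : z ∈ A <;> simp [hz]
  exact hi.ae_eq_zero_of_forall_setIntegral_eq_zero fun B hB _ => by
    rw [← Measure.setIntegral_compProd hB hA hf.integrableOn, h B hB]

theorem setIntegral_compProd_eq_zero (hf : Integrable f (ν ⊗ₘ κ)) {A : Set (α × γ)}
    (hA : MeasurableSet A) (h : ∀ᵐ η ∂ν, ∫ z in Prod.mk η ⁻¹' A, f (η, z) ∂(κ η) = 0) :
    ∫ p in A, f p ∂(ν ⊗ₘ κ) = 0 := by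
  rw [← integral_indicator hA, Measure.integral_compProd (hf.indicator hA)]
  rw [integral_congr_ae (g := fun _ => (0 : ℝ))]
  · simp
  · filter_upwards [h] with η hη
    rw [← hη, ← integral_indicator (measurable_prodMk_left hA)]
    rfl

end CompProd

variable {d : ℕ}

theorem measurable_shift (t : ℝ≥0) : Measurable (shift (d := d) t) :=
  (continuous_shift t).measurable

/-- The path up to time `t` together with the path after time `t`. -/
def split (t : ℝ≥0) (ω : PathSpace d) : PathSpace d × PathSpace d := (stopAt t ω, shift t ω)

theorem measurable_split (t : ℝ≥0) : Measurable (split (d := d) t) :=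
  (measurable_stop t).prodMk (measurable_shift t)

theorem concat_split (t : ℝ≥0) (ω : PathSpace d) : concat t (stopAt t ω) (shift t ω) = ω := by
  rw [concat_stop, concat_shift]

variable {a : E d → Matrix (Fin d) (Fin d) ℝ} {β : ℝ≥0 → PathSpace d → E d} {K : ℝ≥0}

/-- The control after time `t`, given the path up to time `t`. -/
def tail (β : ℝ≥0 → PathSpace d → E d) (t : ℝ≥0) (η : PathSpace d) (s : ℝ≥0) (ω : PathSpace d) :
    E d := β (t + s) (concat t η ω)

theorem measurable_tail (hβ : Measurable (Function.uncurry β)) (t : ℝ≥0) :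
    Measurable fun p : PathSpace d × ℝ≥0 × PathSpace d => tail β t p.1 p.2.1 p.2.2 := by
  have h : Measurable fun p : PathSpace d × ℝ≥0 × PathSpace d =>
      (t + p.2.1, concat t p.1 p.2.2) := by
    refine (measurable_const.add (measurable_fst.comp measurable_snd)).prodMk ?_
    exact (continuous_concat t).measurable.comp
      (measurable_fst.prodMk (measurable_snd.comp measurable_snd))
  exact hβ.comp h

theorem Nonanticipating.tail (hβ : Nonanticipating K β) (t : ℝ≥0) (η : PathSpace d) :
    Nonanticipating K (tail β t η) where
  measurable := (measurable_tail hβ.measurable t).comp measurable_prodMk_left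
  stop_eq s ω := by
    unfold NonlinearDiffusion.tail
    rw [← stop_add_concat, hβ.stop_eq]
  bound s ω i := hβ.bound _ _ i

theorem tail_split (β : ℝ≥0 → PathSpace d → E d) (t u : ℝ≥0) (ω : PathSpace d) :
    tail β t (stopAt t ω) u (shift t ω) = β (t + u) ω := by
  unfold tail
  rw [concat_split]

theorem incr_split (β : ℝ≥0 → PathSpace d → E d) (i : Fin d) (t s r : ℝ≥0) (ω : PathSpace d) :
    incr β i (t + s) (t + r) ω = incr (tail β t (stopAt t ω)) i s r (shift t ω) :=
  incr_add_left rfl (fun u => (tail_split β t u ω).symm) i s r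

theorem measurable_incr_tail (hβ : Nonanticipating K β) (t : ℝ≥0) (i : Fin d) (s r : ℝ≥0) :
    Measurable fun p : PathSpace d × PathSpace d => incr (tail β t p.1) i s r p.2 :=
  measurable_incr_param (measurable_tail hβ.measurable t) i s r

theorem measurableSet_split_preimage {t s : ℝ≥0} {A B : Set (PathSpace d)} (hB : MeasurableSet B)
    (hA : MeasurableSet[canonicalFiltration d s] A) :
    MeasurableSet[canonicalFiltration d (t + s)] (split t ⁻¹' B ×ˢ A) := by
  obtain ⟨hA1, hA2⟩ := measurableSet_canonicalFiltration_iff.1 hA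
  refine measurableSet_canonicalFiltration_iff.2 ⟨measurable_split t (hB.prod hA1), ?_⟩
  ext ω
  simp only [mem_preimage, split, mem_prod, stop_stop, min_eq_left (le_self_add : t ≤ t + s),
    shift_stop]
  rw [← mem_preimage (f := stopAt s), hA2]

variable {P : Measure (PathSpace d)} {κ : Kernel (PathSpace d) (PathSpace d)} {t : ℝ≥0}

theorem integrable_covInt_snd (ha : BoundedMatrixField K a)
    {μ : Measure (PathSpace d × PathSpace d)} [IsFiniteMeasure μ] (i j : Fin d) {s r : ℝ≥0}
    (hsr : s ≤ r) : Integrable (fun p => covInt a i j s r p.2) μ :=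
  Integrable.of_bound ((measurable_covInt ha i j s r).comp measurable_snd).aestronglyMeasurable
    (K * (r - s)) (ae_of_all _ fun p => abs_covInt_le ha i j hsr p.2)

theorem memLp_incr_tail_iff (hβ : Nonanticipating K β)
    (hκ : P.map (split t) = P.map (stopAt t) ⊗ₘ κ) (i : Fin d) (s r : ℝ≥0) :
    MemLp (fun p : PathSpace d × PathSpace d => incr (tail β t p.1) i s r p.2) 2
      (P.map (stopAt t) ⊗ₘ κ) ↔ MemLp (incr β i (t + s) (t + r)) 2 P := by
  rw [← hκ, memLp_map_measure_iff (measurable_incr_tail hβ t i s r).aestronglyMeasurable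
    (measurable_split t).aemeasurable]
  have : (fun p : PathSpace d × PathSpace d => incr (tail β t p.1) i s r p.2) ∘ split t =
      incr β i (t + s) (t + r) := by
    ext ω
    exact (incr_split β i t s r ω).symm
  rw [this]

variable [IsProbabilityMeasure P] [IsMarkovKernel κ]

/-- Events of the past times events of the countable π-system stopped at `s` pull back to `𝓕_{t+s}`.
Testing the increments of `P` on them gives the identities for almost every conditional law. -/
theorem ae_incrementProblem_tail (ha : BoundedMatrixField K a) (hβ : Nonanticipating K β)
    (hκ : P.map (split t) = P.map (stopAt t) ⊗ₘ κ) {s r : ℝ≥0} (hsr : s ≤ r)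
    (h : IncrementProblem a β P (t + s) (t + r)) :
    ∀ᵐ η ∂(P.map (stopAt t)), IncrementProblem a (tail β t η) (κ η) s r := by
  have hprob : IsProbabilityMeasure (P.map (stopAt t)) :=
    Measure.isProbabilityMeasure_map (measurable_stop t).aemeasurable
  set D : Fin d → PathSpace d × PathSpace d → ℝ := fun i p => incr (tail β t p.1) i s r p.2
  have hDm : ∀ i, Measurable (D i) := fun i => measurable_incr_tail hβ t i s r
  have hDc : ∀ i j, Measurable fun p => D i p * D j p - covInt a i j s r p.2 := fun i j =>
    ((hDm i).mul (hDm j)).sub ((measurable_covInt ha i j s r).comp measurable_snd)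
  have hDL : ∀ i, MemLp (D i) 2 (P.map (stopAt t) ⊗ₘ κ) := fun i =>
    (memLp_incr_tail_iff hβ hκ i s r).2 (h.memLp i)
  have hL : ∀ i, ∀ᵐ η ∂(P.map (stopAt t)), MemLp (incr (tail β t η) i s r) 2 (κ η) := by
    intro i
    have h1 := ((Measure.integrable_compProd_iff (hDL i).integrable_sq.aestronglyMeasurable).1
      (hDL i).integrable_sq).1
    filter_upwards [h1] with η hη
    exact (memLp_two_iff_integrable_sq
      (measurable_incr (hβ.tail t η).measurable i s r).aestronglyMeasurable).2 hη
  have hset : ∀ k B, MeasurableSet B → MeasurableSet[canonicalFiltration d (t + s)]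
      (split t ⁻¹' B ×ˢ (stopAt s ⁻¹' pathSets d k)) := fun k B hB =>
    measurableSet_split_preimage hB (measurableSet_stop_preimage (measurableSet_pathSets k))
  have hm : ∀ k, MeasurableSet (stopAt (d := d) s ⁻¹' pathSets d k) := fun k =>
    measurable_stop s (measurableSet_pathSets k)
  have h1 : ∀ i k, ∀ᵐ η ∂(P.map (stopAt t)),
      ∫ ω in stopAt s ⁻¹' pathSets d k, incr (tail β t η) i s r ω ∂(κ η) = 0 := by
    intro i k
    refine ae_setIntegral_eq_zero_of_compProd (f := D i) ((hDL i).integrable (by norm_num))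
      (hm k) fun B hB => ?_
    rw [← hκ, setIntegral_map (hB.prod (hm k)) (hDm i).aestronglyMeasurable
      (measurable_split t).aemeasurable]
    have := h.fst i _ (hset k B hB)
    simp only [incr_split] at this
    exact this
  have h2 : ∀ i j k, ∀ᵐ η ∂(P.map (stopAt t)),
      ∫ ω in stopAt s ⁻¹' pathSets d k, (incr (tail β t η) i s r ω * incr (tail β t η) j s r ω -
        covInt a i j s r ω) ∂(κ η) = 0 := by
    intro i j k
    refine ae_setIntegral_eq_zero_of_compProd
      (f := fun p => D i p * D j p - covInt a i j s r p.2)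
      (((hDL i).integrable_mul (hDL j)).sub (integrable_covInt_snd ha i j hsr))
      (hm k) fun B hB => ?_
    rw [← hκ, setIntegral_map (hB.prod (hm k)) (hDc i j).aestronglyMeasurable
      (measurable_split t).aemeasurable]
    have := h.snd i j _ (hset k B hB)
    simp only [incr_split, covInt_add_left] at this
    exact this
  filter_upwards [ae_all_iff.2 hL, ae_all_iff.2 fun i => ae_all_iff.2 (h1 i),
    ae_all_iff.2 fun i => ae_all_iff.2 fun j => ae_all_iff.2 (h2 i j)] with η e0 e1 e2
  exact (incrementProblem_iff ha hsr).2 ⟨e0, e1, e2⟩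

/-- The exceptional set depends on the two times, so they are first restricted to a countable dense
sequence. -/
theorem MartingaleProblem.ae_tail (ha : BoundedMatrixField K a) (hβ : Nonanticipating K β)
    (hκ : P.map (split t) = P.map (stopAt t) ⊗ₘ κ) (h : MartingaleProblem a β P) :
    ∀ᵐ η ∂(P.map (stopAt t)), MartingaleProblem a (tail β t η) (κ η) := by
  let D : ℕ → ℝ≥0 := TopologicalSpace.denseSeq ℝ≥0
  have h1 : ∀ m n, ∀ᵐ η ∂(P.map (stopAt t)), D m ≤ D n →
      IncrementProblem a (tail β t η) (κ η) (D m) (D n) := by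
    intro m n
    by_cases hmn : D m ≤ D n
    · filter_upwards [ae_incrementProblem_tail ha hβ hκ hmn (h _ _ (by gcongr))] with η hη _
      exact hη
    · exact ae_of_all _ fun η h => absurd h hmn
  filter_upwards [ae_all_iff.2 fun m => ae_all_iff.2 (h1 m)] with η hη
  refine martingaleProblem_of_dense ha (hβ.tail t η) (TopologicalSpace.denseRange_denseSeq ℝ≥0) ?_
  rintro _ ⟨m, rfl⟩ _ ⟨n, rfl⟩ hmn
  exact hη m n hmn

/-- An event of `𝓕_{t+s}`, read through concatenation, has sections in `𝓕_s`, so the identities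
integrate over the past. The bound `K (r - s)` on conditional second moments is uniform in `η` and
gives square integrability. -/
theorem incrementProblem_of_ae_tail (ha : BoundedMatrixField K a) (hβ : Nonanticipating K β)
    (hκ : P.map (split t) = P.map (stopAt t) ⊗ₘ κ) {s r : ℝ≥0} (hsr : s ≤ r)
    (h : ∀ᵐ η ∂(P.map (stopAt t)), IncrementProblem a (tail β t η) (κ η) s r) :
    IncrementProblem a β P (t + s) (t + r) := by
  have hprob : IsProbabilityMeasure (P.map (stopAt t)) :=
    Measure.isProbabilityMeasure_map (measurable_stop t).aemeasurable
  set D : Fin d → PathSpace d × PathSpace d → ℝ := fun i p => incr (tail β t p.1) i s r p.2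
  have hDm : ∀ i, Measurable (D i) := fun i => measurable_incr_tail hβ t i s r
  have hDc : ∀ i j, Measurable fun p => D i p * D j p - covInt a i j s r p.2 := fun i j =>
    ((hDm i).mul (hDm j)).sub ((measurable_covInt ha i j s r).comp measurable_snd)
  have hDL : ∀ i, MemLp (D i) 2 (P.map (stopAt t) ⊗ₘ κ) := by
    intro i
    refine ⟨(hDm i).aestronglyMeasurable, (eLpNorm_two_le_of_lintegral_sq_le
      (c := K * (r - s)) ?_).trans_lt ENNReal.coe_lt_top⟩
    have hm : Measurable fun p => ENNReal.ofReal (D i p * D i p) :=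
      ((hDm i).mul (hDm i)).ennreal_ofReal
    rw [Measure.lintegral_compProd hm]
    refine (lintegral_mono_ae (g := fun _ => ENNReal.ofReal (K * (r - s))) ?_).trans (by simp)
    filter_upwards [h] with η hη
    exact hη.lintegral_sq_le ha hsr i
  have hset : ∀ A, MeasurableSet[canonicalFiltration d (t + s)] A →
      ∃ A' : Set (PathSpace d × PathSpace d), MeasurableSet A' ∧ split t ⁻¹' A' = A ∧
        ∀ η, MeasurableSet[canonicalFiltration d s] (Prod.mk η ⁻¹' A') := by
    intro A hA
    obtain ⟨hA1, hA2⟩ := measurableSet_canonicalFiltration_iff.1 hA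
    have hm : MeasurableSet ((fun p : PathSpace d × PathSpace d => concat t p.1 p.2) ⁻¹' A) :=
      (continuous_concat t).measurable hA1
    refine ⟨_, hm, ?_, fun η => measurableSet_canonicalFiltration_iff.2
      ⟨measurable_prodMk_left hm, ?_⟩⟩
    · ext ω
      simp only [mem_preimage, split, concat_split]
    · ext ω
      simp only [mem_preimage]
      rw [← stop_add_concat, ← mem_preimage (f := stopAt (t + s)), hA2]
  refine ⟨fun i => (memLp_incr_tail_iff hβ hκ i s r).1 (hDL i), fun i A hA => ?_,
    fun i j A hA => ?_⟩
  · obtain ⟨A', hA', rfl, hsec⟩ := hset A hA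
    have h1 := setIntegral_compProd_eq_zero ((hDL i).integrable (by norm_num)) hA' (by
      filter_upwards [h] with η hη using hη.fst i _ (hsec η))
    rw [← hκ, setIntegral_map hA' (hDm i).aestronglyMeasurable
      (measurable_split t).aemeasurable] at h1
    simp only [incr_split]
    exact h1
  · obtain ⟨A', hA', rfl, hsec⟩ := hset A hA
    have h1 := setIntegral_compProd_eq_zero (f := fun p => D i p * D j p - covInt a i j s r p.2)
      (((hDL i).integrable_mul (hDL j)).sub (integrable_covInt_snd ha i j hsr)) hA' (by
      filter_upwards [h] with η hη using hη.snd i j _ (hsec η))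
    rw [← hκ, setIntegral_map hA' (hDc i j).aestronglyMeasurable
      (measurable_split t).aemeasurable] at h1
    simp only [incr_split, covInt_add_left]
    exact h1

variable {F : Type*} {b : F × E d → E d}

theorem measurableSet_drift {Y : Type*} [MeasurableSpace Y] (hV : MeasurableSet (driftSet b))
    {B : Y → ℝ≥0 → PathSpace d → E d}
    (hB : Measurable fun p : Y × ℝ≥0 × PathSpace d => B p.1 p.2.1 p.2.2) :
    MeasurableSet {p : Y × PathSpace d | ∀ᵐ s ∂lebesgue, (X s p.2, B p.1 s p.2) ∈ driftSet b} := by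
  have h1 : MeasurableSet {q : (Y × PathSpace d) × ℝ≥0 |
      (X q.2 q.1.2, B q.1.1 q.2 q.1.2) ∈ driftSet b} := by
    refine hV.preimage ((continuous_X_uncurry.measurable.comp
      (f := fun q : (Y × PathSpace d) × ℝ≥0 => (q.2, q.1.2)) (by fun_prop)).prodMk ?_)
    exact hB.comp (f := fun q : (Y × PathSpace d) × ℝ≥0 => (q.1.1, q.2, q.1.2)) (by fun_prop)
  exact measurable_measure_prodMk_left h1.compl (measurableSet_singleton 0)

theorem ae_drift_tail_iff (hV : MeasurableSet (driftSet b)) (hβ : Nonanticipating K β)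
    (hκ : P.map (split t) = P.map (stopAt t) ⊗ₘ κ) :
    (∀ᵐ η ∂(P.map (stopAt t)), ∀ᵐ ω ∂(κ η), ∀ᵐ s ∂lebesgue, (X s ω, tail β t η s ω) ∈ driftSet b) ↔
      ∀ᵐ ω ∂P, ∀ᵐ s ∂lebesgue, t ≤ s → (X s ω, β s ω) ∈ driftSet b := by
  have hprob : IsProbabilityMeasure (P.map (stopAt t)) :=
    Measure.isProbabilityMeasure_map (measurable_stop t).aemeasurable
  have hm := measurableSet_drift hV (measurable_tail hβ.measurable t)
  rw [← Measure.ae_compProd_iff hm, ← hκ, ae_map_iff (measurable_split t).aemeasurable hm]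
  refine eventually_congr (Eventually.of_forall fun ω => ?_)
  rw [← ae_lebesgue_add t]
  simp only [split, tail_split, X, shift_apply, add_comm]

/-- Conditional laws of controlled laws are controlled laws. -/
theorem IsControlledLaw.ae_tail (ha : BoundedMatrixField K a) (hV : MeasurableSet (driftSet b))
    (hκ : P.map (split t) = P.map (stopAt t) ⊗ₘ κ) (h : IsControlledLaw b a K β P) :
    ∀ᵐ η ∂(P.map (stopAt t)), (∀ᵐ ω ∂(κ η), X 0 ω = X t η) ∧
      IsControlledLaw b a K (tail β t η) (κ η) := by
  have hprob : IsProbabilityMeasure (P.map (stopAt t)) :=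
    Measure.isProbabilityMeasure_map (measurable_stop t).aemeasurable
  have h0 : ∀ᵐ η ∂(P.map (stopAt t)), ∀ᵐ ω ∂(κ η), X 0 ω = X t η := by
    have hm : MeasurableSet {p : PathSpace d × PathSpace d | X 0 p.2 = X t p.1} :=
      measurableSet_eq_fun ((continuous_X 0).measurable.comp measurable_snd)
        ((continuous_X t).measurable.comp measurable_fst)
    rw [← Measure.ae_compProd_iff hm, ← hκ, ae_map_iff (measurable_split t).aemeasurable hm]
    exact ae_of_all _ fun ω => by simp [split, X]
  have h1 := (ae_drift_tail_iff hV h.nonanticipating hκ).2 (by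
    filter_upwards [h.drift] with ω hω
    filter_upwards [hω] with s hs _ using hs)
  filter_upwards [h0, h1, h.martingaleProblem.ae_tail ha h.nonanticipating hκ] with η e0 e1 e2
  exact ⟨e0, h.nonanticipating.tail t η, e2, e1⟩

end Conditioning

/-! ### Stability under gluing at a fixed time. -/

section Gluing

open Filter Topology

variable {d : ℕ} {F : Type*} {b : F × E d → E d} {a : E d → Matrix (Fin d) (Fin d) ℝ}
  {β β' : ℝ≥0 → PathSpace d → E d} {K : ℝ≥0} {P P' : Measure (PathSpace d)} {t : ℝ≥0}

theorem incr_congr {ω : PathSpace d} (h : ∀ᵐ s ∂lebesgue, β s ω = β' s ω) (i : Fin d)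
    (s r : ℝ≥0) : incr β i s r ω = incr β' i s r ω := by
  unfold incr
  congr 1
  refine integral_congr_ae (ae_restrict_of_ae ?_)
  filter_upwards [h] with u hu
  rw [hu]

theorem IncrementProblem.congr (h : ∀ᵐ ω ∂P, ∀ᵐ s ∂lebesgue, β s ω = β' s ω) {s r : ℝ≥0}
    (hp : IncrementProblem a β P s r) : IncrementProblem a β' P s r where
  memLp i := (hp.memLp i).ae_eq (h.mono fun ω hω => incr_congr hω i s r)
  fst i A hA := by
    rw [← hp.fst i A hA]
    refine integral_congr_ae (ae_restrict_of_ae ?_)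
    filter_upwards [h] with ω hω
    rw [incr_congr hω]
  snd i j A hA := by
    rw [← hp.snd i j A hA]
    refine integral_congr_ae (ae_restrict_of_ae ?_)
    filter_upwards [h] with ω hω
    rw [incr_congr hω, incr_congr hω]

theorem IsControlledLaw.congr (h : ∀ᵐ ω ∂P, ∀ᵐ s ∂lebesgue, β s ω = β' s ω)
    (hβ' : Nonanticipating K β') (hp : IsControlledLaw b a K β P) :
    IsControlledLaw b a K β' P where
  nonanticipating := hβ'
  martingaleProblem s r hsr := (hp.martingaleProblem s r hsr).congr h
  drift := by
    filter_upwards [h, hp.drift] with ω h1 h2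
    filter_upwards [h1, h2] with s h3 h4
    rwa [← h3]

theorem setIntegral_eq_of_map_stop_eq (hP : P'.map (stopAt t) = P.map (stopAt t))
    {f : PathSpace d → ℝ} (hf : Measurable f) (hft : ∀ ω, f (stopAt t ω) = f ω)
    {A : Set (PathSpace d)} (hA : MeasurableSet[canonicalFiltration d t] A) :
    ∫ ω in A, f ω ∂P' = ∫ ω in A, f ω ∂P := by
  obtain ⟨hA1, hA2⟩ := measurableSet_canonicalFiltration_iff.1 hA
  have h : ∀ μ : Measure (PathSpace d), ∫ ω in A, f ω ∂μ = ∫ ω in A, f ω ∂(μ.map (stopAt t)) := by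
    intro μ
    rw [setIntegral_map hA1 hf.aestronglyMeasurable (measurable_stop t).aemeasurable, hA2]
    simp only [hft]
  rw [h P', h P, hP]

theorem memLp_of_map_stop_eq (hP : P'.map (stopAt t) = P.map (stopAt t))
    {f : PathSpace d → ℝ} (hf : Measurable f) (hft : ∀ ω, f (stopAt t ω) = f ω)
    (h : MemLp f 2 P) : MemLp f 2 P' := by
  have e : f ∘ stopAt t = f := funext hft
  rw [← e] at h ⊢
  rw [← memLp_map_measure_iff hf.aestronglyMeasurable (measurable_stop t).aemeasurable] at h ⊢
  rwa [hP]

/-- Up to time `t` every quantity in the problem is a function of the stopped path, so only the law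
of the latter matters. -/
theorem IncrementProblem.of_map_stop_eq (ha : BoundedMatrixField K a) (hβ : Nonanticipating K β)
    (hP : P'.map (stopAt t) = P.map (stopAt t)) (hββ' : ∀ u ≤ t, ∀ ω, β u ω = β' u ω) {s r : ℝ≥0}
    (hsr : s ≤ r) (hrt : r ≤ t) (h : IncrementProblem a β P s r) :
    IncrementProblem a β' P' s r := by
  have he : ∀ i, incr β' i s r = incr β i s r := by
    intro i
    ext ω
    unfold incr
    congr 1
    refine setIntegral_congr_fun measurableSet_Ioc fun u hu => ?_
    simp only [hββ' u (hu.2.trans hrt)]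
  have hm : ∀ i, Measurable (incr β i s r) := fun i => measurable_incr hβ.measurable i s r
  have hi := fun i => incr_stop hβ i hsr hrt
  refine ⟨fun i => ?_, fun i A hA => ?_, fun i j A hA => ?_⟩
  · rw [he]
    exact memLp_of_map_stop_eq hP (hm i) (hi i) (h.memLp i)
  · rw [he, setIntegral_eq_of_map_stop_eq hP (hm i) (hi i)
      ((canonicalFiltration d).mono (hsr.trans hrt) _ hA)]
    exact h.fst i A hA
  · rw [he, he, setIntegral_eq_of_map_stop_eq hP
      (f := fun ω => incr β i s r ω * incr β j s r ω - covInt a i j s r ω)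
      (((hm i).mul (hm j)).sub (measurable_covInt ha i j s r))
      (fun ω => by rw [hi, hi, covInt_stop i j hrt])
      ((canonicalFiltration d).mono (hsr.trans hrt) _ hA)]
    exact h.snd i j A hA

/-- Follow the control `β` up to time `t` and afterwards the control `B` started at `X_t`. -/
def glueControl (t : ℝ≥0) (β : ℝ≥0 → PathSpace d → E d) (B : E d → ℝ≥0 → PathSpace d → E d)
    (s : ℝ≥0) (ω : PathSpace d) : E d :=
  if s ≤ t then β s ω else B (X t ω) (s - t) (shift t ω)

/-- The law of a path that has law `P` up to time `t` and whose future has conditional law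
`Q (X_t)`. -/
def glueLaw (t : ℝ≥0) (P : Measure (PathSpace d)) (Q : Kernel (E d) (PathSpace d)) :
    Measure (PathSpace d) :=
  (P ⊗ₘ Q.comap (X t) (continuous_X t).measurable).map fun p => concat t p.1 p.2

theorem nonanticipating_glueControl {B : E d → ℝ≥0 → PathSpace d → E d}
    (hβ : Nonanticipating K β)
    (hB : Measurable fun p : E d × ℝ≥0 × PathSpace d => B p.1 p.2.1 p.2.2)
    (hBn : ∀ y, Nonanticipating K (B y)) : Nonanticipating K (glueControl t β B) where
  measurable := by
    refine Measurable.ite (measurableSet_le measurable_fst measurable_const) hβ.measurable ?_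
    exact hB.comp (((continuous_X t).measurable.comp measurable_snd).prodMk
      ((measurable_fst.sub_const t).prodMk ((measurable_shift t).comp measurable_snd)))
  stop_eq s ω := by
    unfold glueControl
    split_ifs with h
    · exact hβ.stop_eq s ω
    · have h1 : s = t + (s - t) := (add_tsub_cancel_of_le (not_le.1 h).le).symm
      have h2 : shift t (stopAt s ω) = stopAt (s - t) (shift t ω) := by
        conv_lhs => rw [h1]
        exact shift_stop t (s - t) ω
      rw [h2, (hBn _).stop_eq, X_stop (not_le.1 h).le]
  bound s ω i := by
    unfold glueControl
    split_ifs with h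
    · exact hβ.bound s ω i
    · exact (hBn _).bound _ _ i

variable [IsProbabilityMeasure P] {Q : Kernel (E d) (PathSpace d)} [IsMarkovKernel Q]

theorem measurable_concat (t : ℝ≥0) :
    Measurable fun p : PathSpace d × PathSpace d => concat t p.1 p.2 :=
  (continuous_concat t).measurable

instance : IsProbabilityMeasure (glueLaw t P Q) :=
  Measure.isProbabilityMeasure_map (measurable_concat t).aemeasurable

theorem map_stop_glueLaw : (glueLaw t P Q).map (stopAt t) = P.map (stopAt t) := by
  unfold glueLaw
  rw [Measure.map_map (measurable_stop t) (measurable_concat t)]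
  have h : (stopAt t ∘ fun p : PathSpace d × PathSpace d => concat t p.1 p.2) =
      stopAt t ∘ Prod.fst := by
    ext1 p
    exact stop_concat_of_le le_rfl p.1 p.2
  rw [h, ← Measure.map_map (measurable_stop t) measurable_fst]
  congr 1
  exact Measure.fst_compProd _ _

theorem ae_glueLaw_start (hQ : ∀ᵐ y ∂(P.map (X t)), ∀ᵐ ω ∂(Q y), X 0 ω = y) :
    ∀ᵐ p ∂(P ⊗ₘ Q.comap (X t) (continuous_X t).measurable), X 0 p.2 = X t p.1 := by
  have hm : MeasurableSet {p : PathSpace d × PathSpace d | X 0 p.2 = X t p.1} :=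
    measurableSet_eq_fun ((continuous_X 0).measurable.comp measurable_snd)
      ((continuous_X t).measurable.comp measurable_fst)
  rw [Measure.ae_compProd_iff hm]
  exact ae_of_ae_map (continuous_X t).measurable.aemeasurable hQ

/-- Where the second path starts at `X t` of the first, shifting the concatenation returns it. As
`Q` is evaluated at `X t`, a function of the past, it is the conditional law of the future. -/
theorem map_split_glueLaw (hQ : ∀ᵐ y ∂(P.map (X t)), ∀ᵐ ω ∂(Q y), X 0 ω = y) :
    (glueLaw t P Q).map (split t) =
      (glueLaw t P Q).map (stopAt t) ⊗ₘ Q.comap (X t) (continuous_X t).measurable := by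
  have hprob : IsProbabilityMeasure (P.map (stopAt t)) :=
    Measure.isProbabilityMeasure_map (measurable_stop t).aemeasurable
  rw [map_stop_glueLaw]
  refine Measure.ext_of_lintegral _ fun f hf => ?_
  rw [lintegral_map hf (measurable_split t), glueLaw,
    lintegral_map (f := fun ω => f (split t ω)) (hf.comp (measurable_split t))
      (measurable_concat t),
    Measure.lintegral_compProd hf, lintegral_map hf.lintegral_kernel_prod_right'
      (measurable_stop t)]
  have h1 : ∫⁻ p, f (split t (concat t p.1 p.2))
      ∂(P ⊗ₘ Q.comap (X t) (continuous_X t).measurable) =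
      ∫⁻ p, f (stopAt t p.1, p.2) ∂(P ⊗ₘ Q.comap (X t) (continuous_X t).measurable) := by
    refine lintegral_congr_ae ?_
    filter_upwards [ae_glueLaw_start hQ] with p hp
    simp only [split, shift_concat hp, stop_concat_of_le le_rfl]
  have hm : Measurable fun p : PathSpace d × PathSpace d => f (stopAt t p.1, p.2) :=
    hf.comp (((measurable_stop t).comp measurable_fst).prodMk measurable_snd)
  beta_reduce
  rw [h1, Measure.lintegral_compProd hm]
  refine lintegral_congr fun ω => ?_
  simp only [Kernel.comap_apply, X_stop le_rfl]

theorem lintegral_shift_glueLaw (hQ : ∀ᵐ y ∂(P.map (X t)), ∀ᵐ ω ∂(Q y), X 0 ω = y)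
    {f : PathSpace d → ℝ≥0∞} (hf : Measurable f) :
    ∫⁻ ω, f (shift t ω) ∂(glueLaw t P Q) = ∫⁻ y, ∫⁻ ω, f ω ∂(Q y) ∂(P.map (X t)) := by
  rw [glueLaw, lintegral_map (f := fun ω => f (shift t ω)) (hf.comp (measurable_shift t))
      (measurable_concat t),
    lintegral_map (hf.lintegral_kernel) (continuous_X t).measurable]
  have h1 : ∫⁻ p, f (shift t (concat t p.1 p.2))
      ∂(P ⊗ₘ Q.comap (X t) (continuous_X t).measurable) =
      ∫⁻ p, f p.2 ∂(P ⊗ₘ Q.comap (X t) (continuous_X t).measurable) := by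
    refine lintegral_congr_ae ?_
    filter_upwards [ae_glueLaw_start hQ] with p hp
    simp only [shift_concat hp]
  have hm : Measurable fun p : PathSpace d × PathSpace d => f p.2 := hf.comp measurable_snd
  rw [h1, Measure.lintegral_compProd hm]
  rfl

/-- Time `s = 0` is excluded because at time `t` itself the glued control still follows `β`; a
single instant is Lebesgue-null. -/
theorem tail_glueControl {B : E d → ℝ≥0 → PathSpace d → E d} {η ω : PathSpace d}
    (h : X 0 ω = X t η) {s : ℝ≥0} (hs : s ≠ 0) :
    tail (glueControl t β B) t η s ω = B (X t η) s ω := by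
  have h1 : ¬ t + s ≤ t := by
    simpa using hs
  have h2 : X t (concat t η ω) = X t η := by
    simpa using X_add_concat t 0 η ω
  simp only [tail, glueControl, if_neg h1, h2, add_tsub_cancel_left, shift_concat h]

/-- Before `t` the stopped law is that of `P`; after `t` the conditional laws solve the problem with
the new controls; an interval containing `t` is split there and handled by `IncrementProblem.trans`.
-/
theorem isControlledLaw_glueLaw (ha : BoundedMatrixField K a) (hV : MeasurableSet (driftSet b))
    (h : IsControlledLaw b a K β P) {B : E d → ℝ≥0 → PathSpace d → E d}
    (hB : Measurable fun p : E d × ℝ≥0 × PathSpace d => B p.1 p.2.1 p.2.2)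
    (hBn : ∀ y, Nonanticipating K (B y))
    (hQ : ∀ᵐ y ∂(P.map (X t)), (∀ᵐ ω ∂(Q y), X 0 ω = y) ∧ IsControlledLaw b a K (B y) (Q y)) :
    IsControlledLaw b a K (glueControl t β B) (glueLaw t P Q) := by
  have hγ := nonanticipating_glueControl (t := t) h.nonanticipating hB hBn
  have hs := map_split_glueLaw (hQ.mono fun y hy => hy.1)
  have hβγ : ∀ u ≤ t, ∀ ω, β u ω = glueControl t β B u ω := fun u hu ω => (if_pos hu).symm
  have hMt : ∀ s r, s ≤ r → r ≤ t →
      IncrementProblem a (glueControl t β B) (glueLaw t P Q) s r := fun s r hsr hrt =>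
    (h.martingaleProblem s r hsr).of_map_stop_eq ha h.nonanticipating map_stop_glueLaw hβγ hsr hrt
  have hne : ∀ᵐ s ∂lebesgue, s ≠ 0 := by
    rw [ae_iff]
    simp
  have htail : ∀ᵐ η ∂((glueLaw t P Q).map (stopAt t)),
      IsControlledLaw b a K (tail (glueControl t β B) t η)
        (Q.comap (X t) (continuous_X t).measurable η) := by
    rw [map_stop_glueLaw]
    have hmap : P.map (X t) = (P.map (stopAt t)).map (X t) := by
      rw [Measure.map_map (continuous_X t).measurable (measurable_stop t)]
      congr 1
      ext1 ω
      exact (X_stop le_rfl ω).symm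
    rw [hmap] at hQ
    filter_upwards [ae_of_ae_map (continuous_X t).measurable.aemeasurable hQ] with η hη
    refine hη.2.congr ?_ (hγ.tail t η)
    filter_upwards [hη.1] with ω hω
    filter_upwards [hne] with s hs
    exact (tail_glueControl hω hs).symm
  have hMt' : ∀ s r, s ≤ r → t ≤ s →
      IncrementProblem a (glueControl t β B) (glueLaw t P Q) s r := by
    intro s r hsr hts
    have h1 := incrementProblem_of_ae_tail ha hγ hs (tsub_le_tsub_right hsr t)
      (htail.mono fun η hη => hη.martingaleProblem _ _ (tsub_le_tsub_right hsr t))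
    rwa [add_tsub_cancel_of_le hts, add_tsub_cancel_of_le (hts.trans hsr)] at h1
  refine ⟨hγ, fun s r hsr => ?_, ?_⟩
  · rcases le_total r t with hrt | hrt
    · exact hMt s r hsr hrt
    · rcases le_total s t with hst | hst
      · exact (hMt s t hst le_rfl).trans ha hγ hst hrt (hMt' t r hrt le_rfl)
      · exact hMt' s r hsr hst
  · have h1 := (ae_drift_tail_iff hV hγ hs).1 (htail.mono fun η hη => hη.drift)
    -- The drift constraint up to time `t` sees only the stopped path, so it carries over from `P`
    -- through the common law of stopped paths.
    have h2 : ∀ᵐ ω ∂(glueLaw t P Q), ∀ᵐ s ∂lebesgue, s ≤ t → (X s ω, β s ω) ∈ driftSet b := by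
      have hm : MeasurableSet {ω | ∀ᵐ s ∂lebesgue, s ≤ t → (X s ω, β s ω) ∈ driftSet b} := by
        have hn : MeasurableSet {q : PathSpace d × ℝ≥0 |
            q.2 ≤ t → (X q.2 q.1, β q.2 q.1) ∈ driftSet b} := by
          refine MeasurableSet.imp (measurableSet_le measurable_snd measurable_const)
            (hV.preimage ((continuous_X_uncurry.measurable.comp measurable_swap).prodMk ?_))
          exact h.nonanticipating.measurable.comp measurable_swap
        exact measurable_measure_prodMk_left hn.compl (measurableSet_singleton 0)
      have he : ∀ ω, (∀ᵐ s ∂lebesgue, s ≤ t → (X s (stopAt t ω), β s (stopAt t ω)) ∈ driftSet b) ↔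
          ∀ᵐ s ∂lebesgue, s ≤ t → (X s ω, β s ω) ∈ driftSet b := by
        intro ω
        refine eventually_congr (Eventually.of_forall fun s => ?_)
        refine imp_congr_right fun hst => ?_
        rw [X_stop hst, h.nonanticipating.stop_eq_of_le hst]
      have h3 : ∀ᵐ ω ∂(P.map (stopAt t)), ∀ᵐ s ∂lebesgue, s ≤ t → (X s ω, β s ω) ∈ driftSet b := by
        rw [ae_map_iff (measurable_stop t).aemeasurable hm]
        filter_upwards [h.drift] with ω hω
        rw [he]
        filter_upwards [hω] with s hs _ using hs
      rw [← map_stop_glueLaw (Q := Q), ae_map_iff (measurable_stop t).aemeasurable hm] at h3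
      exact h3.mono fun ω hω => (he ω).1 hω
    filter_upwards [h1, h2] with ω e1 e2
    filter_upwards [e1, e2] with s e3 e4
    rcases le_total s t with hst | hst
    · rw [← hβγ s hst]
      exact e4 hst
    · exact e3 hst

theorem ae_glueLaw_X_zero {x : E d} (h : ∀ᵐ ω ∂P, X 0 ω = x) :
    ∀ᵐ ω ∂(glueLaw t P Q), X 0 ω = x := by
  have hm : MeasurableSet {ω : PathSpace d | X 0 ω = x} :=
    (continuous_X 0).measurable (measurableSet_singleton x)
  have h1 : ∀ᵐ ω ∂(P.map (stopAt t)), X 0 ω = x := by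
    rw [ae_map_iff (measurable_stop t).aemeasurable hm]
    filter_upwards [h] with ω hω
    rw [X_stop zero_le, hω]
  rw [← map_stop_glueLaw (Q := Q), ae_map_iff (measurable_stop t).aemeasurable hm] at h1
  filter_upwards [h1] with ω hω
  rwa [X_stop zero_le] at hω

end Gluing

/-! ### Borel dependence on parameters, and codes for controls. -/

section BorelParametrization

open Filter Topology

variable {d : ℕ} {F : Type*} {b : F × E d → E d} {a : E d → Matrix (Fin d) (Fin d) ℝ} {K : ℝ≥0}

section Kernels

variable {Y : Type*} [MeasurableSpace Y] {κ : Kernel Y (PathSpace d)} [IsMarkovKernel κ]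
  {B : Y → ℝ≥0 → PathSpace d → E d}

theorem measurable_setIntegral_kernel {f : Y × PathSpace d → ℝ} (hf : Measurable f)
    {A : Set (PathSpace d)} (hA : MeasurableSet A) :
    Measurable fun z => ∫ ω in A, f (z, ω) ∂(κ z) := by
  have h : Measurable ((univ ×ˢ A).indicator f) := hf.indicator (MeasurableSet.univ.prod hA)
  have h1 : (fun z => ∫ ω in A, f (z, ω) ∂(κ z)) =
      fun z => ∫ ω, (univ ×ˢ A).indicator f (z, ω) ∂(κ z) := by
    ext z
    rw [← integral_indicator hA]
    refine integral_congr_ae (ae_of_all _ fun ω => ?_)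
    by_cases hω : ω ∈ A <;> simp [hω]
  rw [h1]
  exact (h.stronglyMeasurable.integral_kernel_prod_right' (κ := κ)).measurable

theorem measurableSet_incrementProblem (ha : BoundedMatrixField K a)
    (hB : Measurable fun p : Y × ℝ≥0 × PathSpace d => B p.1 p.2.1 p.2.2) {s r : ℝ≥0}
    (hsr : s ≤ r) : MeasurableSet {z | IncrementProblem a (B z) (κ z) s r} := by
  have hm : ∀ i, Measurable fun p : Y × PathSpace d => incr (B p.1) i s r p.2 := fun i =>
    measurable_incr_param hB i s r
  have hs : ∀ k, MeasurableSet (stopAt (d := d) s ⁻¹' pathSets d k) := fun k =>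
    measurable_stop s (measurableSet_pathSets k)
  simp only [incrementProblem_iff ha hsr, ofPred_and, ofPred_forall]
  refine MeasurableSet.inter (MeasurableSet.iInter fun i => ?_) (MeasurableSet.inter
    (MeasurableSet.iInter fun i => MeasurableSet.iInter fun k => ?_)
    (MeasurableSet.iInter fun i => MeasurableSet.iInter fun j => MeasurableSet.iInter fun k => ?_))
  · have h1 : ∀ z, MemLp (incr (B z) i s r) 2 (κ z) ↔
        ∫⁻ ω, ‖incr (B z) i s r ω‖ₑ ^ (2 : ℝ) ∂(κ z) < ⊤ := by
      intro z
      have h2 : AEStronglyMeasurable (incr (B z) i s r) (κ z) :=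
        ((hm i).comp measurable_prodMk_left).aestronglyMeasurable
      rw [MemLp, and_iff_right h2,
        eLpNorm_lt_top_iff_lintegral_rpow_enorm_lt_top (by norm_num) (by norm_num)]
      norm_num
    simp only [h1]
    have h3 : Measurable fun z => ∫⁻ ω, ‖incr (B z) i s r ω‖ₑ ^ (2 : ℝ) ∂(κ z) :=
      Measurable.lintegral_kernel_prod_right' (f := fun p : Y × PathSpace d =>
        ‖incr (B p.1) i s r p.2‖ₑ ^ (2 : ℝ)) ((hm i).enorm.pow_const _)
    exact measurableSet_lt h3 measurable_const
  · exact measurable_setIntegral_kernel (hm i) (hs k) (measurableSet_singleton 0)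
  · exact measurable_setIntegral_kernel (f := fun p => incr (B p.1) i s r p.2 *
      incr (B p.1) j s r p.2 - covInt a i j s r p.2) (((hm i).mul (hm j)).sub
      ((measurable_covInt ha i j s r).comp measurable_snd)) (hs k) (measurableSet_singleton 0)

theorem martingaleProblem_iff_denseSeq (ha : BoundedMatrixField K a)
    {β : ℝ≥0 → PathSpace d → E d} (hβ : Nonanticipating K β) {P : Measure (PathSpace d)}
    [IsProbabilityMeasure P] : MartingaleProblem a β P ↔
      ∀ m n, TopologicalSpace.denseSeq ℝ≥0 m ≤ TopologicalSpace.denseSeq ℝ≥0 n →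
        IncrementProblem a β P (TopologicalSpace.denseSeq ℝ≥0 m)
          (TopologicalSpace.denseSeq ℝ≥0 n) := by
  refine ⟨fun h m n hmn => h _ _ hmn, fun h => ?_⟩
  refine martingaleProblem_of_dense ha hβ (TopologicalSpace.denseRange_denseSeq ℝ≥0) ?_
  rintro _ ⟨m, rfl⟩ _ ⟨n, rfl⟩ hmn
  exact h m n hmn

/-- A countable intersection over dense times, coordinates and test events of conditions on kernel
integrals, together with one almost sure condition. -/
theorem measurableSet_isControlledLaw (ha : BoundedMatrixField K a)
    (hV : MeasurableSet (driftSet b))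
    (hB : Measurable fun p : Y × ℝ≥0 × PathSpace d => B p.1 p.2.1 p.2.2)
    (hBn : ∀ z, Nonanticipating K (B z)) :
    MeasurableSet {z | IsControlledLaw b a K (B z) (κ z)} := by
  have h : ∀ z, IsControlledLaw b a K (B z) (κ z) ↔
      (∀ m n, TopologicalSpace.denseSeq ℝ≥0 m ≤ TopologicalSpace.denseSeq ℝ≥0 n →
        IncrementProblem a (B z) (κ z) (TopologicalSpace.denseSeq ℝ≥0 m)
          (TopologicalSpace.denseSeq ℝ≥0 n)) ∧
      ∀ᵐ ω ∂(κ z), ∀ᵐ s ∂lebesgue, (X s ω, B z s ω) ∈ driftSet b := fun z =>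
    ⟨fun h => ⟨(martingaleProblem_iff_denseSeq ha (hBn z)).1 h.martingaleProblem, h.drift⟩,
      fun h => ⟨hBn z, (martingaleProblem_iff_denseSeq ha (hBn z)).2 h.1, h.2⟩⟩
  simp only [h, ofPred_and, ofPred_forall]
  refine MeasurableSet.inter (MeasurableSet.iInter fun m => MeasurableSet.iInter fun n =>
    MeasurableSet.iInter fun hmn => measurableSet_incrementProblem ha hB hmn) ?_
  exact Kernel.measurable_kernel_prodMk_left (κ := κ) (measurableSet_drift hV hB).compl
    (measurableSet_singleton 0)

theorem measurableSet_ae_X_zero {y : Y → E d} (hy : Measurable y) :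
    MeasurableSet {z | ∀ᵐ ω ∂(κ z), X 0 ω = y z} := by
  have h : MeasurableSet {p : Y × PathSpace d | X 0 p.2 = y p.1} :=
    measurableSet_eq_fun ((continuous_X 0).measurable.comp measurable_snd)
      (hy.comp measurable_fst)
  exact Kernel.measurable_kernel_prodMk_left (κ := κ) h.compl (measurableSet_singleton 0)

end Kernels

/-- The codes of bounded controls. -/
abbrev Code : Type := ℕ → ℕ → ℕ

/-- Coordinatewise truncation. -/
def clamp (K : ℝ≥0) (v : E d) : E d := WithLp.toLp 2 fun i => max (-K) (min K (v i))

theorem measurable_clamp (K : ℝ≥0) : Measurable (clamp (d := d) K) := by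
  refine (PiLp.continuous_toLp 2 _).measurable.comp (measurable_pi_iff.2 fun i => ?_)
  exact measurable_const.max (measurable_const.min (measurable_coord i))

theorem abs_clamp_le (K : ℝ≥0) (v : E d) (i : Fin d) : |clamp K v i| ≤ K := by
  simp only [clamp, abs_le]
  exact ⟨le_max_left _ _, max_le (by linarith [K.2]) (min_le_left _ _)⟩

theorem clamp_eq {v : E d} (h : ∀ i, |v i| ≤ K) : clamp K v = v := by
  ext i
  simp only [clamp]
  rw [min_eq_right (abs_le.1 (h i)).2, max_eq_right (abs_le.1 (h i)).1]

/-- A jointly measurable enumeration of all nonanticipating controls. -/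
def codedControl (K : ℝ≥0) (σ : Code) (s : ℝ≥0) (ω : PathSpace d) : E d :=
  clamp K ((exists_universal_measurable (ℝ≥0 × PathSpace d) (E d)).choose σ (s, stopAt s ω))

theorem measurable_stop_uncurry :
    Measurable fun p : ℝ≥0 × PathSpace d => stopAt p.1 p.2 := continuous_stop.measurable

theorem measurable_codedControl (K : ℝ≥0) :
    Measurable fun p : Code × ℝ≥0 × PathSpace d => codedControl K p.1 p.2.1 p.2.2 := by
  have h := (exists_universal_measurable (ℝ≥0 × PathSpace d) (E d)).choose_spec.1
  exact (measurable_clamp K).comp (h.comp (measurable_fst.prodMk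
    ((measurable_fst.comp measurable_snd).prodMk (measurable_stop_uncurry.comp measurable_snd))))

theorem nonanticipating_codedControl (K : ℝ≥0) (σ : Code) :
    Nonanticipating K (codedControl (d := d) K σ) where
  measurable := (measurable_codedControl K).comp measurable_prodMk_left
  stop_eq s ω := by simp only [codedControl, stop_stop, min_self]
  bound s ω i := abs_clamp_le K _ i

theorem Nonanticipating.exists_code {β : ℝ≥0 → PathSpace d → E d} (hβ : Nonanticipating K β)
    (P : Measure (PathSpace d)) [IsFiniteMeasure P] :
    ∃ σ, ∀ᵐ ω ∂P, ∀ᵐ s ∂lebesgue, β s ω = codedControl K σ s ω := by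
  have hm : Measurable fun p : ℝ≥0 × PathSpace d => (p.1, stopAt p.1 p.2) :=
    measurable_fst.prodMk measurable_stop_uncurry
  -- Parametrization is available for finite measures; `toFinite` has the null sets of `λ ⊗ P`. The
  -- image under stopping is used because the coded control is evaluated at the stopped path.
  obtain ⟨σ, hσ⟩ := (exists_universal_measurable (ℝ≥0 × PathSpace d) (E d)).choose_spec.2
    ((lebesgue.prod P).toFinite.map fun p => (p.1, stopAt p.1 p.2)) (Function.uncurry β) hβ.measurable
  refine ⟨σ, ?_⟩
  have h1 := ae_of_ae_map hm.aemeasurable hσ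
  rw [ae_toFinite] at h1
  have h2 : ∀ᵐ p ∂(lebesgue.prod P), β p.1 p.2 = codedControl K σ p.1 p.2 := by
    filter_upwards [h1] with p hp
    rw [codedControl, hp]
    simp only [Function.uncurry]
    rw [hβ.stop_eq, clamp_eq (hβ.bound _ _)]
  exact Measure.ae_ae_of_ae_prod (Measure.measurePreserving_swap.quasiMeasurePreserving.ae h2)

end BorelParametrization

/-! ### Extended integrals and approximation from below. -/

section ExtendedIntegral

open Filter Topology

variable {α : Type*} [MeasurableSpace α]

/-- The extended integral `∫ f⁺ - ∫ f⁻` with the convention `∞ - ∞ = -∞`. -/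
def extIntegral (μ : Measure α) (f : α → EReal) : EReal :=
  ((∫⁻ x, (f x).toENNReal ∂μ : ℝ≥0∞) : EReal) - ((∫⁻ x, (-f x).toENNReal ∂μ : ℝ≥0∞) : EReal)

theorem ofReal_sub_le_of_lt {x : EReal} (hx : (-x).toENNReal ≠ ⊤) (c : ℝ≥0) {ε : ℝ} (hε : 0 < ε) :
    (((min x.toENNReal c).toReal - (-x).toENNReal.toReal - ε : ℝ) : EReal) < x := by
  induction x with
  | bot => simp at hx
  | top => exact EReal.coe_lt_top _
  | coe r =>
    rw [EReal.coe_lt_coe_iff, ← EReal.coe_neg, EReal.real_coe_toENNReal, EReal.real_coe_toENNReal]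
    have h1 : (min (ENNReal.ofReal r) c).toReal ≤ (ENNReal.ofReal r).toReal :=
      ENNReal.toReal_mono ENNReal.ofReal_ne_top (min_le_left _ _)
    rw [ENNReal.toReal_ofReal'] at h1 ⊢
    rcases le_total r 0 with h | h
    · rw [max_eq_right h] at h1
      rw [max_eq_left (by linarith)]
      linarith
    · rw [max_eq_left h] at h1
      rw [max_eq_right (by linarith)]
      linarith

variable {μ : Measure α}

theorem integral_le_extIntegral {f : α → EReal} {g : α → ℝ} (hg : Integrable g μ)
    (hgf : ∀ᵐ x ∂μ, (g x : EReal) ≤ f x) : ((∫ x, g x ∂μ : ℝ) : EReal) ≤ extIntegral μ f := by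
  have h1 : ∫⁻ x, ENNReal.ofReal (g x) ∂μ ≤ ∫⁻ x, (f x).toENNReal ∂μ := by
    refine lintegral_mono_ae ?_
    filter_upwards [hgf] with x hx
    simpa using EReal.toENNReal_le_toENNReal hx
  have h2 : ∫⁻ x, (-f x).toENNReal ∂μ ≤ ∫⁻ x, ENNReal.ofReal (-g x) ∂μ := by
    refine lintegral_mono_ae ?_
    filter_upwards [hgf] with x hx
    have := EReal.toENNReal_le_toENNReal (EReal.neg_le_neg_iff.2 hx)
    rwa [← EReal.coe_neg, EReal.real_coe_toENNReal] at this
  have hp : ∫⁻ x, ENNReal.ofReal (g x) ∂μ ≠ ⊤ := hg.lintegral_lt_top.ne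
  have hn : ∫⁻ x, ENNReal.ofReal (-g x) ∂μ ≠ ⊤ := hg.neg.lintegral_lt_top.ne
  rw [integral_eq_lintegral_pos_part_sub_lintegral_neg_part hg, EReal.coe_sub,
    EReal.coe_ennreal_toReal hp, EReal.coe_ennreal_toReal hn]
  exact EReal.sub_le_sub (EReal.coe_ennreal_le_coe_ennreal_iff.2 h1)
    (EReal.coe_ennreal_le_coe_ennreal_iff.2 h2)

/-- The convention `∞ - ∞ = -∞` makes the negative part integrable. Truncating the positive part at
a high level keeps the integral above `c` by monotone convergence, and subtracting half of the slack
makes the pointwise inequality strict. -/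
theorem exists_integrable_lt_of_lt_extIntegral [IsProbabilityMeasure μ] {f : α → EReal}
    (hf : AEMeasurable f μ) {c : ℝ} (hc : (c : EReal) < extIntegral μ f) :
    ∃ g : α → ℝ, Measurable g ∧ Integrable g μ ∧ (∀ᵐ x ∂μ, (g x : EReal) < f x) ∧
      c < ∫ x, g x ∂μ := by
  set u : α → ℝ≥0∞ := fun x => (hf.mk f x).toENNReal
  set v : α → ℝ≥0∞ := fun x => (-hf.mk f x).toENNReal
  have hu : Measurable u := hf.measurable_mk.ereal_toENNReal
  have hv : Measurable v := hf.measurable_mk.neg.ereal_toENNReal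
  have hfu : ∫⁻ x, (f x).toENNReal ∂μ = ∫⁻ x, u x ∂μ :=
    lintegral_congr_ae (hf.ae_eq_mk.mono fun x hx => by simp only [u, ← hx])
  have hfv : ∫⁻ x, (-f x).toENNReal ∂μ = ∫⁻ x, v x ∂μ :=
    lintegral_congr_ae (hf.ae_eq_mk.mono fun x hx => by simp only [v, ← hx])
  rw [extIntegral, hfu, hfv] at hc
  have hvt : ∫⁻ x, v x ∂μ ≠ ⊤ := by
    intro h
    rw [h] at hc
    simp at hc
  have hvi : Integrable (fun x => (v x).toReal) μ := integrable_toReal_of_lintegral_ne_top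
    hv.aemeasurable hvt
  have hvr : ∫ x, (v x).toReal ∂μ = (∫⁻ x, v x ∂μ).toReal :=
    integral_toReal hv.aemeasurable (ae_lt_top hv hvt)
  set N : ℝ := (∫⁻ x, v x ∂μ).toReal with hN
  have hcN : ((c + N : ℝ) : EReal) < ((∫⁻ x, u x ∂μ : ℝ≥0∞) : EReal) := by
    rw [← EReal.coe_ennreal_toReal hvt, ← hN] at hc
    rw [EReal.coe_add]
    exact (EReal.lt_sub_iff_add_lt (Or.inl (EReal.coe_ne_bot _)) (Or.inl (EReal.coe_ne_top _))).1 hc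
  have hun : Tendsto (fun n : ℕ => ∫⁻ x, min (u x) (n : ℝ≥0) ∂μ) atTop (𝓝 (∫⁻ x, u x ∂μ)) := by
    refine lintegral_tendsto_of_tendsto_of_monotone
      (fun n => (hu.min measurable_const).aemeasurable) (ae_of_all _ fun x m n hmn => ?_)
      (ae_of_all _ fun x => ?_)
    · exact min_le_min_left _ (by exact_mod_cast hmn)
    · have h1 : Tendsto (fun n : ℕ => ((n : ℝ≥0) : ℝ≥0∞)) atTop (𝓝 ⊤) := by
        simpa using ENNReal.tendsto_nat_nhds_top
      simpa using (tendsto_const_nhds (x := u x)).min h1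
  obtain ⟨n, hn⟩ : ∃ n : ℕ, ((c + N : ℝ) : EReal) < ((∫⁻ x, min (u x) (n : ℝ≥0) ∂μ : ℝ≥0∞) : EReal) :=
    (((continuous_coe_ennreal_ereal.tendsto _).comp hun).eventually (lt_mem_nhds hcN)).exists
  have hmm : Measurable fun x => min (u x) ((n : ℝ≥0) : ℝ≥0∞) := hu.min measurable_const
  have hmt : ∫⁻ x, min (u x) ((n : ℝ≥0) : ℝ≥0∞) ∂μ ≠ ⊤ := by
    refine ((lintegral_mono fun x => min_le_right (u x) ((n : ℝ≥0) : ℝ≥0∞)).trans_lt ?_).ne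
    simp
  have hmi : Integrable (fun x => (min (u x) ((n : ℝ≥0) : ℝ≥0∞)).toReal) μ :=
    integrable_toReal_of_lintegral_ne_top hmm.aemeasurable hmt
  have hmr : ∫ x, (min (u x) ((n : ℝ≥0) : ℝ≥0∞)).toReal ∂μ =
      (∫⁻ x, min (u x) ((n : ℝ≥0) : ℝ≥0∞) ∂μ).toReal :=
    integral_toReal hmm.aemeasurable (ae_lt_top hmm hmt)
  rw [← EReal.coe_ennreal_toReal hmt, EReal.coe_lt_coe_iff, ← hmr] at hn
  set I : ℝ := ∫ x, (min (u x) ((n : ℝ≥0) : ℝ≥0∞)).toReal ∂μ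
  have hε : 0 < (I - (c + N)) / 2 := by linarith
  refine ⟨fun x => (min (u x) ((n : ℝ≥0) : ℝ≥0∞)).toReal - (v x).toReal - (I - (c + N)) / 2,
    (hmm.ennreal_toReal.sub hv.ennreal_toReal).sub_const _,
    (hmi.sub hvi).sub (integrable_const _), ?_, ?_⟩
  · filter_upwards [hf.ae_eq_mk, ae_lt_top hv hvt] with x hx hvx
    rw [hx]
    exact ofReal_sub_le_of_lt hvx.ne n hε
  · have h1 : ∫ x, ((min (u x) ((n : ℝ≥0) : ℝ≥0∞)).toReal - (v x).toReal - (I - (c + N)) / 2) ∂μ =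
        I - N - (I - (c + N)) / 2 := by
      have h2 : Integrable (fun x => (min (u x) ((n : ℝ≥0) : ℝ≥0∞)).toReal - (v x).toReal) μ :=
        hmi.sub hvi
      rw [integral_sub h2 (integrable_const _), integral_sub hmi hvi, hvr]
      simp [I]
    rw [h1]
    linarith

end ExtendedIntegral

/-! ### Upper semianalytic functions and lifts to the Baire space. -/

section Semianalytic

variable {S : Type*} [TopologicalSpace S]

theorem UpperSemianalytic.nullMeasurable [T2Space S] [MeasurableSpace S] [BorelSpace S]
    {ψ : S → EReal} (hψ : UpperSemianalytic ψ) (μ : Measure S) [IsFiniteMeasure μ]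
    [μ.OuterRegular] : NullMeasurable ψ μ := by
  have h : ∀ c : EReal, MeasurableSet[NullMeasurableSpace.instMeasurableSpace (μ := μ)]
      (ψ ⁻¹' Ioi c) := by
    intro c
    change NullMeasurableSet (ψ ⁻¹' Ioi c) μ
    induction c with
    | bot =>
      have h1 : ψ ⁻¹' Ioi ⊥ = ⋃ n : ℕ, {s | ((-(n : ℝ) : ℝ) : EReal) < ψ s} := by
        ext s
        simp only [mem_preimage, mem_Ioi, mem_iUnion, Set.mem_ofPred_eq]
        constructor
        · intro hs
          obtain ⟨r, hr⟩ := EReal.lt_iff_exists_real_btwn.1 hs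
          obtain ⟨n, hn⟩ := exists_nat_gt (-r)
          exact ⟨n, lt_trans (EReal.coe_lt_coe_iff.2 (by linarith)) hr.2⟩
        · rintro ⟨n, hn⟩
          exact (EReal.bot_lt_coe _).trans hn
      rw [h1]
      exact NullMeasurableSet.iUnion fun n => analyticSet_nullMeasurableSet (hψ _) μ
    | top => simp
    | coe r => exact analyticSet_nullMeasurableSet (hψ r) μ
  exact measurable_of_Ioi (mδ := NullMeasurableSpace.instMeasurableSpace (μ := μ)) h

theorem UpperSemianalytic.aemeasurable [T2Space S] [MeasurableSpace S] [BorelSpace S]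
    {ψ : S → EReal} (hψ : UpperSemianalytic ψ) (μ : Measure S) [IsFiniteMeasure μ]
    [μ.OuterRegular] : AEMeasurable ψ μ := (hψ.nullMeasurable μ).aemeasurable

theorem UpperSemianalytic.comp [PolishSpace S] {T : Type*} [TopologicalSpace T] [PolishSpace T]
    {ψ : S → EReal} (hψ : UpperSemianalytic ψ) {f : T → S} (hf : Continuous f) :
    UpperSemianalytic (ψ ∘ f) := fun c => (hψ c).preimage hf

theorem UpperSemianalytic.analyticSet_subgraph [PolishSpace S] {ψ : S → EReal}
    (hψ : UpperSemianalytic ψ) : AnalyticSet {p : S × ℝ | (p.2 : EReal) < ψ p.1} := by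
  have h1 : {p : S × ℝ | (p.2 : EReal) < ψ p.1} =
      ⋃ q : ℚ, ({p : S × ℝ | p.2 < q} ∩ Prod.fst ⁻¹' {s | ((q : ℝ) : EReal) < ψ s}) := by
    ext p
    simp only [mem_iUnion, mem_inter_iff, mem_preimage, Set.mem_ofPred_eq]
    constructor
    · intro hp
      obtain ⟨q, hq1, hq2⟩ := EReal.lt_iff_exists_rat_btwn.1 hp
      exact ⟨q, EReal.coe_lt_coe_iff.1 hq1, hq2⟩
    · rintro ⟨q, hq1, hq2⟩
      exact (EReal.coe_lt_coe_iff.2 hq1).trans hq2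
  rw [h1]
  refine AnalyticSet.iUnion fun q => ?_
  have h2 : AnalyticSet {p : S × ℝ | p.2 < q} := by
    let _ : MeasurableSpace (S × ℝ) := borel _
    have _ : BorelSpace (S × ℝ) := ⟨rfl⟩
    exact (isOpen_lt continuous_snd continuous_const).measurableSet.analyticSet
  rw [inter_eq_iInter]
  refine AnalyticSet.iInter fun b => ?_
  cases b
  · exact (hψ q).preimage continuous_fst
  · exact h2

/-- A continuous parametrization of the strict subgraph of an upper semianalytic function. -/
theorem UpperSemianalytic.exists_parametrization [PolishSpace S] {ψ : S → EReal}
    (hψ : UpperSemianalytic ψ) {s₀ : S} (h₀ : ψ s₀ ≠ ⊥) :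
    ∃ (h₁ : (ℕ → ℕ) → S) (h₂ : (ℕ → ℕ) → ℝ), Continuous h₁ ∧ Continuous h₂ ∧
      ∀ s (r : ℝ), (r : EReal) < ψ s ↔ ∃ z, h₁ z = s ∧ h₂ z = r := by
  have h := hψ.analyticSet_subgraph
  rw [AnalyticSet] at h
  rcases h with h | ⟨f, hf, hfr⟩
  · exfalso
    obtain ⟨r, -, hr⟩ := EReal.lt_iff_exists_real_btwn.1 (bot_lt_iff_ne_bot.2 h₀)
    have : (s₀, r) ∈ {p : S × ℝ | (p.2 : EReal) < ψ p.1} := hr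
    rw [h] at this
    exact this
  · refine ⟨fun z => (f z).1, fun z => (f z).2, hf.fst, hf.snd, fun s r => ?_⟩
    have h1 : (r : EReal) < ψ s ↔ (s, r) ∈ range f := by
      rw [hfr]
      rfl
    rw [h1]
    simp only [mem_range, Prod.ext_iff]

variable [PolishSpace S] [MeasurableSpace S] [BorelSpace S]

/-- Replaces an integral of a semianalytic function by conditions on a lift that involve only
continuous functions. Given `c < E^P[ψ]`, an integrable `g` strictly below `ψ` is lifted by
selecting `z` with `h₁ z = ω` and `h₂ z = g ω`. Conversely `h₂ < ψ ∘ h₁` everywhere. -/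
theorem lt_extIntegral_iff {ψ : S → EReal} (hψ : UpperSemianalytic ψ) {h₁ : (ℕ → ℕ) → S}
    {h₂ : (ℕ → ℕ) → ℝ} (hc₁ : Continuous h₁) (hc₂ : Continuous h₂)
    (hh : ∀ s (r : ℝ), (r : EReal) < ψ s ↔ ∃ z, h₁ z = s ∧ h₂ z = r) {P : Measure S}
    [IsProbabilityMeasure P] {c : ℝ} :
    (c : EReal) < extIntegral P ψ ↔ ∃ m : Measure (ℕ → ℕ), IsProbabilityMeasure m ∧
      m.map h₁ = P ∧ Integrable h₂ m ∧ c < ∫ z, h₂ z ∂m := by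
  have hψm := hψ.aemeasurable P
  constructor
  · intro hc
    obtain ⟨g, hgm, hgi, hgψ, hgc⟩ := exists_integrable_lt_of_lt_extIntegral hψm hc
    have hA : MeasurableSet {p : S × (ℕ → ℕ) | h₁ p.2 = p.1 ∧ h₂ p.2 = g p.1} :=
      (measurableSet_eq_fun (hc₁.measurable.comp measurable_snd) measurable_fst).inter
        (measurableSet_eq_fun (hc₂.measurable.comp measurable_snd) (hgm.comp measurable_fst))
    obtain ⟨sel, hsel, hs⟩ := AnalyticSet.exists_measurable_selection hA.analyticSet P
    have hs' : ∀ᵐ ω ∂P, h₁ (sel ω) = ω ∧ h₂ (sel ω) = g ω := by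
      filter_upwards [hs, hgψ] with ω e1 e2
      obtain ⟨z, hz⟩ := (hh ω (g ω)).1 e2
      exact e1 ⟨(ω, z), hz, rfl⟩
    have h2 : (h₂ ∘ sel) =ᵐ[P] g := hs'.mono fun ω hω => hω.2
    refine ⟨P.map sel, Measure.isProbabilityMeasure_map hsel.aemeasurable, ?_, ?_, ?_⟩
    · rw [Measure.map_map hc₁.measurable hsel]
      exact (Measure.map_congr (hs'.mono fun ω hω => hω.1)).trans Measure.map_id
    · rw [integrable_map_measure hc₂.aestronglyMeasurable hsel.aemeasurable]
      exact hgi.congr h2.symm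
    · rw [integral_map hsel.aemeasurable hc₂.aestronglyMeasurable]
      rwa [integral_congr_ae (f := fun x => h₂ (sel x)) h2]
  · rintro ⟨m, hm, rfl, hi, hc⟩
    refine (EReal.coe_lt_coe_iff.2 hc).trans_le ?_
    have h1 : extIntegral (m.map h₁) ψ = extIntegral m (ψ ∘ h₁) := by
      have hn : AEMeasurable (fun s => (-ψ s).toENNReal) (m.map h₁) := hψm.neg.ereal_toENNReal
      unfold extIntegral
      rw [lintegral_map' hψm.ereal_toENNReal hc₁.measurable.aemeasurable,
        lintegral_map' hn hc₁.measurable.aemeasurable]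
      rfl
    rw [h1]
    exact integral_le_extIntegral hi (ae_of_all _ fun z => ((hh (h₁ z) (h₂ z)).2 ⟨z, rfl, rfl⟩).le)

end Semianalytic

/-! ### Extended integrals of mixtures. -/

section Mixtures

variable {α Ω : Type*} [MeasurableSpace α] [MeasurableSpace Ω]

theorem coe_sub_le_coe_sub {x y z w : ℝ≥0∞} (hy : y ≠ ⊤) (hw : w ≠ ⊤) (h : x + w ≤ z + y) :
    (x : EReal) - y ≤ (z : EReal) - w := by
  lift y to ℝ≥0 using hy
  lift w to ℝ≥0 using hw
  rcases eq_or_ne z ⊤ with rfl | hz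
  · have h1 : ((⊤ : ℝ≥0∞) : EReal) - ((w : ℝ≥0∞) : EReal) = ⊤ := by
      rw [EReal.coe_ennreal_top]
      exact EReal.top_sub (by simp)
    rw [h1]
    exact le_top
  · have hx : x ≠ ⊤ := by
      rintro rfl
      rw [top_add, top_le_iff, ENNReal.add_eq_top] at h
      rcases h with h | h
      · exact hz h
      · exact ENNReal.coe_ne_top h
    lift z to ℝ≥0 using hz
    lift x to ℝ≥0 using hx
    have h1 : (x : ℝ) + w ≤ z + y := by exact_mod_cast h
    change ((x : ℝ) : EReal) - ((y : ℝ) : EReal) ≤ ((z : ℝ) : EReal) - ((w : ℝ) : EReal)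
    rw [← EReal.coe_sub, ← EReal.coe_sub, EReal.coe_le_coe_iff]
    linarith

theorem neg_toENNReal_le_of_sub_le {p n : ℝ≥0∞} {G : EReal}
    (h : (p : EReal) - n ≤ G) : (-G).toENNReal ≤ n := by
  have h1 : -(n : EReal) ≤ G := by
    refine le_trans ?_ h
    rw [sub_eq_add_neg]
    exact le_add_of_nonneg_left (EReal.coe_ennreal_nonneg p)
  have h2 := EReal.toENNReal_le_toENNReal (EReal.neg_le.1 h1)
  simpa using h2

/-- The additive form can be integrated termwise in `ℝ≥0∞`, where no undefined differences arise. -/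
theorem add_neg_toENNReal_le_of_sub_le {p n : ℝ≥0∞} (hn : n ≠ ⊤) {G : EReal}
    (h : (p : EReal) - n ≤ G) : p + (-G).toENNReal ≤ G.toENNReal + n := by
  lift n to ℝ≥0 using hn
  induction G with
  | top => simp
  | bot =>
    have h2 := neg_toENNReal_le_of_sub_le h
    simp at h2
  | coe r =>
    have hp : p ≠ ⊤ := by
      rintro rfl
      rw [EReal.coe_ennreal_top, EReal.top_sub (by simp), top_le_iff] at h
      exact EReal.coe_ne_top r h
    lift p to ℝ≥0 using hp
    have h1 : ((p : ℝ) : EReal) - ((n : ℝ) : EReal) ≤ (r : EReal) := h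
    rw [← EReal.coe_sub, EReal.coe_le_coe_iff] at h1
    rw [← EReal.coe_neg, EReal.real_coe_toENNReal, EReal.real_coe_toENNReal, ENNReal.ofReal,
      ENNReal.ofReal, ← ENNReal.coe_add, ← ENNReal.coe_add, ENNReal.coe_le_coe,
      ← NNReal.coe_le_coe]
    push_cast
    rw [Real.coe_toNNReal', Real.coe_toNNReal']
    rcases le_total r 0 with h0 | h0
    · rw [max_eq_left (by linarith), max_eq_right h0]
      linarith
    · rw [max_eq_right (by linarith), max_eq_left h0]
      linarith

theorem ofReal_add_le_of_le_sub {p n : ℝ≥0∞} {r : ℝ} (h : (r : EReal) ≤ (p : EReal) - n) :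
    ENNReal.ofReal r + n ≤ p + ENNReal.ofReal (-r) := by
  have hn : n ≠ ⊤ := by
    rintro rfl
    rw [EReal.coe_ennreal_top, EReal.sub_top, le_bot_iff] at h
    exact EReal.coe_ne_bot r h
  rcases eq_or_ne p ⊤ with rfl | hp
  · simp
  lift n to ℝ≥0 using hn
  lift p to ℝ≥0 using hp
  have h1 : (r : EReal) ≤ ((p : ℝ) : EReal) - ((n : ℝ) : EReal) := h
  rw [← EReal.coe_sub, EReal.coe_le_coe_iff] at h1
  rw [ENNReal.ofReal, ENNReal.ofReal, ← ENNReal.coe_add, ← ENNReal.coe_add, ENNReal.coe_le_coe,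
    ← NNReal.coe_le_coe]
  push_cast
  rw [Real.coe_toNNReal', Real.coe_toNNReal']
  rcases le_total r 0 with h0 | h0
  · rw [max_eq_left (by linarith : 0 ≤ -r), max_eq_right h0]
    linarith
  · rw [max_eq_right (by linarith : -r ≤ 0), max_eq_left h0]
    linarith

theorem extIntegral_map {μ : Measure α} {f : α → Ω} (hf : Measurable f) {ψ : Ω → EReal}
    (hψ : AEMeasurable ψ (μ.map f)) : extIntegral (μ.map f) ψ = extIntegral μ (ψ ∘ f) := by
  have hn : AEMeasurable (fun s => (-ψ s).toENNReal) (μ.map f) := hψ.neg.ereal_toENNReal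
  unfold extIntegral
  rw [lintegral_map' hψ.ereal_toENNReal hf.aemeasurable, lintegral_map' hn hf.aemeasurable]
  rfl

variable {μ : Measure α} {Q : Kernel α Ω} {ψ : Ω → EReal}

/-- If the mixture has infinite negative part, the left side is `-∞`. Otherwise almost every inner
negative part is finite and dominates that of `G`, so the additive inequality can be integrated and
rearranged. -/
theorem extIntegral_bind_le (hψ : AEMeasurable ψ (μ.bind Q)) {G : α → EReal}
    (hG : AEMeasurable G μ) (h : ∀ᵐ y ∂μ, extIntegral (Q y) ψ ≤ G y) :
    extIntegral (μ.bind Q) ψ ≤ extIntegral μ G := by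
  have hp := Measure.lintegral_bind Q.measurable.aemeasurable hψ.ereal_toENNReal
  have hn : ∫⁻ ω, (-ψ ω).toENNReal ∂(μ.bind Q) = ∫⁻ y, ∫⁻ ω, (-ψ ω).toENNReal ∂(Q y) ∂μ :=
    Measure.lintegral_bind Q.measurable.aemeasurable hψ.neg.ereal_toENNReal
  have hnm : AEMeasurable (fun y => ∫⁻ ω, (-ψ ω).toENNReal ∂(Q y)) μ :=
    (Measure.aemeasurable_lintegral hψ.neg.ereal_toENNReal).comp_aemeasurable
      Q.measurable.aemeasurable
  rw [extIntegral, hp, hn]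
  by_cases hN : ∫⁻ y, ∫⁻ ω, (-ψ ω).toENNReal ∂(Q y) ∂μ = ⊤
  · rw [hN, EReal.coe_ennreal_top, EReal.sub_top]
    exact bot_le
  have hfin := ae_lt_top' hnm hN
  have hGn : AEMeasurable (fun y => (-G y).toENNReal) μ := hG.neg.ereal_toENNReal
  have h1 : ∫⁻ y, (-G y).toENNReal ∂μ ≤ ∫⁻ y, ∫⁻ ω, (-ψ ω).toENNReal ∂(Q y) ∂μ := by
    refine lintegral_mono_ae ?_
    filter_upwards [h] with y e1
    exact neg_toENNReal_le_of_sub_le e1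
  refine coe_sub_le_coe_sub hN (ne_top_of_le_ne_top hN h1) ?_
  rw [← lintegral_add_right' _ hGn, ← lintegral_add_left' hG.ereal_toENNReal]
  refine lintegral_mono_ae ?_
  filter_upwards [h, hfin] with y e1 e2
  exact add_neg_toENNReal_le_of_sub_le e2.ne e1

theorem integral_le_extIntegral_bind (hψ : AEMeasurable ψ (μ.bind Q)) {g : α → ℝ}
    (hg : Integrable g μ) (h : ∀ᵐ y ∂μ, (g y : EReal) ≤ extIntegral (Q y) ψ)
    (hex : ∫⁻ ω, (ψ ω).toENNReal ∂(μ.bind Q) ≠ ⊤ ∨ ∫⁻ ω, (-ψ ω).toENNReal ∂(μ.bind Q) ≠ ⊤) :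
    ((∫ y, g y ∂μ : ℝ) : EReal) ≤ extIntegral (μ.bind Q) ψ := by
  have hp := Measure.lintegral_bind Q.measurable.aemeasurable hψ.ereal_toENNReal
  have hn : ∫⁻ ω, (-ψ ω).toENNReal ∂(μ.bind Q) = ∫⁻ y, ∫⁻ ω, (-ψ ω).toENNReal ∂(Q y) ∂μ :=
    Measure.lintegral_bind Q.measurable.aemeasurable hψ.neg.ereal_toENNReal
  have hgp : ∫⁻ x, ENNReal.ofReal (g x) ∂μ ≠ ⊤ := hg.lintegral_lt_top.ne
  have hgn : ∫⁻ x, ENNReal.ofReal (-g x) ∂μ ≠ ⊤ := hg.neg.lintegral_lt_top.ne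
  have hgm : AEMeasurable (fun x => ENNReal.ofReal (-g x)) μ :=
    hg.1.aemeasurable.neg.ennreal_ofReal
  have key : ∫⁻ x, ENNReal.ofReal (g x) ∂μ + ∫⁻ ω, (-ψ ω).toENNReal ∂(μ.bind Q) ≤
      ∫⁻ ω, (ψ ω).toENNReal ∂(μ.bind Q) + ∫⁻ x, ENNReal.ofReal (-g x) ∂μ := by
    rw [hp, hn, ← lintegral_add_left' hg.1.aemeasurable.ennreal_ofReal,
      ← lintegral_add_right' _ hgm]
    refine lintegral_mono_ae ?_
    filter_upwards [h] with y hy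
    exact ofReal_add_le_of_le_sub hy
  -- Existence of the expectation enters here: if the positive part is finite, `key` bounds the
  -- negative part, so it is finite in either case.
  have hN : ∫⁻ ω, (-ψ ω).toENNReal ∂(μ.bind Q) ≠ ⊤ := by
    rcases hex with hex | hex
    · exact ne_top_of_le_ne_top (ENNReal.add_ne_top.2 ⟨hex, hgn⟩) (le_add_self.trans key)
    · exact hex
  rw [integral_eq_lintegral_pos_part_sub_lintegral_neg_part hg, EReal.coe_sub,
    EReal.coe_ennreal_toReal hgp, EReal.coe_ennreal_toReal hgn]
  exact coe_sub_le_coe_sub hgn hN key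

end Mixtures

/-! ### The value function as a projection of a Borel set of codes. -/

section SublinearExpectation

variable {d : ℕ} {F : Type*} {b : F × E d → E d} {a : E d → Matrix (Fin d) (Fin d) ℝ} {K : ℝ≥0}

/-- A kernel enumerating all laws on the Baire space. -/
def codedKernel : Kernel Code (ℕ → ℕ) := (exists_universal_kernel (ℕ → ℕ)).choose

instance : IsMarkovKernel codedKernel := (exists_universal_kernel (ℕ → ℕ)).choose_spec.1

theorem exists_codedKernel_eq (m : Measure (ℕ → ℕ)) [IsProbabilityMeasure m] :
    ∃ p, codedKernel p = m := (exists_universal_kernel (ℕ → ℕ)).choose_spec.2 m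

instance instSecondCountableTopologyCode : SecondCountableTopology Code := inferInstance

instance instBorelSpaceCodeProd : BorelSpace (Code × Code) := Prod.borelSpace

instance instPolishSpaceCodeProd : PolishSpace (Code × Code) := inferInstance

instance instPolishSpaceProdReal (d : ℕ) : PolishSpace (E d × ℝ) := inferInstance

instance instBorelSpaceProdCode (d : ℕ) : BorelSpace ((E d × ℝ) × (Code × Code)) :=
  Prod.borelSpace

/-- The points `((y, c), (σ, p))` such that `p` codes a law controlled by `σ`, started at `y`,
with value larger than `c`. -/
def controlGraph (b : F × E d → E d) (a : E d → Matrix (Fin d) (Fin d) ℝ) (K : ℝ≥0)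
    (h₁ : (ℕ → ℕ) → PathSpace d) (h₂ : (ℕ → ℕ) → ℝ) : Set ((E d × ℝ) × (Code × Code)) :=
  {q | (∀ᵐ ω ∂((codedKernel q.2.2).map h₁), X 0 ω = q.1.1) ∧
    IsControlledLaw b a K (codedControl K q.2.1) ((codedKernel q.2.2).map h₁) ∧
    Integrable h₂ (codedKernel q.2.2) ∧ q.1.2 < ∫ z, h₂ z ∂(codedKernel q.2.2)}

theorem measurableSet_controlGraph (ha : BoundedMatrixField K a) (hV : MeasurableSet (driftSet b))
    {h₁ : (ℕ → ℕ) → PathSpace d} {h₂ : (ℕ → ℕ) → ℝ} (hc₁ : Continuous h₁) (hc₂ : Continuous h₂) :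
    MeasurableSet (controlGraph b a K h₁ h₂) := by
  have hm : Measurable fun q : (E d × ℝ) × (Code × Code) => q.2.2 :=
    measurable_snd.comp measurable_snd
  let κ₀ : Kernel ((E d × ℝ) × (Code × Code)) (ℕ → ℕ) := codedKernel.comap _ hm
  let κ : Kernel ((E d × ℝ) × (Code × Code)) (PathSpace d) := κ₀.map h₁
  have hκ₀ : IsMarkovKernel κ₀ := inferInstanceAs (IsMarkovKernel (codedKernel.comap _ hm))
  have hκ : IsMarkovKernel κ := Kernel.IsMarkovKernel.map _ hc₁.measurable
  have hκ' : ∀ q, κ q = (codedKernel q.2.2).map h₁ := fun q =>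
    Kernel.map_apply _ hc₁.measurable q
  have h1 := measurableSet_ae_X_zero (κ := κ) (y := fun q => q.1.1)
    (measurable_fst.comp measurable_fst)
  have h2 := measurableSet_isControlledLaw (κ := κ) (B := fun q => codedControl K q.2.1) ha hV
    ((measurable_codedControl K).comp
      (f := fun p : ((E d × ℝ) × (Code × Code)) × ℝ≥0 × PathSpace d => (p.1.2.1, p.2))
      (by fun_prop)) (fun q => nonanticipating_codedControl K _)
  have h3 : MeasurableSet {q : (E d × ℝ) × (Code × Code) | Integrable h₂ (codedKernel q.2.2)} := by
    have e : ∀ q : (E d × ℝ) × (Code × Code), Integrable h₂ (codedKernel q.2.2) ↔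
        ∫⁻ z, ‖h₂ z‖ₑ ∂(codedKernel q.2.2) < ⊤ := fun q => by
      rw [Integrable, and_iff_right hc₂.aestronglyMeasurable, HasFiniteIntegral]
    simp only [e]
    exact measurableSet_lt ((hc₂.measurable.enorm.lintegral_kernel).comp hm) measurable_const
  have h4 : MeasurableSet {q : (E d × ℝ) × (Code × Code) |
      q.1.2 < ∫ z, h₂ z ∂(codedKernel q.2.2)} := by
    have e : Measurable fun p : Code => ∫ z, h₂ z ∂(codedKernel p) :=
      (StronglyMeasurable.integral_kernel_prod_right' (κ := codedKernel)
        (f := fun q : Code × (ℕ → ℕ) => h₂ q.2)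
        (hc₂.measurable.comp measurable_snd).stronglyMeasurable).measurable
    exact measurableSet_lt (measurable_snd.comp measurable_fst) (e.comp hm)
  simp only [hκ'] at h1 h2
  exact h1.inter (h2.inter (h3.inter h4))

variable {ψ : PathSpace d → EReal}

/-- A strict inequality for the supremum is witnessed by one law. Its lift to the Baire space has a
code, and its control may be replaced by a coded one that agrees almost everywhere. -/
theorem lt_sublinearExpectation_iff (ha : BoundedMatrixField K a)
    (hb : ∀ f x i, |b (f, x) i| ≤ K) (hV : MeasurableSet (driftSet b))
    (hψ : UpperSemianalytic ψ) {h₁ : (ℕ → ℕ) → PathSpace d} {h₂ : (ℕ → ℕ) → ℝ}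
    (hc₁ : Continuous h₁) (hc₂ : Continuous h₂)
    (hh : ∀ s (r : ℝ), (r : EReal) < ψ s ↔ ∃ z, h₁ z = s ∧ h₂ z = r) {y : E d} {c : ℝ} :
    (c : EReal) < sublinearExpectation b a y ψ ↔
      (y, c) ∈ Prod.fst '' controlGraph b a K h₁ h₂ := by
  simp only [sublinearExpectation, lt_iSup_iff]
  constructor
  · rintro ⟨P, hP, hc⟩
    obtain ⟨h0, β, hβ⟩ := (mem_R_iff ha hb hV).1 hP
    obtain ⟨m, hm, hmP, hi, hmc⟩ := (lt_extIntegral_iff hψ hc₁ hc₂ hh).1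
      (show (c : EReal) < extIntegral (P : Measure (PathSpace d)) ψ from hc)
    obtain ⟨p, rfl⟩ := exists_codedKernel_eq m
    obtain ⟨σ, hσ⟩ := hβ.nonanticipating.exists_code (P : Measure (PathSpace d))
    refine ⟨((y, c), (σ, p)), ⟨?_, ?_, hi, hmc⟩, rfl⟩
    · simp only [hmP]
      exact h0
    · simp only [hmP]
      exact hβ.congr hσ (nonanticipating_codedControl K σ)
  · rintro ⟨⟨⟨y', c'⟩, ⟨σ, p⟩⟩, ⟨h0, hβ, hi, hc⟩, hyc⟩
    obtain ⟨rfl, rfl⟩ := Prod.ext_iff.1 hyc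
    have hprob : IsProbabilityMeasure ((codedKernel p).map h₁) :=
      Measure.isProbabilityMeasure_map hc₁.measurable.aemeasurable
    refine ⟨⟨(codedKernel p).map h₁, hprob⟩, (mem_R_iff ha hb hV).2 ⟨h0, _, hβ⟩, ?_⟩
    exact show (c' : EReal) < extIntegral ((codedKernel p).map h₁) ψ from
      (lt_extIntegral_iff hψ hc₁ hc₂ hh).2 ⟨codedKernel p, inferInstance, rfl, hi, hc⟩

theorem extIntegral_bot {α : Type*} [MeasurableSpace α] (μ : Measure α) [IsProbabilityMeasure μ] :
    extIntegral μ (fun _ => ⊥) = ⊥ := by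
  simp [extIntegral]

theorem sublinearExpectation_bot (y : E d) (h : ∀ s, ψ s = ⊥) :
    sublinearExpectation b a y ψ = ⊥ := by
  obtain rfl : ψ = fun _ => ⊥ := funext h
  simp only [sublinearExpectation, iSup_eq_bot]
  exact fun P _ => extIntegral_bot (P : Measure (PathSpace d))

theorem upperSemianalytic_bot {S : Type*} [TopologicalSpace S] {f : S → EReal}
    (h : ∀ s, f s = ⊥) : UpperSemianalytic f := by
  intro c
  have : {s | (c : EReal) < f s} = ∅ := by
    ext s
    simp [h]
  rw [this]
  exact analyticSet_empty

theorem upperSemianalytic_sublinearExpectation (ha : BoundedMatrixField K a)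
    (hb : ∀ f x i, |b (f, x) i| ≤ K) (hV : MeasurableSet (driftSet b))
    (hψ : UpperSemianalytic ψ) : UpperSemianalytic fun y => sublinearExpectation b a y ψ := by
  -- If `ψ` is identically `-∞`, its strict subgraph is empty and is not the image of the Baire
  -- space.
  by_cases h : ∀ s, ψ s = ⊥
  · exact upperSemianalytic_bot fun y => sublinearExpectation_bot y h
  push Not at h
  obtain ⟨s₀, hs₀⟩ := h
  obtain ⟨h₁, h₂, hc₁, hc₂, hh⟩ := hψ.exists_parametrization hs₀
  intro c
  simp only [lt_sublinearExpectation_iff ha hb hV hψ hc₁ hc₂ hh]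
  have h1 : AnalyticSet (Prod.fst '' controlGraph b a K h₁ h₂) :=
    (measurableSet_controlGraph ha hV hc₁ hc₂).analyticSet.image_of_continuous continuous_fst
  exact h1.preimage (Continuous.prodMk_left c)

/-- Measurable selection of nearly optimal laws. -/
theorem exists_kernel_lt_extIntegral (ha : BoundedMatrixField K a)
    (hb : ∀ f x i, |b (f, x) i| ≤ K) (hV : MeasurableSet (driftSet b))
    (hψ : UpperSemianalytic ψ) {s₀ : PathSpace d} (hs₀ : ψ s₀ ≠ ⊥) {μ : Measure (E d)}
    [IsProbabilityMeasure μ] {g : E d → ℝ} (hg : Measurable g)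
    (hgψ : ∀ᵐ y ∂μ, (g y : EReal) < sublinearExpectation b a y ψ) :
    ∃ (Q : Kernel (E d) (PathSpace d)) (σ : E d → Code), IsMarkovKernel Q ∧ Measurable σ ∧
      ∀ᵐ y ∂μ, ((∀ᵐ ω ∂(Q y), X 0 ω = y) ∧ IsControlledLaw b a K (codedControl K (σ y)) (Q y)) ∧
        (g y : EReal) < extIntegral (Q y) ψ := by
  obtain ⟨h₁, h₂, hc₁, hc₂, hh⟩ := hψ.exists_parametrization hs₀
  have hyg : Measurable fun y : E d => (y, g y) := measurable_id.prodMk hg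
  obtain ⟨sel, hsel, hs⟩ := AnalyticSet.exists_measurable_selection
    (measurableSet_controlGraph (K := K) ha hV hc₁ hc₂).analyticSet (μ.map fun y => (y, g y))
  have hsel' : Measurable fun y : E d => sel (y, g y) := hsel.comp hyg
  refine ⟨(codedKernel.map h₁).comap (fun y => (sel (y, g y)).2) (measurable_snd.comp hsel'),
    fun y => (sel (y, g y)).1, ?_, measurable_fst.comp hsel', ?_⟩
  · have : IsMarkovKernel (codedKernel.map h₁) := Kernel.IsMarkovKernel.map _ hc₁.measurable
    infer_instance
  · filter_upwards [ae_of_ae_map hyg.aemeasurable hs, hgψ] with y e1 e2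
    obtain ⟨h0, hβ, hi, hc⟩ := e1 ((lt_sublinearExpectation_iff ha hb hV hψ hc₁ hc₂ hh).1 e2)
    rw [Kernel.comap_apply, Kernel.map_apply _ hc₁.measurable]
    have hprob : IsProbabilityMeasure ((codedKernel (sel (y, g y)).2).map h₁) :=
      Measure.isProbabilityMeasure_map hc₁.measurable.aemeasurable
    exact ⟨⟨h0, hβ⟩, (lt_extIntegral_iff hψ hc₁ hc₂ hh).2 ⟨_, inferInstance, rfl, hi, hc⟩⟩

end SublinearExpectation

/-! ### The two inequalities of the dynamic programming principle. -/

section DynamicProgramming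

variable {d : ℕ} {F : Type*} {b : F × E d → E d} {a : E d → Matrix (Fin d) (Fin d) ℝ} {K : ℝ≥0}
  {ψ : PathSpace d → EReal} {t : ℝ≥0} {x : E d}

/-- The conditional laws of the shifted path given the past are competitors in the inner supremum;
integrating their expectations over the past gives the bound. -/
theorem sublinearExpectation_shift_le (ha : BoundedMatrixField K a)
    (hb : ∀ f x i, |b (f, x) i| ≤ K) (hV : MeasurableSet (driftSet b))
    (hψ : UpperSemianalytic ψ) :
    sublinearExpectation b a x (ψ ∘ shift t) ≤
      sublinearExpectation b a x fun ω => sublinearExpectation b a (X t ω) ψ := by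
  refine iSup₂_le fun P hP => le_trans ?_ (le_iSup₂ P hP)
  obtain ⟨-, β, hβ⟩ := (mem_R_iff ha hb hV).1 hP
  set μ : Measure (PathSpace d) := (P : Measure (PathSpace d)) with hμ
  let κ : Kernel (PathSpace d) (PathSpace d) := condDistrib (shift t) (stopAt t) μ
  have hκ : μ.map (split t) = μ.map (stopAt t) ⊗ₘ κ :=
    (compProd_map_condDistrib (measurable_shift t).aemeasurable).symm
  have hmeas : Measurable (stopAt (d := d) t) := (continuous_stop_right t).measurable
  have hprob : IsProbabilityMeasure (μ.map (stopAt t)) :=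
    Measure.isProbabilityMeasure_map hmeas.aemeasurable
  have hbind : μ.map (shift t) = (μ.map (stopAt t)).bind κ := by
    rw [← Measure.snd_compProd, ← hκ, Measure.snd, Measure.map_map measurable_snd
      (measurable_split t)]
    rfl
  have hG : UpperSemianalytic fun ω => sublinearExpectation b a (X t ω) ψ :=
    (upperSemianalytic_sublinearExpectation ha hb hV hψ).comp (continuous_X t)
  have key : extIntegral ((μ.map (stopAt t)).bind κ) ψ ≤
      extIntegral (μ.map (stopAt t)) fun ω => sublinearExpectation b a (X t ω) ψ := by
    refine extIntegral_bind_le (hψ.aemeasurable _) (hG.aemeasurable _) ?_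
    filter_upwards [hβ.ae_tail ha hV hκ] with η hη
    exact le_iSup₂ (f := fun (P : ProbabilityMeasure (PathSpace d)) (_ : P ∈ R b a (X t η)) =>
      expectation P ψ) ⟨κ η, inferInstance⟩ ((mem_R_iff ha hb hV).2 ⟨hη.1, _, hη.2⟩)
  rw [← hbind, extIntegral_map (measurable_shift t) (hψ.aemeasurable _),
    extIntegral_map hmeas (hG.aemeasurable _)] at key
  simp only [Function.comp_def, X_stop le_rfl] at key
  exact key

theorem map_shift_glueLaw {P : Measure (PathSpace d)} [IsProbabilityMeasure P]
    {Q : Kernel (E d) (PathSpace d)} [IsMarkovKernel Q]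
    (hQ : ∀ᵐ y ∂(P.map (X t)), ∀ᵐ ω ∂(Q y), X 0 ω = y) :
    (glueLaw t P Q).map (shift t) = (P.map (X t)).bind Q := by
  refine Measure.ext_of_lintegral _ fun f hf => ?_
  rw [lintegral_map hf (measurable_shift t), lintegral_shift_glueLaw hQ hf,
    Measure.lintegral_bind Q.measurable.aemeasurable hf.aemeasurable]

/-- An integrable `g` strictly below the value function, with integral above `c`, leaves room to
select laws measurably with expectation above `g`. Glued to `P` at time `t`, they form a competitor
on the right with value above `c`. -/
theorem sublinearExpectation_le_shift (ha : BoundedMatrixField K a)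
    (hb : ∀ f x i, |b (f, x) i| ≤ K) (hV : MeasurableSet (driftSet b))
    (hψ : UpperSemianalytic ψ) (hex : ∀ P ∈ R b a x, ExpectationExists P (ψ ∘ shift t)) :
    (sublinearExpectation b a x fun ω => sublinearExpectation b a (X t ω) ψ) ≤
      sublinearExpectation b a x (ψ ∘ shift t) := by
  by_cases hbot : ∀ s, ψ s = ⊥
  · rw [sublinearExpectation_bot x fun ω => sublinearExpectation_bot (X t ω) hbot]
    exact bot_le
  push Not at hbot
  obtain ⟨s₀, hs₀⟩ := hbot
  refine iSup₂_le fun P hP => le_of_forall_lt fun e he => ?_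
  obtain ⟨c, hec, hc⟩ := EReal.lt_iff_exists_real_btwn.1 he
  refine hec.trans_le ?_
  obtain ⟨h0, β, hβ⟩ := (mem_R_iff ha hb hV).1 hP
  set P₀ : Measure (PathSpace d) := (P : Measure (PathSpace d)) with hP₀
  have hX : Measurable (X (d := d) t) := (continuous_X t).measurable
  have hprob : IsProbabilityMeasure (P₀.map (X t)) :=
    Measure.isProbabilityMeasure_map hX.aemeasurable
  have hG := upperSemianalytic_sublinearExpectation ha hb hV hψ
  have hc' : (c : EReal) < extIntegral (P₀.map (X t)) fun y => sublinearExpectation b a y ψ := by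
    rw [extIntegral_map hX (hG.aemeasurable _)]
    exact hc
  obtain ⟨g, hgm, hgi, hgψ, hcg⟩ :=
    exists_integrable_lt_of_lt_extIntegral (hG.aemeasurable _) hc'
  obtain ⟨Q, σ, hQ, hσ, hsel⟩ := exists_kernel_lt_extIntegral ha hb hV hψ hs₀ hgm hgψ
  have hstart : ∀ᵐ y ∂(P₀.map (X t)), ∀ᵐ ω ∂(Q y), X 0 ω = y := hsel.mono fun y h => h.1.1
  have hB : Measurable fun p : E d × ℝ≥0 × PathSpace d => codedControl K (σ p.1) p.2.1 p.2.2 :=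
    (measurable_codedControl K).comp
      (f := fun p : E d × ℝ≥0 × PathSpace d => (σ p.1, p.2)) (by fun_prop)
  have hlaw := isControlledLaw_glueLaw (B := fun y => codedControl K (σ y)) ha hV hβ hB
    (fun y => nonanticipating_codedControl K _) (hsel.mono fun y h => h.1)
  have hmem : (⟨glueLaw t P₀ Q, inferInstance⟩ : ProbabilityMeasure (PathSpace d)) ∈ R b a x :=
    (mem_R_iff ha hb hV).2 ⟨ae_glueLaw_X_zero h0, _, hlaw⟩
  have hmap := map_shift_glueLaw hstart
  have hψm : AEMeasurable ψ ((glueLaw t P₀ Q).map (shift t)) := hψ.aemeasurable _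
  have hneg : AEMeasurable (fun s => (-ψ s).toENNReal) ((glueLaw t P₀ Q).map (shift t)) :=
    hψm.neg.ereal_toENNReal
  -- The existence hypothesis is applied to the glued law, which is why it is required under every
  -- element of `R b a x`.
  have hval := integral_le_extIntegral_bind (hψ.aemeasurable _) hgi
    (hsel.mono fun y h => h.2.le) (by
      rw [← hmap, lintegral_map' hψm.ereal_toENNReal (measurable_shift t).aemeasurable,
        lintegral_map' hneg (measurable_shift t).aemeasurable]
      exact hex _ hmem)
  rw [← hmap, extIntegral_map (measurable_shift t) hψm] at hval
  exact (EReal.coe_lt_coe_iff.2 hcg).le.trans (hval.trans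
    (le_iSup₂ (f := fun (P : ProbabilityMeasure (PathSpace d)) (_ : P ∈ R b a x) =>
      expectation P (ψ ∘ shift t)) _ hmem))

end DynamicProgramming

end NonlinearDiffusion

end

theorem proposition2p5 {d : ℕ} {F : Type*} [TopologicalSpace F]
    [TopologicalSpace.MetrizableSpace F]
    (b : F × NonlinearDiffusion.E d → NonlinearDiffusion.E d)
    (a : NonlinearDiffusion.E d → Matrix (Fin d) (Fin d) ℝ)
    (ha : ∀ x, (a x).PosSemidef)
    (hba : NonlinearDiffusion.BoundedElliptic b a)
    (ψ : NonlinearDiffusion.PathSpace d → EReal)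
    (hψ : NonlinearDiffusion.UpperSemianalytic ψ)
    (t : ℝ≥0) (x : NonlinearDiffusion.E d) :
    NonlinearDiffusion.UpperSemianalytic (fun ω : NonlinearDiffusion.PathSpace d =>
      NonlinearDiffusion.sublinearExpectation b a (NonlinearDiffusion.X t ω) ψ) ∧
    ((∀ P ∈ NonlinearDiffusion.R b a x,
        NonlinearDiffusion.ExpectationExists P (ψ ∘ NonlinearDiffusion.shift t)) →
      NonlinearDiffusion.sublinearExpectation b a x (ψ ∘ NonlinearDiffusion.shift t) =
        NonlinearDiffusion.sublinearExpectation b a x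
          (fun ω => NonlinearDiffusion.sublinearExpectation b a
            (NonlinearDiffusion.X t ω) ψ)) := by
  open NonlinearDiffusion in
  -- For empty `F` the bounds on `a` are vacuous, so this case is separate: there are no laws and
  -- all suprema are `-∞`.
  rcases isEmpty_or_nonempty F with hF | hF
  · have hbot : ∀ (y : E d) (φ : PathSpace d → EReal), sublinearExpectation b a y φ = ⊥ :=
      fun y φ => by simp [sublinearExpectation, R_eq_empty]
    exact ⟨upperSemianalytic_bot fun ω => hbot _ _, fun _ => by rw [hbot, hbot]⟩
  · have := hba.compact
    obtain ⟨K, haK, hbK⟩ := hba.exists_bound ha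
    have hV : MeasurableSet (driftSet b) := (isClosed_driftSet hba.continuous_b).measurableSet
    exact ⟨(upperSemianalytic_sublinearExpectation haK hbK hV hψ).comp (continuous_X t),
      fun hex => le_antisymm (sublinearExpectation_shift_le haK hbK hV hψ)
        (sublinearExpectation_le_shift haK hbK hV hψ hex)⟩
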